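/- Let $G=(X\times Y,A\times B,\mu,V)$ be a two-player one-round game with finite question sets $X,Y$, finite answer sets $A,B$, question distribution $\mu$ on $X\times Y$ and predicate $V$. Let $M$ and $P$ be finite bipartite graphs on vertex classes $(X',X)$ and $(Y',Y)$ in which every $x\in X$ and every $y\in Y$ has at least one neighbour; write $N(\cdot)$ for neighbourhoods and put $l=\max\{\max_{x'\in X'}|N(x')|,\ \max_{y'\in Y'}|N(y')|\}$ and $[l]=\{1,\dots,l\}$. In the *ordered concatenation* $G'_{OF}$ the referee samples $(x,y)\sim\mu$, then independent uniformly random neighbours $x'\in N(x)$ and $y'\in N(y)$, and then a uniformly random pair of injective maps $r:N(x')\to[l]$, $s:N(y')\to[l]$ subject to $r(x)=s(y)$. The players receive $(x',r)$ and $(y',s)$, answer with maps $a':N(x')\to A$ and $b':N(y')\to B$, and win if $V(a'(x),b'(y),x,y)=1$. A *quantum substrategy* for a game consists of $d\in\mathbb N$, a unit vector $|\psi\rangle\in\mathbb C^d\otimes\mathbb C^d$ and positive semidefinite $d\times d$ matrices $A_q^a$, $B_w^b$ (for the questions $q,w$ and answers $a,b$) with $A_q:=\sum_a A_q^a\le \mathrm{Id}$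 and $B_w:=\sum_b B_w^b\le \mathrm{Id}$; it is a *complete strategy* if all these are equalities. Its value $\mathrm{val}^*(\text{game},|\psi\rangle,\{A_q^a\},\{B_w^b\})$ is the expectation over the referee's choices of the sum of $\langle\psi|A_q^a\otimes B_w^b|\psi\rangle$ over the winning answer pairs $(a,b)$, and the entangled value $\mathrm{val}^*$ of the game is the supremum of the values of the complete strategies. (1) We have $\mathrm{val}^*(G'_{OF})=\mathrm{val}^*(G)$. (2) Let $\varepsilon,\delta\in[0,1]$. Suppose that $G$ is biregular (both marginals of $\mu$ are uniform) and that $M$ and $P$ are $\lambda$-spectral expanders, where $M$ is a $\lambda$-spectral expander if every $x\in X$ has the same number $d$ of neighbours and the second-largest singular value of the matrix with entries $\frac1d\sqrt{\frac{1/|X|}{|N(x')|/(d|X|)}}$ for $x'\in N(x)$, and $0$ otherwise, is at most $\lambda$ (similarly for $P$). If $$\lambda\le\frac{\varepsilon^2\delta}{56}\qquad\text{and}\qquad 1\le\Big(\frac{\varepsilon^2\delta}{56}\Big)^2\min\{|X|,|Y|\},$$ then $G'_{OF}$ is $(\varepsilon,\delta)$-weakly fortified against entangled substrategies, as a concatenated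 game with inner game $G^{\oplus l}$: here $G^{\oplus l}$ is the disjoint union of $l$ copies of $G$ (a uniformly random $i\in[l]$ is told to both players together with the questions $(x,y)\sim\mu$), and the assertion is that every quantum substrategy for $G'_{OF}$ satisfies $$\mathrm{val}^*\big(G'_{OF},|\psi\rangle,\{A_{(x',r)}^{a'}\},\{B_{(y',s)}^{b'}\}\big)\le\big(\mathrm{val}^*(G^{\oplus l})+\varepsilon\big)\cdot\mathop{\mathbb E}_{(x,y)\sim\mu,\ i\in[l]}\langle\psi|A_{(x,i)}\otimes B_{(y,i)}|\psi\rangle+\delta ,$$ where $A_{(x,i)}$ is the average of $A_{(x',r)}$ over a uniformly random $x'\in N(x)$ and a uniformly random injective $r:N(x')\to[l]$ with $r(x)=i$, and $B_{(y,i)}$ is defined in the same way. -/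

import Mathlib

open scoped Kronecker ComplexOrder Matrix

/-! ### Two-player games and entangled strategies -/

/-- A two-player one-round game with finite question sets `X`, `Y` and answer sets `A`, `B`: a
probability distribution `μ` on the question pairs and a verification predicate `V`. -/
structure Game (X Y A B : Type*) [Fintype X] [Fintype Y] where
  μ : X → Y → ℝ
  μ_nonneg : ∀ x y, 0 ≤ μ x y
  μ_sum : ∑ x, ∑ y, μ x y = 1
  V : A → B → X → Y → Prop

/-- A two-player one-round game in which the verdict may also depend on a private variable `t : T`
of the referee, and the set of admissible answers may depend on the question. The referee samples
`(t, x, y)` with probability `prob t x y`, sends `x` and `y` to the players, and checks `V`. -/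
structure RefereedGame (T X Y : Type*) (A : X → Type*) (B : Y → Type*)
    [Fintype T] [Fintype X] [Fintype Y] where
  prob : T → X → Y → ℝ
  prob_nonneg : ∀ t x y, 0 ≤ prob t x y
  prob_sum : ∑ t, ∑ x, ∑ y, prob t x y = 1
  V : T → (x : X) → (y : Y) → A x → B y → Prop

/-- An ordinary game is a refereed game without private variable. -/
def Game.toRefereed {X Y A B : Type*} [Fintype X] [Fintype Y] (G : Game X Y A B) :
    RefereedGame Unit X Y (fun _ => A) (fun _ => B) where
  prob := fun _ x y => G.μ x y
  prob_nonneg := fun _ x y => G.μ_nonneg x y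
  prob_sum := by simpa using G.μ_sum
  V := fun _ x y a b => G.V a b x y

/-- A quantum (entangled) substrategy: a unit vector `ψ ∈ ℂ^d ⊗ ℂ^d` and positive semidefinite
matrices `PA x a`, `PB y b` on `ℂ^d` with `∑ a, PA x a ≤ 1` and `∑ b, PB y b ≤ 1`. -/
structure QuantumSubstrategy (X Y : Type*) (A : X → Type*) (B : Y → Type*)
    [∀ x, Fintype (A x)] [∀ y, Fintype (B y)] where
  dim : ℕ
  ψ : Fin dim × Fin dim → ℂ
  ψ_unit : star ψ ⬝ᵥ ψ = 1
  PA : (x : X) → A x → Matrix (Fin dim) (Fin dim) ℂ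
  PB : (y : Y) → B y → Matrix (Fin dim) (Fin dim) ℂ
  PA_psd : ∀ x a, (PA x a).PosSemidef
  PB_psd : ∀ y b, (PB y b).PosSemidef
  PA_le : ∀ x, (1 - ∑ a, PA x a).PosSemidef
  PB_le : ∀ y, (1 - ∑ b, PB y b).PosSemidef

namespace QuantumSubstrategy

variable {X Y : Type*} {A : X → Type*} {B : Y → Type*}
  [∀ x, Fintype (A x)] [∀ y, Fintype (B y)]

/-- A complete strategy: all measurements are complete. -/
def IsComplete (S : QuantumSubstrategy X Y A B) : Prop :=
  (∀ x, ∑ a, S.PA x a = 1) ∧ ∀ y, ∑ b, S.PB y b = 1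

/-- `⟨ψ| P ⊗ Q |ψ⟩` (a real number when `P` and `Q` are Hermitian). -/
noncomputable def expect (S : QuantumSubstrategy X Y A B)
    (P Q : Matrix (Fin S.dim) (Fin S.dim) ℂ) : ℝ :=
  (star S.ψ ⬝ᵥ ((P ⊗ₖ Q) *ᵥ S.ψ)).re

/-- The total operator `∑ a, PA x a` of the first player on question `x`. -/
noncomputable def totalA (S : QuantumSubstrategy X Y A B) (x : X) :
    Matrix (Fin S.dim) (Fin S.dim) ℂ := ∑ a, S.PA x a

/-- The total operator `∑ b, PB y b` of the second player on question `y`. -/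
noncomputable def totalB (S : QuantumSubstrategy X Y A B) (y : Y) :
    Matrix (Fin S.dim) (Fin S.dim) ℂ := ∑ b, S.PB y b

end QuantumSubstrategy

namespace RefereedGame

variable {T X Y : Type*} {A : X → Type*} {B : Y → Type*}
  [Fintype T] [Fintype X] [Fintype Y] [∀ x, Fintype (A x)] [∀ y, Fintype (B y)]

open Classical in
/-- The value of a quantum substrategy in the game. -/
noncomputable def value (H : RefereedGame T X Y A B) (S : QuantumSubstrategy X Y A B) : ℝ :=
  ∑ t, ∑ x, ∑ y, H.prob t x y *
    ∑ a, ∑ b, if H.V t x y a b then S.expect (S.PA x a) (S.PB y b) else 0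

/-- The entangled value: the supremum of the values of all complete strategies. -/
noncomputable def entangledValue (H : RefereedGame T X Y A B) : ℝ :=
  sSup {v | ∃ S : QuantumSubstrategy X Y A B, S.IsComplete ∧ H.value S = v}

/-- Weak `(ε, δ)`-fortification against entangled substrategies of an outer game `H` whose questions
`x'`, `y'` are sampled, given the questions `(x, y)` of the inner game `G`, independently with
probabilities `κ x x'` and `ρ y y'`. The operators
`∑ x', κ x x' • ∑ a', PA x' a'` and `∑ y', ρ y y' • ∑ b', PB y' b'`
are the total operators of the induced substrategy for `G`. -/
def WeaklyFortified {Xi Yi Ai Bi : Type*} [Fintype Xi] [Fintype Yi] [Fintype Ai] [Fintype Bi]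
    (H : RefereedGame T X Y A B) (G : Game Xi Yi Ai Bi) (κ : Xi → X → ℝ) (ρ : Yi → Y → ℝ)
    (ε δ : ℝ) : Prop :=
  ∀ S : QuantumSubstrategy X Y A B,
    H.value S ≤
      (G.toRefereed.entangledValue + ε) *
        (∑ x, ∑ y, G.μ x y *
          S.expect (∑ x', (κ x x' : ℂ) • S.totalA x') (∑ y', (ρ y y' : ℂ) • S.totalB y'))
      + δ

end RefereedGame

namespace Game

variable {X Y A B : Type*} [Fintype X] [Fintype Y]

/-- The entangled value of a game. -/
noncomputable def entangledValue [Fintype A] [Fintype B] (G : Game X Y A B) : ℝ :=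
  G.toRefereed.entangledValue

/-- Both marginals of the question distribution are uniform. -/
def IsBiregular (G : Game X Y A B) : Prop :=
  (∀ x, ∑ y, G.μ x y = 1 / (Fintype.card X : ℝ)) ∧
    ∀ y, ∑ x, G.μ x y = 1 / (Fintype.card Y : ℝ)

/-- The disjoint union of `l ≥ 1` copies of `G`: the referee picks a uniformly random copy `i`, and
both players are told `i` together with their question of that copy. -/
noncomputable def disjointCopies (G : Game X Y A B) (l : ℕ) (hl : 0 < l) :
    Game (X × Fin l) (Y × Fin l) A B where
  μ := fun p q => if p.2 = q.2 then G.μ p.1 q.1 / l else 0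
  μ_nonneg := fun p q => by
    have := G.μ_nonneg p.1 q.1
    split_ifs <;> positivity
  μ_sum := by
    have hl' : (l : ℝ) ≠ 0 := by positivity
    simp only [Fintype.sum_prod_type, Finset.sum_ite_eq, Finset.mem_univ, if_true,
      Finset.sum_const, Finset.card_univ, Fintype.card_fin, nsmul_eq_mul]
    simp only [div_eq_mul_inv, ← Finset.sum_mul, ← Finset.mul_sum]
    rw [G.μ_sum]
    field_simp
  V := fun a b p q => G.V a b p.1 q.1

end Game

/-! ### Bipartite graphs and spectral expanders -/

/-- A (finite, simple) bipartite graph on the vertex classes `X'` and `X`, given by its edges. -/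
abbrev BipGraph (X' X : Type*) := Finset (X' × X)

namespace BipGraph

variable {X' X : Type*} [Fintype X'] [Fintype X] [DecidableEq X'] [DecidableEq X]

/-- The neighbourhood `N(x') ⊆ X` of a vertex `x' ∈ X'`. -/
def nbr (M : BipGraph X' X) (x' : X') : Finset X := Finset.univ.filter fun x => (x', x) ∈ M

/-- The neighbourhood `N(x) ⊆ X'` of a vertex `x ∈ X`. -/
def conbr (M : BipGraph X' X) (x : X) : Finset X' := Finset.univ.filter fun x' => (x', x) ∈ M

lemma mem_nbr {M : BipGraph X' X} {x' : X'} {x : X} (h : (x', x) ∈ M) : x ∈ M.nbr x' := by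
  simpa [nbr] using h

/-- The largest size of a neighbourhood `N(x')`, `x' ∈ X'`. -/
def maxDeg (M : BipGraph X' X) : ℕ := Finset.univ.sup fun x' => (M.nbr x').card

/-- The normalized adjacency matrix of a graph in which each `x ∈ X` has `d` neighbours, that is
`(1 / d) * √(μ x / μ' x')` on edges and `0` elsewhere, where `μ x = 1 / |X|` and
`μ' x' = |N(x')| / (d * |X|)` is the law of a random neighbour of a uniformly random `x`. -/
noncomputable def normalizedAdj (M : BipGraph X' X) (d : ℕ) : Matrix X X' ℝ := fun x x' =>
  if (x', x) ∈ M then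
    (1 / (d : ℝ)) *
      √((1 / (Fintype.card X : ℝ)) / (((M.nbr x').card : ℝ) / ((d : ℝ) * Fintype.card X)))
  else 0

/-- A `lam`-spectral expander: each `x ∈ X` has exactly `d` neighbours, and the second-largest
singular value of the normalized adjacency matrix `ℓ₂(X') → ℓ₂(X)` is at most `lam`. (Singular
values are indexed from `0`, with multiplicity, and continued by zeros.) -/
def IsSpectralExpander (M : BipGraph X' X) (d : ℕ) (lam : ℝ) : Prop :=
  (∀ x, (M.conbr x).card = d) ∧
    (Matrix.toEuclideanLin (M.normalizedAdj d)).singularValues 1 ≤ lam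

/-- A question of the ordered concatenation: a vertex `x'` with an injective labeling of `N(x')` by
`l` labels. -/
abbrev OrdQuestion (M : BipGraph X' X) (l : ℕ) : Type _ := Σ x' : X', (M.nbr x' ↪ Fin l)

/-- An answer to the question `(x', r)`: a map `N(x') → A`. -/
abbrev OrdAnswer (M : BipGraph X' X) (l : ℕ) (A : Type*) (q : M.OrdQuestion l) : Type _ :=
  M.nbr q.1 → A

/-- The probability of the question `(x', r)` in the ordered concatenation given the true question
`x` and its label `i`: a uniformly random neighbour `x'` of `x`, and then a uniformly random
injective `r : N(x') → [l]` among those with `r x = i`. -/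
noncomputable def ordKernel (M : BipGraph X' X) (l : ℕ) (p : X × Fin l) (q : M.OrdQuestion l) :
    ℝ :=
  if h : (q.1, p.1) ∈ M then
    if q.2 ⟨p.1, mem_nbr h⟩ = p.2 then
      1 / (M.conbr p.1).card *
        (1 / Fintype.card {r : M.nbr q.1 ↪ Fin l // r ⟨p.1, mem_nbr h⟩ = p.2})
    else 0
  else 0

end BipGraph

/-! ### The ordered concatenation -/

section OrderedConcatenation

variable {X Y X' Y' A B : Type*} [Fintype X] [Fintype Y] [Fintype X'] [Fintype Y']
  [DecidableEq X] [DecidableEq Y] [DecidableEq X'] [DecidableEq Y']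

/-- The number of labels: `l = max (max |N(x')|) (max |N(y')|)`. -/
def labelCount (M : BipGraph X' X) (P : BipGraph Y' Y) : ℕ := max M.maxDeg P.maxDeg

/-- The probability of `(x, y)`, `(x', r)`, `(y', s)` in the ordered concatenation: `(x, y)` is drawn
from the game, `x'` and `y'` are independent uniformly random neighbours of `x` and `y`, and `(r, s)`
is uniformly random among the pairs of injective labelings with `r x = s y`. -/
noncomputable def ordProb (G : Game X Y A B) (M : BipGraph X' X) (P : BipGraph Y' Y) (l : ℕ)
    (t : X × Y) (q : M.OrdQuestion l) (w : P.OrdQuestion l) : ℝ :=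
  if h : (q.1, t.1) ∈ M ∧ (w.1, t.2) ∈ P then
    if q.2 ⟨t.1, BipGraph.mem_nbr h.1⟩ = w.2 ⟨t.2, BipGraph.mem_nbr h.2⟩ then
      G.μ t.1 t.2 * (1 / (M.conbr t.1).card) * (1 / (P.conbr t.2).card) *
        (1 / Fintype.card {rs : (M.nbr q.1 ↪ Fin l) × (P.nbr w.1 ↪ Fin l) //
          rs.1 ⟨t.1, BipGraph.mem_nbr h.1⟩ = rs.2 ⟨t.2, BipGraph.mem_nbr h.2⟩})
    else 0
  else 0

lemma card_nbr_le_maxDeg (M : BipGraph X' X) (x' : X') : (M.nbr x').card ≤ M.maxDeg :=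
  Finset.le_sup (f := fun x' => (M.nbr x').card) (Finset.mem_univ x')

lemma Game.nonempty_questions (G : Game X Y A B) : Nonempty X := by
  by_contra h
  rw [not_nonempty_iff] at h
  simpa using G.μ_sum

lemma labelCount_pos (G : Game X Y A B) (M : BipGraph X' X) (P : BipGraph Y' Y)
    (hM : ∀ x, (M.conbr x).Nonempty) : 0 < labelCount M P := by
  obtain ⟨x⟩ := G.nonempty_questions
  obtain ⟨x', hx'⟩ := hM x
  have hx : x ∈ M.nbr x' := BipGraph.mem_nbr (by simpa [BipGraph.conbr] using hx')
  have h1 : 0 < (M.nbr x').card := Finset.card_pos.2 ⟨x, hx⟩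
  exact lt_of_lt_of_le h1 ((card_nbr_le_maxDeg M x').trans (le_max_left _ _))

/-- Matching pairs of labelings exist. -/
lemma exists_matching_labelings {α β : Type*} [Fintype α] [Fintype β] {l : ℕ}
    (hα : Fintype.card α ≤ l) (hβ : Fintype.card β ≤ l) (a : α) (b : β) :
    Nonempty {rs : (α ↪ Fin l) × (β ↪ Fin l) // rs.1 a = rs.2 b} := by
  classical
  obtain ⟨r⟩ := Function.Embedding.nonempty_of_card_le (α := α) (β := Fin l) (by simpa using hα)
  obtain ⟨s⟩ := Function.Embedding.nonempty_of_card_le (α := β) (β := Fin l) (by simpa using hβ)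
  exact ⟨⟨(r, s.trans (Equiv.swap (s b) (r a)).toEmbedding), by simp⟩⟩

lemma sum_ordProb (G : Game X Y A B) (M : BipGraph X' X) (P : BipGraph Y' Y) (l : ℕ)
    (hl : labelCount M P ≤ l)
    (hM : ∀ x, (M.conbr x).Nonempty) (hP : ∀ y, (P.conbr y).Nonempty) (t : X × Y) :
    ∑ q, ∑ w, ordProb G M P l t q w = G.μ t.1 t.2 := by
  have key : ∀ x' y', ∑ r : (M.nbr x' ↪ Fin l), ∑ s : (P.nbr y' ↪ Fin l),
      ordProb G M P l t ⟨x', r⟩ ⟨y', s⟩ =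
      if (x', t.1) ∈ M ∧ (y', t.2) ∈ P then
        G.μ t.1 t.2 * (1 / (M.conbr t.1).card) * (1 / (P.conbr t.2).card) else 0 := by
    intro x' y'
    by_cases h : (x', t.1) ∈ M ∧ (y', t.2) ∈ P
    · have hne := exists_matching_labelings (l := l)
        (α := M.nbr x') (β := P.nbr y')
        (by simpa using ((card_nbr_le_maxDeg M x').trans (le_max_left _ _)).trans hl)
        (by simpa using ((card_nbr_le_maxDeg P y').trans (le_max_right _ _)).trans hl)
        ⟨t.1, BipGraph.mem_nbr h.1⟩ ⟨t.2, BipGraph.mem_nbr h.2⟩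
      rw [if_pos h]
      simp only [ordProb, dif_pos h]
      rw [← Fintype.sum_prod_type' (f := fun (r : (M.nbr x' ↪ Fin l)) (s : (P.nbr y' ↪ Fin l)) =>
        if r ⟨t.1, BipGraph.mem_nbr h.1⟩ = s ⟨t.2, BipGraph.mem_nbr h.2⟩ then
          G.μ t.1 t.2 * (1 / (M.conbr t.1).card : ℝ) * (1 / (P.conbr t.2).card) *
          (1 / Fintype.card {rs : (M.nbr x' ↪ Fin l) × (P.nbr y' ↪ Fin l) //
          rs.1 ⟨t.1, BipGraph.mem_nbr h.1⟩ = rs.2 ⟨t.2, BipGraph.mem_nbr h.2⟩}) else 0)]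
      rw [← Finset.sum_filter, Finset.sum_const, nsmul_eq_mul, ← Fintype.card_subtype]
      have hc := Fintype.card_pos_iff.2 hne
      have hc' : (Fintype.card {rs : (M.nbr x' ↪ Fin l) × (P.nbr y' ↪ Fin l) //
          rs.1 ⟨t.1, BipGraph.mem_nbr h.1⟩ = rs.2 ⟨t.2, BipGraph.mem_nbr h.2⟩} : ℝ) ≠ 0 := by
        exact_mod_cast hc.ne'
      rw [mul_comm, mul_assoc, one_div_mul_cancel hc', mul_one]
    · rw [if_neg h]
      simp [ordProb, dif_neg h]
  have h1 : ∑ q, ∑ w, ordProb G M P l t q w = ∑ x', ∑ y',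
      if (x', t.1) ∈ M ∧ (y', t.2) ∈ P then
        G.μ t.1 t.2 * (1 / (M.conbr t.1).card : ℝ) * (1 / (P.conbr t.2).card) else 0 := by
    rw [Fintype.sum_sigma]
    refine Finset.sum_congr rfl fun x' _ => ?_
    rw [Finset.sum_comm, Fintype.sum_sigma]
    refine Finset.sum_congr rfl fun y' _ => ?_
    rw [Finset.sum_comm]
    exact key x' y'
  rw [h1]
  have hcM : ((M.conbr t.1).card : ℝ) ≠ 0 := by
    exact_mod_cast (Finset.card_pos.2 (hM t.1)).ne'
  have hcP : ((P.conbr t.2).card : ℝ) ≠ 0 := by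
    exact_mod_cast (Finset.card_pos.2 (hP t.2)).ne'
  simp only [ite_and, Finset.sum_ite_irrel, Finset.sum_const_zero]
  simp only [← Finset.sum_filter, Finset.sum_const, nsmul_eq_mul]
  change ((M.conbr t.1).card : ℝ) * (((P.conbr t.2).card : ℝ) * _) = _
  field_simp

/-- The ordered concatenation of the game `G` with the bipartite graphs `M` and `P`. The private
variable of the referee is the pair `(x, y)` of true questions. -/
noncomputable def orderedConcat (G : Game X Y A B) (M : BipGraph X' X) (P : BipGraph Y' Y)
    (hM : ∀ x, (M.conbr x).Nonempty) (hP : ∀ y, (P.conbr y).Nonempty) :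
    RefereedGame (X × Y) (M.OrdQuestion (labelCount M P)) (P.OrdQuestion (labelCount M P))
      (M.OrdAnswer (labelCount M P) A) (P.OrdAnswer (labelCount M P) B) where
  prob := ordProb G M P (labelCount M P)
  prob_nonneg := fun t q w => by
    have := G.μ_nonneg t.1 t.2
    unfold ordProb
    split_ifs <;> positivity
  prob_sum := by
    simp only [sum_ordProb G M P _ le_rfl hM hP]
    rw [Fintype.sum_prod_type]
    exact G.μ_sum
  V := fun t q w a b => ∃ (hx : t.1 ∈ M.nbr q.1) (hy : t.2 ∈ P.nbr w.1),
    G.V (a ⟨t.1, hx⟩) (b ⟨t.2, hy⟩) t.1 t.2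

/-- Weak `(ε, δ)`-fortification against entangled substrategies of the ordered concatenation, seen as
the concatenation whose inner game is the disjoint union of `l` copies of `G` and whose inner
questions are the true questions together with their labels, `(x, r x)` and `(y, s y)`. -/
def OrderedConcatWeaklyFortified [Fintype A] [Fintype B]
    (G : Game X Y A B) (M : BipGraph X' X) (P : BipGraph Y' Y)
    (hM : ∀ x, (M.conbr x).Nonempty) (hP : ∀ y, (P.conbr y).Nonempty) (ε δ : ℝ) : Prop :=
  (orderedConcat G M P hM hP).WeaklyFortified
    (G.disjointCopies (labelCount M P) (labelCount_pos G M P hM))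
    (M.ordKernel (labelCount M P)) (P.ordKernel (labelCount M P)) ε δ

end OrderedConcatenation

/-! Everything rests on one identity. Given the true questions and their common label i, the two
sides of the ordered concatenation are independent (`ordProb_eq_sum`). So averaging a player's
operators over the outer questions and keeping only the answer at the true question turns a
substrategy for the concatenation into one for the disjoint union of l copies of G, with exactly the
same value (`value_orderedConcat`).

Equality of values. If the strategy is complete, so is the induced one, and fixing the label i
leaves a complete strategy for G; hence the concatenation is worth at most G. Conversely, the
players share l copies of the state of a strategy for G and, on question (x', r), measure copy r(z)
as if asked z, for every z in N(x'). Injectivity of r makes these measurements compatible, and r(x)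
= s(y) means that the answers to the true questions come from the same copy
(`value_le_entangledValue_orderedConcat`).

Fortification has two ingredients.

Concentration: the induced totals A_p, p = (x, i), are on average close to their mean A₀ in the norm
‖(A_p - A₀) ⊗ 1 ψ‖. It suffices to treat real functions, and by duality to bound the transposed
averaging operator on functions h(x, i) of mean zero. Write h as its average over labels plus a part
of mean zero in i for each x. The expander contracts the first part. On the second, distinct points
of a random injection are nearly uncorrelated, and neighbourhoods in an expander of large vertex
class are large on average (`BipGraph.IsSpectralExpander.sum_sq_sum_labeled_le`).

Rounding: let R be the square root of A₀ + τ. Each A_p + τ factors as K*K with K close to R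
(`exists_factor_near_sqrt`), and conjugating the submeasurement by the inverse of K makes it
complete once the spare τ is assigned to some answer. With K, L and R, R' for the two players, the
submeasurements on ψ are dominated by complete ones on (K ⊗ L)ψ, a vector near φ = (R ⊗ R')ψ. Since
φ does not depend on the questions, the complete measurements earn at most val* times ‖φ‖², and ‖φ‖²
is about ⟨A₀ ⊗ B₀⟩, which concentration compares with the average of ⟨A_p ⊗ B_p'⟩
(`Game.value_le_of_concentration`). The choice τ = δ/8 balances the errors. -/

set_option linter.unusedSectionVars false

/-! ### Quadratic forms, the Löwner order and perturbation of square roots -/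

section QuadraticForms

open scoped MatrixOrder

variable {n m : Type*} [Fintype n] [Fintype m] [DecidableEq n] [DecidableEq m]

/-- The real part of `⟨ψ, W ψ⟩`, as a linear function of the matrix `W`. -/
noncomputable def quadForm (ψ : n → ℂ) : Matrix n n ℂ →ₗ[ℝ] ℝ where
  toFun W := (star ψ ⬝ᵥ (W *ᵥ ψ)).re
  map_add' W W' := by simp [Matrix.add_mulVec]
  map_smul' c W := by simp [Matrix.smul_mulVec]

lemma quadForm_apply (ψ : n → ℂ) (W : Matrix n n ℂ) :
    quadForm ψ W = (star ψ ⬝ᵥ (W *ᵥ ψ)).re := rfl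

lemma quadForm_nonneg (ψ : n → ℂ) {W : Matrix n n ℂ} (hW : 0 ≤ W) : 0 ≤ quadForm ψ W := by
  have h := (Matrix.nonneg_iff_posSemidef.1 hW).dotProduct_mulVec_nonneg ψ
  exact (Complex.le_def.1 h).1

lemma quadForm_mono (ψ : n → ℂ) {W W' : Matrix n n ℂ} (hW : W ≤ W') :
    quadForm ψ W ≤ quadForm ψ W' := by
  have h := quadForm_nonneg ψ (sub_nonneg.2 hW)
  rw [map_sub] at h
  linarith

lemma quadForm_mulVec (ψ : n → ℂ) (N : Matrix m n ℂ) (W : Matrix m m ℂ) :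
    quadForm (N *ᵥ ψ) W = quadForm ψ (Nᴴ * W * N) := by
  simp only [quadForm_apply, Matrix.star_mulVec, ← Matrix.mulVec_mulVec,
    Matrix.dotProduct_mulVec, Matrix.vecMul_vecMul, Matrix.mul_assoc]

lemma quadForm_one (ψ : n → ℂ) : quadForm ψ 1 = ∑ i, ‖ψ i‖ ^ 2 := by
  simp only [quadForm_apply, Matrix.one_mulVec, dotProduct, Complex.re_sum]
  refine Finset.sum_congr rfl fun i _ => ?_
  rw [Pi.star_apply, Complex.star_def, ← Complex.normSq_eq_conj_mul_self, Complex.ofReal_re,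
    Complex.normSq_eq_norm_sq]

lemma quadForm_smul (c : ℝ) (ψ : n → ℂ) (W : Matrix n n ℂ) :
    quadForm ((c : ℂ) • ψ) W = c ^ 2 * quadForm ψ W := by
  simp only [quadForm_apply, Matrix.mulVec_smul, star_smul, smul_dotProduct, dotProduct_smul]
  simp [sq, mul_assoc]

/-- With x = u - v, positivity of the form at c v - x bounds the cross terms by c⟨v, Wv⟩ + ⟨x, Wx⟩ /
c. A small c keeps the factor of the main term near 1, which the crude factor 2 would not. -/
lemma quadForm_le_add (u v : n → ℂ) {W : Matrix n n ℂ} (hW : 0 ≤ W) {c : ℝ} (hc : 0 < c) :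
    quadForm u W ≤ (1 + c) * quadForm v W + (1 + 1 / c) * quadForm (u - v) W := by
  set x := u - v with hx
  have hu : u = v + x := by rw [hx]; abel
  have h := quadForm_nonneg ((c : ℂ) • v - x) hW
  rw [hu]
  simp only [quadForm_apply, Matrix.mulVec_smul, Matrix.mulVec_add, Matrix.mulVec_sub, star_sub,
    star_add, star_smul, smul_dotProduct, dotProduct_smul, dotProduct_add, add_dotProduct,
    dotProduct_sub, sub_dotProduct, Complex.add_re, Complex.sub_re] at h ⊢
  simp at h
  set a := (star v ⬝ᵥ W *ᵥ v).re
  set b := (star x ⬝ᵥ W *ᵥ x).re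
  set p := (star x ⬝ᵥ W *ᵥ v).re
  set q := (star v ⬝ᵥ W *ᵥ x).re
  have h2 : p + q ≤ c * a + 1 / c * b := by
    have h3 : 0 ≤ c * (c * a) - c * p - (c * q - b) := by linarith
    have h4 : c * (p + q) ≤ c * (c * a + 1 / c * b) := by
      have : c * (c * a + 1 / c * b) = c * (c * a) + b := by field_simp
      rw [this]; linarith
    exact le_of_mul_le_mul_left h4 hc
  linarith

/-- The parallelogram law: the difference of the two sides is (X - Y)*(X - Y). -/
lemma conjTranspose_mul_self_add_le (X Y : Matrix m n ℂ) :
    (X + Y)ᴴ * (X + Y) ≤ (2 : ℝ) • (Xᴴ * X) + (2 : ℝ) • (Yᴴ * Y) := by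
  rw [Matrix.le_iff]
  have h : (2 : ℝ) • (Xᴴ * X) + (2 : ℝ) • (Yᴴ * Y) - (X + Y)ᴴ * (X + Y)
      = (X - Y)ᴴ * (X - Y) := by
    simp only [Matrix.conjTranspose_add, Matrix.conjTranspose_sub, Matrix.add_mul, Matrix.mul_add,
      Matrix.sub_mul, Matrix.mul_sub, two_smul]
    abel
  rw [h]
  exact Matrix.posSemidef_conjTranspose_mul_self _

lemma kronecker_nonneg {P : Matrix n n ℂ} {Q : Matrix m m ℂ} (hP : 0 ≤ P) (hQ : 0 ≤ Q) :
    0 ≤ P ⊗ₖ Q :=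
  ((Matrix.nonneg_iff_posSemidef.1 hP).kronecker (Matrix.nonneg_iff_posSemidef.1 hQ)).nonneg

lemma kronecker_sub (P : Matrix n n ℂ) (Q Q' : Matrix m m ℂ) :
    P ⊗ₖ (Q - Q') = P ⊗ₖ Q - P ⊗ₖ Q' := by
  ext; simp [Matrix.kroneckerMap_apply, mul_sub]

lemma sub_kronecker (P P' : Matrix n n ℂ) (Q : Matrix m m ℂ) :
    (P - P') ⊗ₖ Q = P ⊗ₖ Q - P' ⊗ₖ Q := by
  ext; simp [Matrix.kroneckerMap_apply, sub_mul]

lemma kronecker_mono_right {P : Matrix n n ℂ} {Q Q' : Matrix m m ℂ} (hP : 0 ≤ P) (hQ : Q ≤ Q') :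
    P ⊗ₖ Q ≤ P ⊗ₖ Q' := by
  rw [← sub_nonneg, ← kronecker_sub]
  exact kronecker_nonneg hP (sub_nonneg.2 hQ)

lemma kronecker_mono_left {P P' : Matrix n n ℂ} {Q : Matrix m m ℂ} (hP : P ≤ P') (hQ : 0 ≤ Q) :
    P ⊗ₖ Q ≤ P' ⊗ₖ Q := by
  rw [← sub_nonneg, ← sub_kronecker]
  exact kronecker_nonneg (sub_nonneg.2 hP) hQ

lemma kronecker_mono {P P' : Matrix n n ℂ} {Q Q' : Matrix m m ℂ} (hP0 : 0 ≤ P') (hQ0 : 0 ≤ Q)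
    (hP : P ≤ P') (hQ : Q ≤ Q') : P ⊗ₖ Q ≤ P' ⊗ₖ Q' :=
  (kronecker_mono_left hP hQ0).trans (kronecker_mono_right hP0 hQ)

lemma sum_kronecker {ι : Type*} (s : Finset ι) (P : ι → Matrix n n ℂ) (Q : Matrix m m ℂ) :
    (∑ i ∈ s, P i) ⊗ₖ Q = ∑ i ∈ s, P i ⊗ₖ Q := by
  ext; simp [Matrix.kroneckerMap_apply, Matrix.sum_apply, Finset.sum_mul]

lemma kronecker_sum {ι : Type*} (s : Finset ι) (P : Matrix n n ℂ) (Q : ι → Matrix m m ℂ) :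
    P ⊗ₖ (∑ i ∈ s, Q i) = ∑ i ∈ s, P ⊗ₖ Q i := by
  ext; simp [Matrix.kroneckerMap_apply, Matrix.sum_apply, Finset.mul_sum]

/-- A positive definite matrix near another one has a factorization near the square root of the
latter. -/
lemma exists_factor_near_sqrt {D D₀ R : Matrix n n ℂ} {τ : ℝ} (hτ : 0 < τ)
    (hD : D.PosDef) (hR : R.PosDef) (hRR : R * R = D₀) (hD₀ : τ • (1 : Matrix n n ℂ) ≤ D₀) :
    ∃ K : Matrix n n ℂ, IsUnit K ∧ Kᴴ * K = D ∧
      (K - R)ᴴ * (K - R) ≤ τ⁻¹ • ((D - D₀)ᴴ * (D - D₀)) := by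
  have hRu : IsUnit R.det := (Matrix.isUnit_iff_isUnit_det _).1 hR.isUnit
  have hRh : Rᴴ = R := hR.isHermitian
  have hIh : (R⁻¹)ᴴ = R⁻¹ := by rw [Matrix.conjTranspose_nonsing_inv, hRh]
  have hDh : Dᴴ = D := hD.isHermitian
  have hD₀h : D₀ᴴ = D₀ := by rw [← hRR, Matrix.conjTranspose_mul, hRh]
  have h1 : R * R⁻¹ = 1 := Matrix.mul_nonsing_inv _ hRu
  have h2 : R⁻¹ * R = 1 := Matrix.nonsing_inv_mul _ hRu
  have hS : (R⁻¹ * D * R⁻¹).PosSemidef := by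
    have := hD.posSemidef.conjTranspose_mul_mul_same R⁻¹
    rwa [hIh] at this
  -- The factor is K = H R with H the square root of R⁻¹ D R⁻¹, rather than the square root of D.
  -- Then (H² - 1) R = R⁻¹ (D - D₀), so the error is controlled vector by vector by D - D₀, with no
  -- loss in the dimension.
  set T := R⁻¹ * D * R⁻¹ with hT
  set H := CFC.sqrt T with hH
  have hH0 : 0 ≤ H := CFC.sqrt_nonneg T
  have hHh : Hᴴ = H := (Matrix.nonneg_iff_posSemidef.1 hH0).isHermitian
  have hHH : H * H = T := CFC.sqrt_mul_sqrt_self T hS.nonneg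
  have hRTR : R * T * R = D := by
    rw [hT]
    calc R * (R⁻¹ * D * R⁻¹) * R = (R * R⁻¹) * D * (R⁻¹ * R) := by simp only [Matrix.mul_assoc]
      _ = D := by rw [h1, h2]; simp
  have hKK : (H * R)ᴴ * (H * R) = D := by
    rw [Matrix.conjTranspose_mul, hHh, hRh, ← hRTR, ← hHH]
    simp only [Matrix.mul_assoc]
  refine ⟨H * R, ?_, hKK, ?_⟩
  · rw [Matrix.isUnit_iff_isUnit_det]
    have : IsUnit ((H * R)ᴴ.det * (H * R).det) := by
      rw [← Matrix.det_mul, hKK]; exact (Matrix.isUnit_iff_isUnit_det _).1 hD.isUnit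
    exact isUnit_of_mul_isUnit_right this
  · have hTR : (T - 1) * R = R⁻¹ * (D - D₀) := by
      rw [Matrix.sub_mul, Matrix.mul_sub, ← hRR, ← Matrix.mul_assoc R⁻¹ R R, h2, hT]
      rw [Matrix.mul_assoc _ R⁻¹ R, h2, Matrix.mul_one]
    -- T - 1 = (H - 1)(H + 1) and (H + 1)² = 1 + (H² + 2H) ≥ 1, so the gap is (H - 1)(H² + 2H)(H -
    -- 1) conjugated by R.
    have step1 : (H * R - R)ᴴ * (H * R - R) ≤ ((T - 1) * R)ᴴ * ((T - 1) * R) := by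
      have e1 : H * R - R = (H - 1) * R := by rw [Matrix.sub_mul, Matrix.one_mul]
      have hpos : 0 ≤ H * H + (2 : ℝ) • H := by
        refine add_nonneg ?_ (smul_nonneg (by norm_num) hH0)
        rw [hHH]; exact hS.nonneg
      rw [← sub_nonneg]
      have e2 : ((T - 1) * R)ᴴ * ((T - 1) * R) - (H * R - R)ᴴ * (H * R - R)
          = ((H - 1) * R)ᴴ * (H * H + (2 : ℝ) • H) * ((H - 1) * R) := by
        rw [e1, ← hHH]
        simp only [Matrix.conjTranspose_mul, Matrix.conjTranspose_sub, hHh, hRh,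
          Matrix.conjTranspose_one, two_smul]
        noncomm_ring
      rw [e2]
      exact ((Matrix.nonneg_iff_posSemidef.1 hpos).conjTranspose_mul_mul_same _).nonneg
    refine step1.trans ?_
    rw [hTR, Matrix.conjTranspose_mul, hIh]
    have hinv : R⁻¹ * R⁻¹ ≤ τ⁻¹ • (1 : Matrix n n ℂ) := by
      rw [← sub_nonneg]
      have e3 : τ⁻¹ • (1 : Matrix n n ℂ) - R⁻¹ * R⁻¹
          = τ⁻¹ • ((R⁻¹)ᴴ * (D₀ - τ • (1 : Matrix n n ℂ)) * R⁻¹) := by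
        rw [hIh, Matrix.mul_sub, Matrix.sub_mul, ← hRR]
        rw [show R⁻¹ * (R * R) * R⁻¹ = (R⁻¹ * R) * (R * R⁻¹) by simp only [Matrix.mul_assoc]]
        rw [h1, h2, Matrix.one_mul, smul_sub]
        simp only [Matrix.mul_smul, Matrix.smul_mul, Matrix.mul_one, smul_smul]
        rw [inv_mul_cancel₀ hτ.ne', one_smul]
      rw [e3]
      refine smul_nonneg (by positivity) ?_
      exact ((Matrix.le_iff.1 hD₀).conjTranspose_mul_mul_same _).nonneg
    rw [← sub_nonneg]
    have e4 : τ⁻¹ • ((D - D₀)ᴴ * (D - D₀)) - (D - D₀)ᴴ * R⁻¹ * (R⁻¹ * (D - D₀))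
        = (D - D₀)ᴴ * (τ⁻¹ • (1 : Matrix n n ℂ) - R⁻¹ * R⁻¹) * (D - D₀) := by
      simp only [Matrix.mul_sub, Matrix.sub_mul, Matrix.mul_smul, Matrix.smul_mul, Matrix.mul_one,
        Matrix.mul_assoc, smul_sub]
      abel
    rw [e4]
    exact ((Matrix.le_iff.1 hinv).conjTranspose_mul_mul_same _).nonneg

end QuadraticForms

/-! ### Operators of winning answer pairs -/

section WinningOperators

open scoped MatrixOrder

variable {n m A B : Type*} [Fintype n] [Fintype m] [DecidableEq n] [DecidableEq m]
  [Fintype A] [Fintype B]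

open Classical in
/-- The operator `∑ M a ⊗ N b` over the winning answer pairs `(a, b)`. -/
noncomputable def winOp (V : A → B → Prop) (M : A → Matrix n n ℂ) (N : B → Matrix m m ℂ) :
    Matrix (n × m) (n × m) ℂ :=
  ∑ a, ∑ b, if V a b then M a ⊗ₖ N b else 0

lemma winOp_nonneg (V : A → B → Prop) {M : A → Matrix n n ℂ} {N : B → Matrix m m ℂ}
    (hM : ∀ a, 0 ≤ M a) (hN : ∀ b, 0 ≤ N b) : 0 ≤ winOp V M N := by
  refine Finset.sum_nonneg fun a _ => Finset.sum_nonneg fun b _ => ?_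
  split_ifs
  · exact kronecker_nonneg (hM a) (hN b)
  · exact le_rfl

lemma winOp_le_kronecker_sum (V : A → B → Prop) {M : A → Matrix n n ℂ} {N : B → Matrix m m ℂ}
    (hM : ∀ a, 0 ≤ M a) (hN : ∀ b, 0 ≤ N b) : winOp V M N ≤ (∑ a, M a) ⊗ₖ (∑ b, N b) := by
  rw [sum_kronecker]
  refine Finset.sum_le_sum fun a _ => ?_
  rw [kronecker_sum]
  refine Finset.sum_le_sum fun b _ => ?_
  split_ifs
  · exact le_rfl
  · exact kronecker_nonneg (hM a) (hN b)

lemma winOp_mono (V : A → B → Prop) {M M' : A → Matrix n n ℂ} {N N' : B → Matrix m m ℂ}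
    (hM : ∀ a, 0 ≤ M' a) (hN : ∀ b, 0 ≤ N b) (hMM : ∀ a, M a ≤ M' a) (hNN : ∀ b, N b ≤ N' b) :
    winOp V M N ≤ winOp V M' N' := by
  refine Finset.sum_le_sum fun a _ => Finset.sum_le_sum fun b _ => ?_
  split_ifs
  · exact kronecker_mono (hM a) (hN b) (hMM a) (hNN b)
  · exact le_rfl

/-- Moves a local change of the measurements onto the state: together with `quadForm_mulVec`, the
conjugated measurements on ψ score as the original ones on (K ⊗ L)ψ. -/
lemma conjTranspose_mul_winOp_mul (V : A → B → Prop) (M : A → Matrix n n ℂ)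
    (N : B → Matrix m m ℂ) (K : Matrix n n ℂ) (L : Matrix m m ℂ) :
    (K ⊗ₖ L)ᴴ * winOp V M N * (K ⊗ₖ L)
      = winOp V (fun a => Kᴴ * M a * K) (fun b => Lᴴ * N b * L) := by
  simp only [winOp, Finset.mul_sum, Finset.sum_mul]
  refine Finset.sum_congr rfl fun a _ => Finset.sum_congr rfl fun b _ => ?_
  split_ifs
  · rw [Matrix.conjTranspose_kronecker, ← Matrix.mul_kronecker_mul, ← Matrix.mul_kronecker_mul]
  · simp

end WinningOperators

/-! ### Bounds on values of strategies -/

section Values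

open scoped MatrixOrder

variable {T X Y : Type*} {A : X → Type*} {B : Y → Type*}
  [Fintype T] [Fintype X] [Fintype Y] [∀ x, Fintype (A x)] [∀ y, Fintype (B y)]

lemma QuantumSubstrategy.expect_eq_quadForm (S : QuantumSubstrategy X Y A B)
    (P Q : Matrix (Fin S.dim) (Fin S.dim) ℂ) : S.expect P Q = quadForm S.ψ (P ⊗ₖ Q) := rfl

lemma QuantumSubstrategy.quadForm_one (S : QuantumSubstrategy X Y A B) :
    quadForm S.ψ 1 = 1 := by
  rw [quadForm_apply, Matrix.one_mulVec, S.ψ_unit, Complex.one_re]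

lemma RefereedGame.value_eq_winOp (H : RefereedGame T X Y A B) (S : QuantumSubstrategy X Y A B) :
    H.value S = ∑ t, ∑ x, ∑ y, H.prob t x y *
      quadForm S.ψ (winOp (H.V t x y) (S.PA x) (S.PB y)) := by
  simp only [RefereedGame.value, winOp, map_sum]
  refine Finset.sum_congr rfl fun t _ => Finset.sum_congr rfl fun x _ =>
    Finset.sum_congr rfl fun y _ => ?_
  congr 1
  refine Finset.sum_congr rfl fun a _ => Finset.sum_congr rfl fun b _ => ?_
  split_ifs
  · rfl
  · simp

lemma RefereedGame.value_nonneg (H : RefereedGame T X Y A B) (S : QuantumSubstrategy X Y A B) :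
    0 ≤ H.value S := by
  rw [H.value_eq_winOp]
  exact Finset.sum_nonneg fun t _ => Finset.sum_nonneg fun x _ => Finset.sum_nonneg fun y _ =>
    mul_nonneg (H.prob_nonneg t x y) (quadForm_nonneg _
      (winOp_nonneg _ (fun a => (S.PA_psd x a).nonneg) (fun b => (S.PB_psd y b).nonneg)))

lemma RefereedGame.value_le_one (H : RefereedGame T X Y A B) (S : QuantumSubstrategy X Y A B)
    (hS : S.IsComplete) : H.value S ≤ 1 := by
  rw [H.value_eq_winOp, ← H.prob_sum]
  refine Finset.sum_le_sum fun t _ => Finset.sum_le_sum fun x _ => Finset.sum_le_sum fun y _ => ?_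
  refine mul_le_of_le_one_right (H.prob_nonneg t x y) ?_
  refine (quadForm_mono _ (winOp_le_kronecker_sum _ (fun a => (S.PA_psd x a).nonneg)
    (fun b => (S.PB_psd y b).nonneg))).trans ?_
  rw [hS.1 x, hS.2 y, Matrix.one_kronecker_one, S.quadForm_one]

lemma RefereedGame.value_le_entangledValue (H : RefereedGame T X Y A B)
    (S : QuantumSubstrategy X Y A B) (hS : S.IsComplete) : H.value S ≤ H.entangledValue := by
  refine le_csSup ⟨1, ?_⟩ ⟨S, hS, rfl⟩
  rintro v ⟨S', hS', rfl⟩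
  exact H.value_le_one S' hS'

lemma RefereedGame.entangledValue_nonneg (H : RefereedGame T X Y A B) : 0 ≤ H.entangledValue := by
  refine Real.sSup_nonneg ?_
  rintro v ⟨S', hS', rfl⟩
  exact H.value_nonneg S'

lemma RefereedGame.entangledValue_le_one (H : RefereedGame T X Y A B) : H.entangledValue ≤ 1 := by
  refine Real.sSup_le ?_ zero_le_one
  rintro v ⟨S', hS', rfl⟩
  exact H.value_le_one S' hS'

/-- Complete measurements on an unnormalized state. -/
lemma RefereedGame.sum_winOp_le (H : RefereedGame T X Y A B) {d : ℕ} (φ : Fin d × Fin d → ℂ)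
    (M : (x : X) → A x → Matrix (Fin d) (Fin d) ℂ) (N : (y : Y) → B y → Matrix (Fin d) (Fin d) ℂ)
    (hM : ∀ x a, 0 ≤ M x a) (hN : ∀ y b, 0 ≤ N y b)
    (hM1 : ∀ x, ∑ a, M x a = 1) (hN1 : ∀ y, ∑ b, N y b = 1) :
    ∑ t, ∑ x, ∑ y, H.prob t x y * quadForm φ (winOp (H.V t x y) (M x) (N y))
      ≤ H.entangledValue * quadForm φ 1 := by
  -- Both sides are homogeneous of degree two in φ, so φ may be normalized unless it vanishes.
  rcases eq_or_ne (quadForm φ 1) 0 with h0 | h0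
  · have hφ : φ = 0 := by
      rw [quadForm_one, Finset.sum_eq_zero_iff_of_nonneg (fun _ _ => by positivity)] at h0
      funext i
      simpa using h0 i (Finset.mem_univ i)
    rw [hφ]
    simp [quadForm_apply]
  · have hpos : 0 < quadForm φ 1 :=
      lt_of_le_of_ne (quadForm_nonneg _ Matrix.PosSemidef.one.nonneg) (Ne.symm h0)
    set s := quadForm φ 1 with hs
    let ψ : Fin d × Fin d → ℂ := (((√s)⁻¹ : ℝ) : ℂ) • φ
    have hscale : ∀ W, quadForm ψ W = s⁻¹ * quadForm φ W := by
      intro W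
      rw [quadForm_smul, inv_pow, Real.sq_sqrt hpos.le]
    have hunit : star ψ ⬝ᵥ ψ = 1 := by
      have h1 := hscale 1
      rw [← hs, inv_mul_cancel₀ h0, quadForm_apply, Matrix.one_mulVec] at h1
      refine Complex.ext h1 ?_
      exact (Complex.le_def.1 (dotProduct_star_self_nonneg ψ)).2.symm
    let S : QuantumSubstrategy X Y A B :=
      { dim := d, ψ := ψ, ψ_unit := hunit, PA := M, PB := N
        PA_psd := fun x a => Matrix.nonneg_iff_posSemidef.1 (hM x a)
        PB_psd := fun x a => Matrix.nonneg_iff_posSemidef.1 (hN x a)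
        PA_le := fun x => by rw [hM1, sub_self]; exact Matrix.PosSemidef.zero
        PB_le := fun x => by rw [hN1, sub_self]; exact Matrix.PosSemidef.zero }
    have h := H.value_le_entangledValue S ⟨hM1, hN1⟩
    rw [H.value_eq_winOp] at h
    change ∑ t, ∑ x, ∑ y, H.prob t x y * quadForm ψ (winOp (H.V t x y) (M x) (N y)) ≤ _ at h
    simp only [hscale, mul_left_comm _ s⁻¹, ← Finset.mul_sum] at h
    rwa [inv_mul_le_iff₀ hpos, mul_comm s] at h

end Values

/-! ### Rounding submeasurements to complete measurements -/

section Rounding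

open scoped MatrixOrder

variable {n : Type*} [Fintype n] [DecidableEq n]

/-- Rounding sub-measurements whose totals are near `A₀` to complete measurements. -/
lemma exists_complete_measurements {Q A : Type*} [Fintype A] [Nonempty A]
    (E : Q → A → Matrix n n ℂ) (hE : ∀ q a, 0 ≤ E q a) {A₀ : Matrix n n ℂ} (hA₀ : 0 ≤ A₀)
    {τ : ℝ} (hτ : 0 < τ) :
    ∃ (R : Matrix n n ℂ) (K : Q → Matrix n n ℂ) (M : Q → A → Matrix n n ℂ),
      Rᴴ * R = A₀ + τ • 1 ∧ (∀ q, (K q)ᴴ * K q = ∑ a, E q a + τ • 1) ∧ (∀ q a, 0 ≤ M q a) ∧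
      (∀ q, ∑ a, M q a = 1) ∧ (∀ q a, E q a ≤ (K q)ᴴ * M q a * K q) ∧
      ∀ q, (K q - R)ᴴ * (K q - R) ≤ τ⁻¹ • ((∑ a, E q a - A₀)ᴴ * (∑ a, E q a - A₀)) := by
  classical
  obtain ⟨a₀⟩ := ‹Nonempty A›
  have hτ1 : (τ • (1 : Matrix n n ℂ)).PosDef := Matrix.PosDef.one.smul hτ
  have hC₀ : (A₀ + τ • (1 : Matrix n n ℂ)).PosDef :=
    Matrix.PosDef.posSemidef_add (Matrix.nonneg_iff_posSemidef.1 hA₀) hτ1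
  have hC : ∀ q, (∑ a, E q a + τ • (1 : Matrix n n ℂ)).PosDef := fun q =>
    Matrix.PosDef.posSemidef_add (Matrix.nonneg_iff_posSemidef.1
      (Finset.sum_nonneg fun a _ => hE q a)) hτ1
  set R := CFC.sqrt (A₀ + τ • (1 : Matrix n n ℂ)) with hRdef
  have hR0 : 0 ≤ R := CFC.sqrt_nonneg _
  have hRR : R * R = A₀ + τ • (1 : Matrix n n ℂ) := CFC.sqrt_mul_sqrt_self _ hC₀.posSemidef.nonneg
  have hRu : IsUnit R := by
    have h := hC₀.isUnit
    rw [← hRR, Matrix.isUnit_iff_isUnit_det, Matrix.det_mul] at h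
    exact (Matrix.isUnit_iff_isUnit_det _).2 (isUnit_of_mul_isUnit_left h)
  have hR : R.PosDef := (Matrix.nonneg_iff_posSemidef.1 hR0).posDef_iff_isUnit.2 hRu
  have hle : τ • (1 : Matrix n n ℂ) ≤ A₀ + τ • (1 : Matrix n n ℂ) := le_add_of_nonneg_left hA₀
  choose K hKu hKK hKR using fun q => exists_factor_near_sqrt hτ (hC q) hR hRR hle
  have hKdet : ∀ q, IsUnit (K q).det := fun q => (Matrix.isUnit_iff_isUnit_det _).1 (hKu q)
  have hKi : ∀ q, (K q)⁻¹ * K q = 1 := fun q => Matrix.nonsing_inv_mul _ (hKdet q)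
  have hKi' : ∀ q, K q * (K q)⁻¹ = 1 := fun q => Matrix.mul_nonsing_inv _ (hKdet q)
  -- The regularization τ, needed for invertibility, is given to an arbitrary answer. The total
  -- becomes K*K exactly, and the enlarged operators still dominate E.
  let F : Q → A → Matrix n n ℂ := fun q a => E q a + if a = a₀ then τ • 1 else 0
  have hEF : ∀ q a, E q a ≤ F q a := fun q a => by
    refine le_add_of_nonneg_right ?_
    split_ifs
    · exact hτ1.posSemidef.nonneg
    · exact le_rfl
  have hFsum : ∀ q, ∑ a, F q a = ∑ a, E q a + τ • 1 := fun q => by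
    simp [F, Finset.sum_add_distrib]
  have hadj : ∀ q, (K q)ᴴ * ((K q)⁻¹)ᴴ = 1 := fun q => by
    rw [← Matrix.conjTranspose_mul, hKi, Matrix.conjTranspose_one]
  refine ⟨R, K, fun q a => ((K q)⁻¹)ᴴ * F q a * (K q)⁻¹, ?_, hKK, ?_, ?_, ?_, ?_⟩
  · rw [hR.isHermitian.eq, hRR]
  · intro q a
    exact ((Matrix.nonneg_iff_posSemidef.1 ((hE q a).trans (hEF q a))).conjTranspose_mul_mul_same
      _).nonneg
  · intro q
    rw [← Finset.sum_mul, ← Finset.mul_sum, hFsum, ← hKK]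
    rw [show ((K q)⁻¹)ᴴ * ((K q)ᴴ * K q) * (K q)⁻¹ = (K q * (K q)⁻¹)ᴴ * (K q * (K q)⁻¹) by
      rw [Matrix.conjTranspose_mul]; simp only [Matrix.mul_assoc]]
    rw [hKi']; simp
  · intro q a
    have : (K q)ᴴ * (((K q)⁻¹)ᴴ * F q a * (K q)⁻¹) * K q
        = ((K q)ᴴ * ((K q)⁻¹)ᴴ) * F q a * ((K q)⁻¹ * K q) := by simp only [Matrix.mul_assoc]
    rw [this, hadj, hKi]
    simpa using hEF q a
  · intro q
    have h := hKR q
    rwa [add_sub_add_right_eq_sub] at h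

end Rounding

/-! ### Value of a substrategy with concentrated totals -/

section Concentration

open scoped MatrixOrder

variable {n m : Type*} [Fintype n] [Fintype m] [DecidableEq n] [DecidableEq m]

/-- Change one tensor factor at a time: K ⊗ L - R ⊗ R' = (K - R) ⊗ L + R ⊗ (L - R'). The factor left
alone has square at most 1 + τ, and the factor 2 comes from squaring a sum. -/
lemma quadForm_kronecker_sub_le (ψ : n × m → ℂ) {K R ΔA : Matrix n n ℂ} {L R' ΔB C : Matrix m m ℂ}
    {A₀ : Matrix n n ℂ} {τ : ℝ} (hτ : 0 < τ)
    (hR : Rᴴ * R = A₀ + τ • 1) (hA₀ : A₀ ≤ 1) (hL : Lᴴ * L = C + τ • 1) (hC : C ≤ 1)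
    (hK : (K - R)ᴴ * (K - R) ≤ τ⁻¹ • (ΔAᴴ * ΔA))
    (hLR : (L - R')ᴴ * (L - R') ≤ τ⁻¹ • (ΔBᴴ * ΔB)) :
    quadForm ((K ⊗ₖ L) *ᵥ ψ - (R ⊗ₖ R') *ᵥ ψ) 1
      ≤ 2 * (τ⁻¹ * (1 + τ)) * (quadForm ψ ((ΔAᴴ * ΔA) ⊗ₖ 1) + quadForm ψ (1 ⊗ₖ (ΔBᴴ * ΔB))) := by
  have hsplit : K ⊗ₖ L - R ⊗ₖ R' = (K - R) ⊗ₖ L + R ⊗ₖ (L - R') := by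
    rw [sub_kronecker, kronecker_sub]; abel
  have hA1 : Rᴴ * R ≤ (1 + τ) • 1 := by
    rw [hR, add_smul, one_smul]; exact add_le_add_left hA₀ _
  have hC1 : Lᴴ * L ≤ (1 + τ) • 1 := by
    rw [hL, add_smul, one_smul]; exact add_le_add_left hC _
  have h1 : ((K - R) ⊗ₖ L)ᴴ * ((K - R) ⊗ₖ L) ≤ (τ⁻¹ * (1 + τ)) • ((ΔAᴴ * ΔA) ⊗ₖ 1) := by
    rw [Matrix.conjTranspose_kronecker, ← Matrix.mul_kronecker_mul]
    refine (kronecker_mono ?_ ?_ hK hC1).trans_eq ?_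
    · exact smul_nonneg (by positivity) (Matrix.posSemidef_conjTranspose_mul_self _).nonneg
    · exact (Matrix.posSemidef_conjTranspose_mul_self _).nonneg
    · rw [Matrix.smul_kronecker, Matrix.kronecker_smul, smul_smul]
  have h2 : (R ⊗ₖ (L - R'))ᴴ * (R ⊗ₖ (L - R')) ≤ (τ⁻¹ * (1 + τ)) • (1 ⊗ₖ (ΔBᴴ * ΔB)) := by
    rw [Matrix.conjTranspose_kronecker, ← Matrix.mul_kronecker_mul]
    refine (kronecker_mono ?_ ?_ hA1 hLR).trans_eq ?_
    · exact smul_nonneg (by positivity) Matrix.PosSemidef.one.nonneg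
    · exact (Matrix.posSemidef_conjTranspose_mul_self _).nonneg
    · rw [Matrix.smul_kronecker, Matrix.kronecker_smul, smul_smul, mul_comm τ⁻¹]
  rw [← Matrix.sub_mulVec, hsplit, quadForm_mulVec, Matrix.mul_one]
  refine (quadForm_mono ψ (conjTranspose_mul_self_add_le _ _)).trans ?_
  have h1' := quadForm_mono ψ h1
  have h2' := quadForm_mono ψ h2
  simp only [map_add, map_smul, smul_eq_mul] at h1' h2' ⊢
  linarith

/-- Twice the difference of the two sides is the square of P ⊗ 1 + 1 ⊗ Q. This separates correlated
deviations of the two players into one-sided ones. -/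
lemma neg_kronecker_le {P : Matrix n n ℂ} {Q : Matrix m m ℂ} (hP : Pᴴ = P) (hQ : Qᴴ = Q) :
    -(P ⊗ₖ Q) ≤ (2⁻¹ : ℝ) • ((Pᴴ * P) ⊗ₖ 1 + 1 ⊗ₖ (Qᴴ * Q)) := by
  rw [← sub_nonneg]
  have h : (2⁻¹ : ℝ) • ((Pᴴ * P) ⊗ₖ (1 : Matrix m m ℂ) + (1 : Matrix n n ℂ) ⊗ₖ (Qᴴ * Q))
      - -(P ⊗ₖ Q) = (2⁻¹ : ℝ) • ((P ⊗ₖ 1 + 1 ⊗ₖ Q)ᴴ * (P ⊗ₖ 1 + 1 ⊗ₖ Q)) := by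
    simp only [Matrix.conjTranspose_add, Matrix.conjTranspose_kronecker, Matrix.conjTranspose_one,
      hP, hQ, Matrix.add_mul, Matrix.mul_add, ← Matrix.mul_kronecker_mul, Matrix.one_mul,
      Matrix.mul_one]
    module
  rw [h]
  exact smul_nonneg (by norm_num) (Matrix.posSemidef_conjTranspose_mul_self _).nonneg

variable {Q W A B : Type*} [Fintype Q] [Fintype W] [Fintype A] [Fintype B]

/-- If the totals of a substrategy are concentrated around their averages, then its value is at most
the entangled value times the probability that both players answer, up to an error. -/
theorem Game.value_le_of_concentration [Nonempty A] [Nonempty B] (Γ : Game Q W A B)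
    (S : QuantumSubstrategy Q W (fun _ => A) (fun _ => B))
    {A₀ B₀ : Matrix (Fin S.dim) (Fin S.dim) ℂ}
    (hA₀ : ∑ q, ∑ w, Γ.μ q w • S.totalA q = A₀) (hB₀ : ∑ q, ∑ w, Γ.μ q w • S.totalB w = B₀)
    {ε τ kA kB : ℝ} (hε : 0 < ε) (hτ : 0 < τ)
    (hkA : ∑ q, ∑ w, Γ.μ q w *
      quadForm S.ψ (((S.totalA q - A₀)ᴴ * (S.totalA q - A₀)) ⊗ₖ 1) ≤ kA)
    (hkB : ∑ q, ∑ w, Γ.μ q w *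
      quadForm S.ψ (1 ⊗ₖ ((S.totalB w - B₀)ᴴ * (S.totalB w - B₀))) ≤ kB) :
    Γ.toRefereed.value S ≤
      (Γ.toRefereed.entangledValue + ε) *
        (∑ q, ∑ w, Γ.μ q w * S.expect (S.totalA q) (S.totalB w) + 2⁻¹ * (kA + kB)
          + (2 * τ + τ ^ 2))
      + (1 + 1 / ε) * (2 * (τ⁻¹ * (1 + τ)) * (kA + kB)) := by
  have hμ := Γ.μ_nonneg
  have hμ1 := Γ.μ_sum
  have hPA : ∀ q a, 0 ≤ S.PA q a := fun q a => (S.PA_psd q a).nonneg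
  have hPB : ∀ q a, 0 ≤ S.PB q a := fun q a => (S.PB_psd q a).nonneg
  have hA0 : ∀ q, 0 ≤ S.totalA q := fun q => Finset.sum_nonneg fun a _ => hPA q a
  have hB0 : ∀ q, 0 ≤ S.totalB q := fun q => Finset.sum_nonneg fun a _ => hPB q a
  have hA1 : ∀ q, S.totalA q ≤ 1 := fun q => Matrix.le_iff.2 (S.PA_le q)
  have hB1 : ∀ q, S.totalB q ≤ 1 := fun q => Matrix.le_iff.2 (S.PB_le q)
  have hA₀0 : 0 ≤ A₀ := hA₀ ▸ Finset.sum_nonneg fun q _ => Finset.sum_nonneg fun w _ =>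
    smul_nonneg (hμ q w) (hA0 q)
  have hB₀0 : 0 ≤ B₀ := hB₀ ▸ Finset.sum_nonneg fun q _ => Finset.sum_nonneg fun w _ =>
    smul_nonneg (hμ q w) (hB0 w)
  have hsum1 : ∑ q, ∑ w, Γ.μ q w • (1 : Matrix (Fin S.dim) (Fin S.dim) ℂ) = 1 := by
    simp only [← Finset.sum_smul, hμ1, one_smul]
  have hA₀1 : A₀ ≤ 1 := by
    rw [← hA₀, ← hsum1]
    exact Finset.sum_le_sum fun q _ => Finset.sum_le_sum fun w _ =>
      smul_le_smul_of_nonneg_left (hA1 q) (hμ q w)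
  have hB₀1 : B₀ ≤ 1 := by
    rw [← hB₀, ← hsum1]
    exact Finset.sum_le_sum fun q _ => Finset.sum_le_sum fun w _ =>
      smul_le_smul_of_nonneg_left (hB1 w) (hμ q w)
  obtain ⟨R, K, M, hRR, hKK, hM0, hM1, hEM, hKR⟩ :=
    exists_complete_measurements S.PA hPA hA₀0 hτ
  obtain ⟨R', L, N, hRR', hLL, hN0, hN1, hEN, hLR⟩ :=
    exists_complete_measurements S.PB hPB hB₀0 hτ
  set φ := (R ⊗ₖ R') *ᵥ S.ψ with hφ
  set v := Γ.toRefereed.entangledValue with hv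
  set dA := fun q => quadForm S.ψ (((S.totalA q - A₀)ᴴ * (S.totalA q - A₀)) ⊗ₖ 1) with hdA
  set dB := fun w => quadForm S.ψ (1 ⊗ₖ ((S.totalB w - B₀)ᴴ * (S.totalB w - B₀))) with hdB
  have hv0 : 0 ≤ v := Γ.toRefereed.entangledValue_nonneg
  have hv1 : v ≤ 1 := Γ.toRefereed.entangledValue_le_one
  have hc : 0 ≤ 1 + 1 / ε := by positivity
  -- The submeasurements are dominated by complete ones on (K ⊗ L)ψ, which is then replaced by the
  -- question-independent φ. The replacement costs a factor 1 + ε and 1 + 1/ε times the squared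
  -- distance, because the winning operator is at most 1.
  have hpoint : ∀ q w, quadForm S.ψ (winOp (fun a b => Γ.V a b q w) (S.PA q) (S.PB w)) ≤
      (1 + ε) * quadForm φ (winOp (fun a b => Γ.V a b q w) (M q) (N w))
        + (1 + 1 / ε) * (2 * (τ⁻¹ * (1 + τ)) * (dA q + dB w)) := by
    intro q w
    have hKM : ∀ a, 0 ≤ (K q)ᴴ * M q a * K q := fun a => (hPA q a).trans (hEM q a)
    have hLN : ∀ b, 0 ≤ (L w)ᴴ * N w b * L w := fun b => (hPB w b).trans (hEN w b)
    have h1 := quadForm_mono S.ψ (winOp_mono (fun a b => Γ.V a b q w) hKM (hPB w) (hEM q) (hEN w))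
    rw [← conjTranspose_mul_winOp_mul, ← quadForm_mulVec] at h1
    have h2 := quadForm_le_add ((K q ⊗ₖ L w) *ᵥ S.ψ) φ
      (winOp_nonneg (fun a b => Γ.V a b q w) (hM0 q) (hN0 w)) hε
    have h3 := quadForm_mono ((K q ⊗ₖ L w) *ᵥ S.ψ - φ)
      (winOp_le_kronecker_sum (fun a b => Γ.V a b q w) (hM0 q) (hN0 w))
    rw [hM1, hN1, Matrix.one_kronecker_one] at h3
    have h4 := quadForm_kronecker_sub_le S.ψ hτ hRR hA₀1 (hLL w) (hB1 w) (hKR q) (hLR w)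
    have h5 := mul_le_mul_of_nonneg_left (h3.trans h4) hc
    exact h1.trans (h2.trans (add_le_add_right h5 _))
  have hcomplete : ∑ q, ∑ w, Γ.μ q w * quadForm φ (winOp (fun a b => Γ.V a b q w) (M q) (N w))
      ≤ v * quadForm φ 1 := by
    have h := Γ.toRefereed.sum_winOp_le φ M N hM0 hN0 hM1 hN1
    rw [Fintype.sum_unique] at h
    exact h
  have hnorm : quadForm φ 1 ≤ quadForm S.ψ (A₀ ⊗ₖ B₀) + (2 * τ + τ ^ 2) := by
    rw [hφ, quadForm_mulVec, Matrix.mul_one, Matrix.conjTranspose_kronecker,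
      ← Matrix.mul_kronecker_mul, hRR, hRR']
    have e : (A₀ + τ • (1 : Matrix (Fin S.dim) (Fin S.dim) ℂ)) ⊗ₖ (B₀ + τ • 1)
        = A₀ ⊗ₖ B₀ + τ • (A₀ ⊗ₖ 1) + τ • (1 ⊗ₖ B₀) + τ ^ 2 • 1 := by
      simp only [Matrix.add_kronecker, Matrix.kronecker_add, Matrix.smul_kronecker,
        Matrix.kronecker_smul, Matrix.one_kronecker_one]
      module
    rw [e]
    simp only [map_add, map_smul, smul_eq_mul, S.quadForm_one]
    have h1 : quadForm S.ψ (A₀ ⊗ₖ 1) ≤ 1 := by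
      rw [← S.quadForm_one, ← Matrix.one_kronecker_one]
      exact quadForm_mono _ (kronecker_mono_left hA₀1 Matrix.PosSemidef.one.nonneg)
    have h2 : quadForm S.ψ (1 ⊗ₖ B₀) ≤ 1 := by
      rw [← S.quadForm_one, ← Matrix.one_kronecker_one]
      exact quadForm_mono _ (kronecker_mono_right Matrix.PosSemidef.one.nonneg hB₀1)
    nlinarith
  -- The average of (A_q - A₀) ⊗ (B_w - B₀) is that of A_q ⊗ B_w minus A₀ ⊗ B₀, since A₀ and B₀ are
  -- the means. Correlation of q and w under μ is therefore harmless.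
  have hprod : quadForm S.ψ (A₀ ⊗ₖ B₀) ≤
      ∑ q, ∑ w, Γ.μ q w * S.expect (S.totalA q) (S.totalB w) + 2⁻¹ * (kA + kB) := by
    have hherm : ∀ {Z : Matrix (Fin S.dim) (Fin S.dim) ℂ}, 0 ≤ Z → Zᴴ = Z := fun h =>
      (Matrix.nonneg_iff_posSemidef.1 h).isHermitian
    have hpt : ∀ q w, quadForm S.ψ (S.totalA q ⊗ₖ B₀) + quadForm S.ψ (A₀ ⊗ₖ S.totalB w)
        - quadForm S.ψ (A₀ ⊗ₖ B₀) ≤ S.expect (S.totalA q) (S.totalB w) + 2⁻¹ * (dA q + dB w) := by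
      intro q w
      have h := quadForm_mono S.ψ (neg_kronecker_le (P := S.totalA q - A₀) (Q := S.totalB w - B₀)
        (by rw [Matrix.conjTranspose_sub, hherm (hA0 q), hherm hA₀0])
        (by rw [Matrix.conjTranspose_sub, hherm (hB0 w), hherm hB₀0]))
      rw [map_smul, map_add, sub_kronecker, kronecker_sub, kronecker_sub] at h
      simp only [map_neg, map_sub, smul_eq_mul] at h
      rw [S.expect_eq_quadForm]
      linarith
    have hs := Finset.sum_le_sum fun q (_ : q ∈ Finset.univ) =>
      Finset.sum_le_sum fun w (_ : w ∈ Finset.univ) =>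
        mul_le_mul_of_nonneg_left (hpt q w) (hμ q w)
    have e1 : ∑ q, ∑ w, Γ.μ q w * quadForm S.ψ (S.totalA q ⊗ₖ B₀) = quadForm S.ψ (A₀ ⊗ₖ B₀) := by
      conv_rhs => rw [← hA₀]
      simp only [sum_kronecker, Matrix.smul_kronecker, map_sum, map_smul, smul_eq_mul]
    have e2 : ∑ q, ∑ w, Γ.μ q w * quadForm S.ψ (A₀ ⊗ₖ S.totalB w) = quadForm S.ψ (A₀ ⊗ₖ B₀) := by
      conv_rhs => rw [← hB₀]
      simp only [kronecker_sum, Matrix.kronecker_smul, map_sum, map_smul, smul_eq_mul]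
    simp only [mul_sub, mul_add, Finset.sum_add_distrib, Finset.sum_sub_distrib] at hs
    rw [e1, e2] at hs
    simp only [← Finset.sum_mul, hμ1, mul_left_comm _ (2⁻¹ : ℝ), ← Finset.mul_sum] at hs
    have hkA' : ∑ q, (∑ w, Γ.μ q w) * dA q ≤ kA := by simpa only [Finset.sum_mul] using hkA
    linarith
  have hval : Γ.toRefereed.value S ≤ (1 + ε) * (v * quadForm φ 1)
      + (1 + 1 / ε) * (2 * (τ⁻¹ * (1 + τ)) * (kA + kB)) := by
    rw [Γ.toRefereed.value_eq_winOp]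
    have hs := Finset.sum_le_sum fun q (_ : q ∈ Finset.univ) =>
      Finset.sum_le_sum fun w (_ : w ∈ Finset.univ) =>
        mul_le_mul_of_nonneg_left (hpoint q w) (hμ q w)
    simp only [mul_add (Γ.μ _ _), Finset.sum_add_distrib, mul_left_comm (Γ.μ _ _),
      ← Finset.mul_sum] at hs
    have h1 := mul_le_mul_of_nonneg_left hcomplete (by positivity : 0 ≤ 1 + ε)
    have h2 : (1 + 1 / ε) * (2 * (τ⁻¹ * (1 + τ)) * (∑ q, ∑ w, Γ.μ q w * dA q
        + ∑ q, ∑ w, Γ.μ q w * dB w)) ≤ (1 + 1 / ε) * (2 * (τ⁻¹ * (1 + τ)) * (kA + kB)) := by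
      gcongr
    calc _ = ∑ q, ∑ w, Γ.μ q w *
          quadForm S.ψ (winOp (fun a b => Γ.V a b q w) (S.PA q) (S.PB w)) := by
            simp [Game.toRefereed]
      _ ≤ _ := hs.trans (add_le_add h1 h2)
  have hφ0 : 0 ≤ quadForm φ 1 := quadForm_nonneg _ Matrix.PosSemidef.one.nonneg
  -- The multiplicative loss 1 + ε becomes an additive one because v ≤ 1.
  have h1 : (1 + ε) * (v * quadForm φ 1) ≤ (v + ε) * quadForm φ 1 := by
    nlinarith [mul_nonneg (mul_nonneg hε.le hφ0) (sub_nonneg.2 hv1)]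
  have h2 : (v + ε) * quadForm φ 1 ≤ (v + ε) *
      (∑ q, ∑ w, Γ.μ q w * S.expect (S.totalA q) (S.totalB w) + 2⁻¹ * (kA + kB)
          + (2 * τ + τ ^ 2)) :=
    mul_le_mul_of_nonneg_left (by linarith) (by positivity)
  linarith

end Concentration

/-! ### Contraction by the second singular value -/

section SecondSingularValue

open Module LinearMap

/-- A linear map contracts the orthogonal complement of its top singular vectors by its second
singular value. -/
lemma norm_adjoint_apply_le_singularValues_one {E F : Type*}
    [NormedAddCommGroup E] [InnerProductSpace ℝ E] [FiniteDimensional ℝ E]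
    [NormedAddCommGroup F] [InnerProductSpace ℝ F] [FiniteDimensional ℝ F]
    (T : E →ₗ[ℝ] F) {u v : F} (hu : u ≠ 0) (hTu : T (adjoint T u) = u)
    (h1 : T.singularValues 1 < 1) (huv : inner ℝ u v = 0) :
    ‖adjoint T v‖ ≤ T.singularValues 1 * ‖v‖ := by
  set s := T.singularValues 1 with hs
  have hs0 : 0 ≤ s := T.singularValues_nonneg 1
  set e := adjoint T u with he
  have he0 : e ≠ 0 := fun h => hu (by rw [← hTu, h, map_zero])
  set hsym := T.isSymmetric_adjoint_comp_self
  set b := hsym.eigenvectorBasis rfl with hb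
  have hcoord : ∀ (i : Fin (finrank ℝ E)) (w : E),
      inner ℝ (b i) (adjoint T (T w)) = T.singularValues i ^ 2 * inner ℝ (b i) w := by
    intro i w
    have h := hsym.eigenvectorBasis_apply_self_apply rfl w i
    rw [OrthonormalBasis.repr_apply_apply, OrthonormalBasis.repr_apply_apply] at h
    rw [T.sq_singularValues_fin rfl i]
    exact h
  have hsmall : ∀ i : Fin (finrank ℝ E), (i : ℕ) ≠ 0 → T.singularValues i ≤ s := fun i hi =>
    T.singularValues_antitone (Nat.one_le_iff_ne_zero.2 hi)
  -- The vector e = T*u is fixed by T*T, while the eigenvalues from index 1 on are below 1; hence e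
  -- is a multiple of the eigenvector of index 0.
  have hei : ∀ i : Fin (finrank ℝ E), (i : ℕ) ≠ 0 → inner ℝ (b i) e = 0 := by
    intro i hi
    have h := hcoord i e
    rw [hTu, ← he] at h
    have h2 : (1 - T.singularValues i ^ 2) * inner ℝ (b i) e = 0 := by linarith
    have h3 : T.singularValues i ^ 2 < 1 := by
      have := hsmall i hi
      have h0 := T.singularValues_nonneg i
      nlinarith
    exact (mul_eq_zero.1 h2).resolve_left (by linarith)
  -- Orthogonality to e kills the coordinate of index 0, where the singular value may exceed s.
  have hcontr : ∀ w : E, inner ℝ e w = 0 → ‖T w‖ ^ 2 ≤ s ^ 2 * ‖w‖ ^ 2 := by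
    intro w hw
    have hwi : ∀ i : Fin (finrank ℝ E), (i : ℕ) = 0 → inner ℝ (b i) w = 0 := by
      intro i hi
      have h := b.sum_inner_mul_inner e w
      rw [hw, Finset.sum_eq_single i] at h
      · rcases mul_eq_zero.1 h with h | h
        · exfalso
          apply he0
          have h5 := b.sum_inner_mul_inner e e
          rw [Finset.sum_eq_zero] at h5
          · exact inner_self_eq_zero.1 h5.symm
          · intro j _
            by_cases hj : (j : ℕ) = 0
            · have : j = i := Fin.ext (hj.trans hi.symm)
              rw [this, h, zero_mul]
            · rw [hei j hj, mul_zero]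
        · exact h
      · intro j _ hji
        have hj : (j : ℕ) ≠ 0 := fun hj => hji (Fin.ext (hj.trans hi.symm))
        rw [real_inner_comm, hei j hj, zero_mul]
      · simp
    have h1 : ‖T w‖ ^ 2 = ∑ i : Fin (finrank ℝ E), T.singularValues i ^ 2 * (inner ℝ (b i) w) ^ 2 := by
      rw [← real_inner_self_eq_norm_sq, ← adjoint_inner_right, ← b.sum_inner_mul_inner]
      refine Finset.sum_congr rfl fun i _ => ?_
      rw [hcoord, real_inner_comm]
      ring
    have h2 : ‖w‖ ^ 2 = ∑ i, (inner ℝ (b i) w) ^ 2 := by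
      rw [← real_inner_self_eq_norm_sq, ← b.sum_inner_mul_inner]
      refine Finset.sum_congr rfl fun i _ => ?_
      rw [real_inner_comm]
      ring
    rw [h1, h2, Finset.mul_sum]
    refine Finset.sum_le_sum fun i _ => ?_
    by_cases hi : (i : ℕ) = 0
    · rw [hwi i hi]; simp
    · exact mul_le_mul_of_nonneg_right
        (pow_le_pow_left₀ (T.singularValues_nonneg i) (hsmall i hi) 2) (sq_nonneg _)
  set w := adjoint T v with hw
  have hew : inner ℝ e w = 0 := by
    rw [hw, adjoint_inner_right, hTu, huv]
  have h2 := hcontr w hew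
  -- Passes from T to its adjoint: ‖T*v‖² = ⟨v, T T*v⟩.
  have h3 : ‖w‖ ^ 2 ≤ ‖v‖ * ‖T w‖ := by
    rw [← real_inner_self_eq_norm_sq]
    conv_lhs => rw [hw]
    rw [adjoint_inner_left]
    exact real_inner_le_norm v (T w)
  have h4 : ‖T w‖ ≤ s * ‖w‖ := by
    refine le_of_sq_le_sq ?_ (by positivity)
    rw [mul_pow]; exact h2
  by_cases hw0 : ‖w‖ = 0
  · rw [hw0]; positivity
  · have hpos : 0 < ‖w‖ := lt_of_le_of_ne (norm_nonneg _) (Ne.symm hw0)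
    have h5 : ‖w‖ * ‖w‖ ≤ (s * ‖v‖) * ‖w‖ := by
      nlinarith [mul_le_mul_of_nonneg_left h4 (norm_nonneg v)]
    exact le_of_mul_le_mul_right h5 hpos

end SecondSingularValue

/-! ### Moments of random injections -/

section RandomInjections

variable {α : Type*} [Fintype α] [DecidableEq α] {l : ℕ}

/-- Composing with the transposition of i and j permutes the injections, so the value at a point is
uniformly distributed. -/
lemma card_embedding_eq_apply (a : α) (i j : Fin l) :
    Fintype.card {r : α ↪ Fin l // r a = i} = Fintype.card {r : α ↪ Fin l // r a = j} := by
  refine Fintype.card_congr ?_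
  refine Equiv.subtypeEquiv (Equiv.embeddingCongr (Equiv.refl α) (Equiv.swap i j)) fun r => ?_
  have h : (Equiv.embeddingCongr (Equiv.refl α) (Equiv.swap i j) r) a = Equiv.swap i j (r a) := rfl
  rw [h, Equiv.swap_apply_eq_iff, Equiv.swap_apply_right]

lemma sum_card_embedding_eq_apply (a : α) :
    ∑ i : Fin l, Fintype.card {r : α ↪ Fin l // r a = i} = Fintype.card (α ↪ Fin l) := by
  rw [← Fintype.card_sigma]
  exact Fintype.card_congr (Equiv.sigmaFiberEquiv fun r : α ↪ Fin l => r a)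

lemma mul_card_embedding_eq_apply (a : α) (i : Fin l) :
    l * Fintype.card {r : α ↪ Fin l // r a = i} = Fintype.card (α ↪ Fin l) := by
  rw [← sum_card_embedding_eq_apply a, Finset.sum_congr rfl
    fun j _ => card_embedding_eq_apply a j i]
  simp

lemma sum_embedding_apply (a : α) (f : Fin l → ℝ) :
    l * ∑ r : α ↪ Fin l, f (r a) = Fintype.card (α ↪ Fin l) * ∑ i, f i := by
  have h : ∑ r : α ↪ Fin l, f (r a)
      = ∑ i, (Fintype.card {r : α ↪ Fin l // r a = i} : ℝ) * f i := by
    rw [← Finset.sum_fiberwise (s := Finset.univ) (g := fun r : α ↪ Fin l => r a)]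
    refine Finset.sum_congr rfl fun i _ => ?_
    rw [Finset.sum_congr rfl (g := fun _ => f i)
      (fun r hr => by rw [(Finset.mem_filter.1 hr).2]), Finset.sum_const, nsmul_eq_mul,
      Fintype.card_subtype]
  rw [h, Finset.mul_sum, Finset.mul_sum]
  refine Finset.sum_congr rfl fun i _ => ?_
  rw [← mul_assoc, ← mul_card_embedding_eq_apply a i]
  push_cast
  ring

lemma exists_perm_apply_pair {i j i' j' : Fin l} (h : i ≠ j) (h' : i' ≠ j') :
    ∃ π : Equiv.Perm (Fin l), π i = i' ∧ π j = j' := by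
  refine ⟨Equiv.swap (Equiv.swap i i' j) j' * Equiv.swap i i', ?_, ?_⟩
  · rw [Equiv.Perm.mul_apply, Equiv.swap_apply_left, Equiv.swap_apply_of_ne_of_ne _ h']
    rw [Ne, eq_comm, Equiv.swap_apply_eq_iff, Equiv.swap_apply_right]
    exact fun hj => h hj.symm
  · rw [Equiv.Perm.mul_apply, Equiv.swap_apply_left]

/-- The pair (r a, r b) is uniform over the l(l - 1) ordered pairs of distinct labels, by symmetry
under permutations of the labels. For f of mean zero the sum over all pairs vanishes, so the sum off
the diagonal is minus the sum on it. -/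
lemma sum_embedding_apply_pair {a b : α} (hab : a ≠ b) {f g : Fin l → ℝ} (hf : ∑ i, f i = 0) :
    ∑ r : α ↪ Fin l, f (r a) * g (r b)
      = -((Fintype.card (α ↪ Fin l) : ℝ) / (l * (l - 1)) * ∑ i, f i * g i) := by
  classical
  let c : Fin l → Fin l → ℕ := fun i j =>
    (Finset.univ.filter fun r : α ↪ Fin l => (r a, r b) = (i, j)).card
  have hsum : ∀ F : Fin l → Fin l → ℝ,
      ∑ r : α ↪ Fin l, F (r a) (r b) = ∑ i, ∑ j, (c i j : ℝ) * F i j := by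
    intro F
    rw [← Finset.sum_fiberwise (s := Finset.univ) (g := fun r : α ↪ Fin l => (r a, r b)),
      Fintype.sum_prod_type]
    refine Finset.sum_congr rfl fun i _ => Finset.sum_congr rfl fun j _ => ?_
    rw [Finset.sum_congr rfl (g := fun _ => F i j), Finset.sum_const, nsmul_eq_mul]
    intro r hr
    have := (Finset.mem_filter.1 hr).2
    rw [Prod.mk.injEq] at this
    rw [this.1, this.2]
  have hdiag : ∀ i, c i i = 0 := by
    intro i
    refine Finset.card_eq_zero.2 (Finset.filter_eq_empty_iff.2 fun r _ h => hab ?_)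
    rw [Prod.mk.injEq] at h
    exact r.injective (h.1.trans h.2.symm)
  have hconst : ∀ {i j i' j'}, i ≠ j → i' ≠ j' → c i j = c i' j' := by
    intro i j i' j' h h'
    obtain ⟨π, rfl, rfl⟩ := exists_perm_apply_pair h h'
    refine Finset.card_equiv (Equiv.embeddingCongr (Equiv.refl α) π) fun r => ?_
    simp only [Finset.mem_filter, Finset.mem_univ, true_and, Prod.mk.injEq]
    have e : ∀ x, (Equiv.embeddingCongr (Equiv.refl α) π r) x = π (r x) := fun _ => rfl
    rw [e, e, π.apply_eq_iff_eq, π.apply_eq_iff_eq]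
  by_cases hl : ∃ i j : Fin l, i ≠ j
  · obtain ⟨i₀, j₀, h₀⟩ := hl
    have hc : ∀ i j, (c i j : ℝ) = if i = j then 0 else (c i₀ j₀ : ℝ) := by
      intro i j
      split_ifs with h
      · rw [h, hdiag, Nat.cast_zero]
      · rw [hconst h h₀]
    have hl2 : 2 ≤ l := by
      have := i₀.isLt; have := j₀.isLt
      have : (i₀ : ℕ) ≠ j₀ := fun h => h₀ (Fin.ext h)
      omega
    have hl2' : (2 : ℝ) ≤ l := by exact_mod_cast hl2
    have hF : ∀ F : Fin l → Fin l → ℝ, ∑ r : α ↪ Fin l, F (r a) (r b)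
        = (c i₀ j₀ : ℝ) * (∑ i, ∑ j, F i j - ∑ i, F i i) := by
      intro F
      rw [hsum, ← Finset.sum_sub_distrib, Finset.mul_sum]
      refine Finset.sum_congr rfl fun i _ => ?_
      have e : F i i = ∑ j, if i = j then F i j else 0 := by simp
      rw [e, ← Finset.sum_sub_distrib, Finset.mul_sum]
      refine Finset.sum_congr rfl fun j _ => ?_
      rw [hc]
      split_ifs <;> simp
    have hcard := hF fun _ _ => 1
    simp only [Finset.sum_const, Finset.card_univ, Fintype.card_fin, nsmul_eq_mul, mul_one] at hcard
    rw [hF fun i j => f i * g j]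
    simp only [← Finset.mul_sum, ← Finset.sum_mul, hf]
    rw [hcard]
    have : (l : ℝ) - 1 ≠ 0 := by linarith
    have : (l : ℝ) ≠ 0 := by linarith
    field_simp
    ring
  -- With at most one label there is no injection defined at two points, and both sides are 0
  -- whatever the denominator.
  · push Not at hl
    have he : IsEmpty (α ↪ Fin l) := ⟨fun r => hab (r.injective (hl _ _))⟩
    simp

/-- Values of functions with mean zero at the points of a random injection are nearly orthogonal. -/
lemma sum_embedding_sq_sum_le (g : α → Fin l → ℝ) (hg : ∀ a, ∑ i, g a i = 0) :
    l * ∑ r : α ↪ Fin l, (∑ a, g a (r a)) ^ 2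
      ≤ Fintype.card (α ↪ Fin l) * (2 * ∑ a, ∑ i, g a i ^ 2) := by
  set N : ℝ := (Fintype.card (α ↪ Fin l) : ℝ) with hN
  set C : ℝ := N / (l * (l - 1)) with hC
  have hN0 : 0 ≤ N := by positivity
  have hpt : ∀ a b, l * ∑ r : α ↪ Fin l, g a (r a) * g b (r b)
      = (if a = b then (N + l * C) * ∑ i, g a i ^ 2 else 0) - l * C * ∑ i, g a i * g b i := by
    intro a b
    by_cases h : a = b
    · subst h
      simp only [if_true, ← sq]
      rw [sum_embedding_apply a (fun i => g a i ^ 2)]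
      ring
    · rw [if_neg h, sum_embedding_apply_pair h (hg a)]
      ring
  -- Extending the off-diagonal formula to a = b adds l * C to the diagonal coefficient and makes
  -- the negative terms a complete square, which can be dropped.
  have hexp : l * ∑ r : α ↪ Fin l, (∑ a, g a (r a)) ^ 2
      = (N + l * C) * ∑ a, ∑ i, g a i ^ 2 - l * C * ∑ i, (∑ a, g a i) ^ 2 := by
    have e1 : ∑ r : α ↪ Fin l, (∑ a, g a (r a)) ^ 2
        = ∑ a, ∑ b, ∑ r : α ↪ Fin l, g a (r a) * g b (r b) := by
      simp only [sq, Finset.sum_mul_sum]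
      rw [Finset.sum_comm]
      exact Finset.sum_congr rfl fun a _ => Finset.sum_comm
    have e2 : ∑ i, (∑ a, g a i) ^ 2 = ∑ a, ∑ b, ∑ i, g a i * g b i := by
      simp only [sq, Finset.sum_mul_sum]
      rw [Finset.sum_comm]
      exact Finset.sum_congr rfl fun a _ => Finset.sum_comm
    rw [e1, e2]
    simp only [Finset.mul_sum, ← Finset.sum_sub_distrib]
    refine Finset.sum_congr rfl fun a _ => ?_
    have e3 : ∑ i, (N + l * C) * g a i ^ 2
        = ∑ b, if a = b then (N + l * C) * ∑ i, g a i ^ 2 else 0 := by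
      simp [Finset.mul_sum]
    rw [e3, ← Finset.sum_sub_distrib]
    refine Finset.sum_congr rfl fun b _ => ?_
    rw [← Finset.mul_sum, hpt, Finset.mul_sum (a := (l : ℝ) * C)]
  -- For l ≥ 2, l * C = N / (l - 1). For l = 0 or 1, C is 0 by the convention on division by zero.
  have hlC : 0 ≤ l * C ∧ l * C ≤ N := by
    rcases Nat.lt_or_ge l 2 with h | h
    · interval_cases l
      · simp [hC, hN0]
      · simp [hC, hN0]
    · have h2 : (2 : ℝ) ≤ l := by exact_mod_cast h
      have e : l * C = N / (l - 1) := by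
        rw [hC]
        have : (l : ℝ) - 1 ≠ 0 := by linarith
        have : (l : ℝ) ≠ 0 := by linarith
        field_simp
      rw [e]
      exact ⟨div_nonneg hN0 (by linarith), div_le_self hN0 (by linarith)⟩
  have hS1 : 0 ≤ ∑ a, ∑ i, g a i ^ 2 := by positivity
  have hS2 : 0 ≤ ∑ i, (∑ a, g a i) ^ 2 := by positivity
  rw [hexp]
  nlinarith [mul_nonneg hlC.1 hS2, mul_le_mul_of_nonneg_right hlC.2 hS1]

end RandomInjections

lemma sum_dite_mem {α : Type*} [Fintype α] [DecidableEq α] (s : Finset α) (G : s → ℝ) :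
    ∑ x, (if h : x ∈ s then G ⟨x, h⟩ else 0) = ∑ x : s, G x := by
  have h1 := Finset.sum_coe_sort s fun x => if h : x ∈ s then G ⟨x, h⟩ else 0
  rw [← Finset.sum_subset (Finset.subset_univ s) fun x _ hx => dif_neg hx, ← h1]
  exact Finset.sum_congr rfl fun x _ => dif_pos x.2

/-! ### Spectral expanders and concentration for labeled questions -/

namespace BipGraph

variable {X' X : Type*} [Fintype X'] [Fintype X] [DecidableEq X'] [DecidableEq X]

lemma mem_nbr_iff {M : BipGraph X' X} {x' : X'} {x : X} : x ∈ M.nbr x' ↔ (x', x) ∈ M := by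
  simp [nbr]

lemma mem_conbr_iff {M : BipGraph X' X} {x' : X'} {x : X} : x' ∈ M.conbr x ↔ (x', x) ∈ M := by
  simp [conbr]

lemma sum_nbr_eq_ite (M : BipGraph X' X) (x' : X') (f : X → ℝ) :
    ∑ x ∈ M.nbr x', f x = ∑ x, if (x', x) ∈ M then f x else 0 := by
  rw [nbr, Finset.sum_filter]

lemma sum_sum_nbr (M : BipGraph X' X) (f : X' → X → ℝ) :
    ∑ x', ∑ x ∈ M.nbr x', f x' x = ∑ x, ∑ x' ∈ M.conbr x, f x' x := by
  simp only [nbr, conbr, Finset.sum_filter]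
  exact Finset.sum_comm

lemma sum_card_nbr {M : BipGraph X' X} {d : ℕ} (hd : ∀ x, (M.conbr x).card = d) :
    ∑ x', ((M.nbr x').card : ℝ) = d * Fintype.card X := by
  have h := M.sum_sum_nbr fun _ _ => 1
  simp only [Finset.sum_const, nsmul_eq_mul, mul_one, hd, Finset.card_univ] at h
  rw [h, mul_comm]

/-- The factors |X| cancel inside the root; the adjoint is thus the sum over N(x') weighted by the
root of 1 / (d |N(x')|). -/
lemma normalizedAdj_apply {M : BipGraph X' X} {d : ℕ} (hd : 0 < d) (x : X) (x' : X') :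
    M.normalizedAdj d x x' = if (x', x) ∈ M then √(1 / (d * (M.nbr x').card)) else 0 := by
  unfold normalizedAdj
  split_ifs with h
  · have hN : 0 < ((M.nbr x').card : ℝ) := by
      exact_mod_cast Finset.card_pos.2 ⟨x, mem_nbr h⟩
    have hn : 0 < (Fintype.card X : ℝ) := by
      exact_mod_cast Fintype.card_pos_iff.2 ⟨x⟩
    have hd' : 0 < (d : ℝ) := by exact_mod_cast hd
    rw [← Real.sqrt_sq (show 0 ≤ 1 / (d : ℝ) by positivity), ← Real.sqrt_mul (by positivity)]
    congr 1
    field_simp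
  · rfl

/-- In a spectral expander, averages over neighbourhoods of a function with mean zero are small. -/
lemma IsSpectralExpander.sum_sq_sum_nbr_le {M : BipGraph X' X} {d : ℕ} {lam : ℝ}
    (hM : M.IsSpectralExpander d lam) (hd : 0 < d) (hlam : lam < 1) {m : X → ℝ}
    (hm : ∑ x, m x = 0) :
    ∑ x', 1 / (d * (M.nbr x').card) * (∑ x ∈ M.nbr x', m x) ^ 2 ≤ lam ^ 2 * ∑ x, m x ^ 2 := by
  rcases isEmpty_or_nonempty X with hX | hX
  · have : ∀ x', M.nbr x' = ∅ := fun x' => Finset.eq_empty_of_isEmpty _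
    simp [this]
  set T := Matrix.toEuclideanLin (M.normalizedAdj d) with hT
  have hd' : 0 < (d : ℝ) := by exact_mod_cast hd
  have hadj : ∀ (v : X → ℝ) (x' : X'), (LinearMap.adjoint T (WithLp.toLp 2 v)) x'
      = √(1 / (d * (M.nbr x').card)) * ∑ x ∈ M.nbr x', v x := by
    intro v x'
    rw [hT, ← Matrix.toEuclideanLin_conjTranspose_eq_adjoint, Matrix.toLpLin_toLp]
    change ∑ x, (M.normalizedAdj d)ᴴ x' x * v x = _
    rw [sum_nbr_eq_ite, Finset.mul_sum]
    refine Finset.sum_congr rfl fun x _ => ?_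
    rw [Matrix.conjTranspose_apply, star_trivial, normalizedAdj_apply hd]
    split_ifs <;> simp
  let u : EuclideanSpace ℝ X := WithLp.toLp 2 fun _ => 1
  have hu : u ≠ 0 := by
    intro h
    obtain ⟨x⟩ := hX
    have : u x = 0 := by rw [h]; rfl
    exact one_ne_zero this
  -- T T* averages over x' in N(x) and then over N(x'), so it fixes constants. The orthogonal
  -- complement of the top direction used here is the space of functions of mean zero.
  have hTu : T (LinearMap.adjoint T u) = u := by
    ext x
    rw [hT, Matrix.ofLp_toLpLin, ← hT]
    change ∑ x', M.normalizedAdj d x x' * (LinearMap.adjoint T u) x' = 1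
    have h1 : ∀ x', M.normalizedAdj d x x' * (LinearMap.adjoint T u) x'
        = if x' ∈ M.conbr x then 1 / (d : ℝ) else 0 := by
      intro x'
      rw [hadj, normalizedAdj_apply hd]
      simp only [mem_conbr_iff]
      split_ifs with h
      · have hN : 0 < ((M.nbr x').card : ℝ) := by
          exact_mod_cast Finset.card_pos.2 ⟨x, mem_nbr h⟩
        rw [← mul_assoc, Real.mul_self_sqrt (by positivity)]
        simp only [Finset.sum_const, nsmul_eq_mul, mul_one]
        field_simp
      · simp
    simp only [h1, Finset.sum_ite_mem, Finset.univ_inter, Finset.sum_const, hM.1 x, nsmul_eq_mul]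
    field_simp
  have h := norm_adjoint_apply_le_singularValues_one T (v := WithLp.toLp 2 m) hu hTu
    (hM.2.trans_lt hlam) (by
      rw [PiLp.inner_apply]
      simpa [u] using hm)
  have h2 : ‖LinearMap.adjoint T (WithLp.toLp 2 m)‖ ^ 2
      ≤ (lam * ‖(WithLp.toLp 2 m : EuclideanSpace ℝ X)‖) ^ 2 :=
    pow_le_pow_left₀ (norm_nonneg _)
      (h.trans (mul_le_mul_of_nonneg_right hM.2 (norm_nonneg _))) 2
  rw [mul_pow, EuclideanSpace.real_norm_sq_eq, EuclideanSpace.real_norm_sq_eq] at h2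
  refine le_trans (le_of_eq ?_) h2
  refine Finset.sum_congr rfl fun x' _ => ?_
  rw [hadj, mul_pow, Real.sq_sqrt (by positivity)]

/-- In a spectral expander, neighbourhoods are large on average. -/
lemma IsSpectralExpander.sum_conbr_inv_card_le {M : BipGraph X' X} {d : ℕ} {lam : ℝ}
    (hM : M.IsSpectralExpander d lam) (hd : 0 < d) (hlam : lam < 1) (x : X) :
    ∑ x' ∈ M.conbr x, 1 / ((d : ℝ) * (M.nbr x').card)
      ≤ 2 * lam ^ 2 + 2 / Fintype.card X := by
  set n : ℝ := (Fintype.card X : ℝ) with hn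
  have hn0 : 0 < n := by
    rw [hn]; exact_mod_cast Fintype.card_pos_iff.2 ⟨x⟩
  have hd' : 0 < (d : ℝ) := by exact_mod_cast hd
  -- The expander inequality is tested on the point mass at x, centred. Its sum over N(x') is 1 -
  -- |N(x')| / n for x' in N(x), so it detects small neighbourhoods.
  let m : X → ℝ := fun z => (if z = x then 1 else 0) - 1 / n
  have hm : ∑ z, m z = 0 := by
    simp only [m, Finset.sum_sub_distrib, Finset.sum_ite_eq', Finset.mem_univ, if_true,
      Finset.sum_const, Finset.card_univ, nsmul_eq_mul, ← hn]
    field_simp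
    ring
  have hm2 : ∑ z, m z ^ 2 ≤ 1 := by
    have e : ∀ z, m z ^ 2 = (if z = x then 1 - 2 / n else 0) + 1 / n ^ 2 := by
      intro z
      simp only [m]
      split_ifs
      · field_simp; ring
      · field_simp; ring
    simp only [e, Finset.sum_add_distrib, Finset.sum_ite_eq', Finset.mem_univ, if_true,
      Finset.sum_const, Finset.card_univ, nsmul_eq_mul, ← hn]
    have : n * (1 / n ^ 2) = 1 / n := by field_simp
    rw [this]
    have h1 : 0 < 1 / n := by positivity
    have h2 : 2 / n = 2 * (1 / n) := by ring
    rw [h2]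
    linarith
  have h := hM.sum_sq_sum_nbr_le hd hlam hm
  have hs : ∀ x', ∑ z ∈ M.nbr x', m z
      = (if x' ∈ M.conbr x then 1 else 0) - (M.nbr x').card / n := by
    intro x'
    simp only [m, Finset.sum_sub_distrib, Finset.sum_ite_eq', Finset.sum_const, nsmul_eq_mul,
      mem_nbr_iff, mem_conbr_iff]
    ring
  have hpt : ∀ x', (if x' ∈ M.conbr x then 1 / ((d : ℝ) * (M.nbr x').card) else 0)
      ≤ 2 * (1 / (d * (M.nbr x').card) * (∑ z ∈ M.nbr x', m z) ^ 2)
        + 2 / (d * n ^ 2) * (M.nbr x').card := by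
    intro x'
    set N : ℝ := ((M.nbr x').card : ℝ) with hN
    have hN0 : 0 ≤ N := by positivity
    rw [hs, ← hN]
    rcases eq_or_ne N 0 with h0 | h0
    · simp [h0]
    · have e : 2 / (d * n ^ 2) * N = 2 * (1 / (d * N) * (N / n) ^ 2) := by
        field_simp
      rw [e]
      have hw : 0 ≤ 1 / (d * N) := by positivity
      split_ifs
      -- This avoids comparing N with n. The second square, summed over x' with its weight,
      -- contributes only 2 / n because the sizes |N(x')| add up to d n.
      · have : 1 ≤ 2 * (1 - N / n) ^ 2 + 2 * (N / n) ^ 2 := by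
          nlinarith [sq_nonneg (1 - 2 * (N / n))]
        nlinarith [mul_le_mul_of_nonneg_left this hw]
      · positivity
  have hsum := Finset.sum_le_sum fun x' (_ : x' ∈ Finset.univ) => hpt x'
  rw [Finset.sum_ite_mem, Finset.univ_inter, Finset.sum_add_distrib, ← Finset.mul_sum,
    ← Finset.mul_sum, sum_card_nbr hM.1, ← hn] at hsum
  have e : 2 / (d * n ^ 2) * (d * n) = 2 / n := by field_simp
  rw [e] at hsum
  have h3 : lam ^ 2 * ∑ z, m z ^ 2 ≤ lam ^ 2 :=
    mul_le_of_le_one_right (sq_nonneg _) hm2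
  linarith

lemma card_labelings_pos (M : BipGraph X' X) {l : ℕ} (hl : M.maxDeg ≤ l) (x' : X') :
    0 < (Fintype.card (M.nbr x' ↪ Fin l) : ℝ) := by
  have := Function.Embedding.nonempty_of_card_le (α := M.nbr x') (β := Fin l)
    (by simpa using (card_nbr_le_maxDeg M x').trans hl)
  exact_mod_cast Fintype.card_pos_iff.2 this

/-- The graph between the labeled questions `(x', r)` and `(x, i)` is a spectral expander. -/
lemma IsSpectralExpander.sum_sq_sum_labeled_le {M : BipGraph X' X} {d l : ℕ} {lam η : ℝ}
    (hM : M.IsSpectralExpander d lam) (hd : 0 < d) (hlam : lam < 1) (hη : lam ^ 2 ≤ η ^ 2)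
    (hX : 1 ≤ η ^ 2 * Fintype.card X) (hl : M.maxDeg ≤ l) (hl0 : 0 < l) {h : X → Fin l → ℝ}
    (hh : ∑ x, ∑ i, h x i = 0) :
    ∑ x', 1 / (d * (M.nbr x').card) * (l / Fintype.card (M.nbr x' ↪ Fin l) *
        ∑ r : M.nbr x' ↪ Fin l, (∑ x : M.nbr x', h x (r x)) ^ 2)
      ≤ 16 * η ^ 2 * ∑ x, ∑ i, h x i ^ 2 := by
  have hl' : 0 < (l : ℝ) := by exact_mod_cast hl0
  -- Orthogonal splitting of h into its average m over labels, handled by the expander, and a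
  -- remainder g, handled by the randomness of the labeling.
  obtain ⟨m, hmdef⟩ : ∃ m : X → ℝ, ∀ x, m x = 1 / l * ∑ i, h x i := ⟨_, fun _ => rfl⟩
  obtain ⟨g, hgdef⟩ : ∃ g : X → Fin l → ℝ, ∀ x i, g x i = h x i - m x := ⟨_, fun _ _ => rfl⟩
  have hm : ∑ x, m x = 0 := by simp only [hmdef, ← Finset.mul_sum, hh, mul_zero]
  have hg : ∀ x, ∑ i, g x i = 0 := by
    intro x
    simp only [hgdef, hmdef, Finset.sum_sub_distrib, Finset.sum_const, Finset.card_univ, Fintype.card_fin,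
      nsmul_eq_mul]
    field_simp
    ring
  have hsplit : ∀ x, ∑ i, h x i ^ 2 = l * m x ^ 2 + ∑ i, g x i ^ 2 := by
    intro x
    have e : ∀ i, h x i ^ 2 = m x ^ 2 + 2 * m x * g x i + g x i ^ 2 := fun i => by
      rw [hgdef]; ring
    simp only [e, Finset.sum_add_distrib, ← Finset.mul_sum, hg, mul_zero, add_zero,
      Finset.sum_const, Finset.card_univ, Fintype.card_fin, nsmul_eq_mul]
  have hpt : ∀ x', l / Fintype.card (M.nbr x' ↪ Fin l) *
        ∑ r : M.nbr x' ↪ Fin l, (∑ x : M.nbr x', h x (r x)) ^ 2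
      ≤ 2 * l * (∑ x ∈ M.nbr x', m x) ^ 2 + 4 * ∑ x ∈ M.nbr x', ∑ i, g x i ^ 2 := by
    intro x'
    have hE := M.card_labelings_pos hl x'
    set E : ℝ := (Fintype.card (M.nbr x' ↪ Fin l) : ℝ) with hEdef
    have h1 := sum_embedding_sq_sum_le (fun (x : M.nbr x') i => g x i) (fun x => hg x)
    rw [← hEdef] at h1
    have h2 : ∑ r : M.nbr x' ↪ Fin l, (∑ x : M.nbr x', h x (r x)) ^ 2
        ≤ ∑ r : M.nbr x' ↪ Fin l, (2 * (∑ x : M.nbr x', m x) ^ 2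
          + 2 * (∑ x : M.nbr x', g x (r x)) ^ 2) := by
      refine Finset.sum_le_sum fun r _ => ?_
      have e : ∑ x : M.nbr x', h x (r x) = ∑ x : M.nbr x', m x + ∑ x : M.nbr x', g x (r x) := by
        rw [← Finset.sum_add_distrib]
        exact Finset.sum_congr rfl fun x _ => by rw [hgdef]; ring
      rw [e]
      nlinarith [sq_nonneg (∑ x : M.nbr x', m x - ∑ x : M.nbr x', g x (r x))]
    rw [Finset.sum_add_distrib, Finset.sum_const, Finset.card_univ, nsmul_eq_mul, ← hEdef,
      ← Finset.mul_sum] at h2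
    rw [Finset.sum_coe_sort (M.nbr x') m] at h2
    rw [Finset.sum_coe_sort (M.nbr x') (fun x => ∑ i, g x i ^ 2)] at h1
    rw [div_mul_eq_mul_div, div_le_iff₀ hE]
    nlinarith [mul_le_mul_of_nonneg_left h2 hl'.le]
  have hs := Finset.sum_le_sum fun x' (_ : x' ∈ Finset.univ) =>
    mul_le_mul_of_nonneg_left (hpt x')
      (show (0 : ℝ) ≤ 1 / (d * (M.nbr x').card) by positivity)
  refine hs.trans ?_
  have hm1 := hM.sum_sq_sum_nbr_le hd hlam hm
  -- Interchanging the sums, each x carries the weight ∑ 1 / (d |N(x')|) over x' in N(x), at most 2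
  -- η² + 2 η². With the coefficient 4 in `hpt` this gives the constant 16.
  have hg1 : ∑ x', 1 / ((d : ℝ) * (M.nbr x').card) * ∑ x ∈ M.nbr x', ∑ i, g x i ^ 2
      ≤ 4 * η ^ 2 * ∑ x, ∑ i, g x i ^ 2 := by
    simp only [Finset.mul_sum (M.nbr _)]
    rw [M.sum_sum_nbr, Finset.mul_sum]
    refine Finset.sum_le_sum fun x _ => ?_
    rw [← Finset.sum_mul]
    refine mul_le_mul_of_nonneg_right ?_ (Finset.sum_nonneg fun i _ => sq_nonneg _)
    have h1 := hM.sum_conbr_inv_card_le hd hlam x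
    have hn0 : 0 < (Fintype.card X : ℝ) := by
      exact_mod_cast Fintype.card_pos_iff.2 ⟨x⟩
    have h2 : 2 / (Fintype.card X : ℝ) ≤ 2 * η ^ 2 := by
      rw [div_le_iff₀ hn0]; linarith
    linarith
  have hm2 : 0 ≤ ∑ x, m x ^ 2 := Finset.sum_nonneg fun x _ => sq_nonneg _
  simp only [hsplit, Finset.sum_add_distrib, ← Finset.mul_sum]
  have e : ∀ x', 1 / ((d : ℝ) * (M.nbr x').card) * (2 * l * (∑ x ∈ M.nbr x', m x) ^ 2
        + 4 * ∑ x ∈ M.nbr x', ∑ i, g x i ^ 2)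
      = 2 * l * (1 / ((d : ℝ) * (M.nbr x').card) * (∑ x ∈ M.nbr x', m x) ^ 2)
        + 4 * (1 / ((d : ℝ) * (M.nbr x').card) * ∑ x ∈ M.nbr x', ∑ i, g x i ^ 2) := by
    intro x'; ring
  simp only [e, Finset.sum_add_distrib, ← Finset.mul_sum]
  have h3 : 2 * l * (lam ^ 2 * ∑ x, m x ^ 2) ≤ 16 * η ^ 2 * (l * ∑ x, m x ^ 2) := by
    have : lam ^ 2 * (∑ x, m x ^ 2) ≤ η ^ 2 * ∑ x, m x ^ 2 := mul_le_mul_of_nonneg_right hη hm2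
    nlinarith [mul_nonneg hl'.le (mul_nonneg (sq_nonneg η) hm2),
      mul_le_mul_of_nonneg_left this hl'.le]
  have h4 := mul_le_mul_of_nonneg_left hm1 (show 0 ≤ 2 * (l : ℝ) by positivity)
  linarith

lemma ordKernel_nonneg (M : BipGraph X' X) (l : ℕ) (p : X × Fin l) (q : M.OrdQuestion l) :
    0 ≤ M.ordKernel l p q := by
  unfold ordKernel
  split_ifs <;> positivity

/-- Conditioning on r(x) = i multiplies the uniform law of r by l, since r(x) is uniform. In this
form the weight of an admissible r depends neither on i nor on the position of x in N(x'). -/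
lemma ordKernel_apply {M : BipGraph X' X} {l : ℕ} (hl : 0 < l) (p : X × Fin l)
    (q : M.OrdQuestion l) :
    M.ordKernel l p q = if h : p.1 ∈ M.nbr q.1 then if q.2 ⟨p.1, h⟩ = p.2 then
      (1 : ℝ) / (M.conbr p.1).card * (l / Fintype.card (M.nbr q.1 ↪ Fin l)) else 0 else 0 := by
  unfold ordKernel
  by_cases h : p.1 ∈ M.nbr q.1
  · rw [dif_pos h, dif_pos (mem_nbr_iff.1 h)]
    split_ifs with h2
    · have hc := mul_card_embedding_eq_apply (⟨p.1, h⟩ : M.nbr q.1) p.2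
      have hpos : 0 < Fintype.card {r : M.nbr q.1 ↪ Fin l // r ⟨p.1, h⟩ = p.2} :=
        Fintype.card_pos_iff.2 ⟨⟨q.2, h2⟩⟩
      congr 1
      rw [← hc]
      push_cast
      have : (l : ℝ) ≠ 0 := by positivity
      have : (Fintype.card {r : M.nbr q.1 ↪ Fin l // r ⟨p.1, h⟩ = p.2} : ℝ) ≠ 0 := by positivity
      field_simp
    · rfl
  · rw [dif_neg h, dif_neg fun h' => h (mem_nbr h')]

lemma sum_ordKernel_mul {M : BipGraph X' X} {l : ℕ} (hl : 0 < l) (q : M.OrdQuestion l)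
    (F : X × Fin l → ℝ) :
    ∑ p, M.ordKernel l p q * F p = ∑ x : M.nbr q.1,
      1 / (M.conbr x.1).card * (l / Fintype.card (M.nbr q.1 ↪ Fin l)) * F (x, q.2 x) := by
  have h1 : ∀ x, ∑ i, M.ordKernel l (x, i) q * F (x, i) = if h : x ∈ M.nbr q.1 then
      (1 : ℝ) / (M.conbr x).card * (l / Fintype.card (M.nbr q.1 ↪ Fin l)) * F (x, q.2 ⟨x, h⟩) else 0 := by
    intro x
    simp only [ordKernel_apply hl]
    split_ifs with h
    · simp only [ite_mul, zero_mul]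
      exact (Finset.sum_ite_eq Finset.univ (q.2 ⟨x, h⟩) fun i => (1 : ℝ) / (M.conbr x).card *
        (l / Fintype.card (M.nbr q.1 ↪ Fin l)) * F (x, i)).trans (if_pos (Finset.mem_univ _))
    · simp
  rw [Fintype.sum_prod_type]
  simp only [h1]
  exact sum_dite_mem (M.nbr q.1) fun x =>
    (1 : ℝ) / (M.conbr x.1).card * (l / Fintype.card (M.nbr q.1 ↪ Fin l)) * F (x, q.2 x)

lemma sum_ordKernel {M : BipGraph X' X} {l : ℕ} (hl : M.maxDeg ≤ l) (p : X × Fin l)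
    (hp : (M.conbr p.1).Nonempty) : ∑ q, M.ordKernel l p q = 1 := by
  have hl0 : 0 < l := p.2.pos
  have hl' : (l : ℝ) ≠ 0 := by positivity
  rw [Fintype.sum_sigma]
  have h1 : ∀ x', ∑ r, M.ordKernel l p ⟨x', r⟩
      = if x' ∈ M.conbr p.1 then 1 / ((M.conbr p.1).card : ℝ) else 0 := by
    intro x'
    simp only [ordKernel_apply hl0, mem_conbr_iff]
    by_cases h : p.1 ∈ M.nbr x'
    · simp only [dif_pos h, if_pos (mem_nbr_iff.1 h)]
      change ∑ r : M.nbr x' ↪ Fin l, (if r ⟨p.1, h⟩ = p.2 then (1 : ℝ) / (M.conbr p.1).card *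
        (l / Fintype.card (M.nbr x' ↪ Fin l)) else 0) = _
      rw [← Finset.sum_filter, Finset.sum_const, nsmul_eq_mul, ← Fintype.card_subtype,
        ← mul_card_embedding_eq_apply (⟨p.1, h⟩ : M.nbr x') p.2]
      have hpos : 0 < (Fintype.card (M.nbr x' ↪ Fin l) : ℝ) := M.card_labelings_pos hl x'
      rw [← mul_card_embedding_eq_apply (⟨p.1, h⟩ : M.nbr x') p.2] at hpos
      push_cast at hpos ⊢
      have h2 : (Fintype.card {r : M.nbr x' ↪ Fin l // r ⟨p.1, h⟩ = p.2} : ℝ) ≠ 0 := by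
        intro h0
        rw [h0, mul_zero] at hpos
        exact lt_irrefl _ hpos
      field_simp
    · simp [dif_neg h, if_neg fun h' => h (mem_nbr h')]
  simp only [h1, Finset.sum_ite_mem, Finset.univ_inter, Finset.sum_const, nsmul_eq_mul]
  have : ((M.conbr p.1).card : ℝ) ≠ 0 := by
    exact_mod_cast (Finset.card_pos.2 hp).ne'
  field_simp

/-- Averages over the neighbours of labeled questions are concentrated. -/
lemma IsSpectralExpander.sum_sq_sub_mean_le {M : BipGraph X' X} {d l : ℕ} {lam η : ℝ}
    (hM : M.IsSpectralExpander d lam) (hd : 0 < d) (hlam : lam < 1) (hη : lam ^ 2 ≤ η ^ 2)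
    (hη0 : 0 < η) (hX : 1 ≤ η ^ 2 * Fintype.card X) (hl : M.maxDeg ≤ l)
    (f : M.OrdQuestion l → ℝ) (c : ℝ)
    (hc : ∑ p, (∑ q, M.ordKernel l p q * f q - c) = 0) :
    ∑ p, (∑ q, M.ordKernel l p q * f q - c) ^ 2
      ≤ 16 * η ^ 2 * ∑ p, ∑ q, M.ordKernel l p q * f q ^ 2 := by
  rcases Nat.eq_zero_or_pos l with rfl | hl0
  · simp
  have hd' : 0 < (d : ℝ) := by exact_mod_cast hd
  set h : X × Fin l → ℝ := fun p => ∑ q, M.ordKernel l p q * f q - c with hh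
  set s : ℝ := 16 * η ^ 2 with hs
  have hs0 : 0 < s := by positivity
  have hback := hM.sum_sq_sum_labeled_le hd hlam hη hX hl hl0 (h := fun x i => h (x, i))
    (by rw [← Fintype.sum_prod_type']; exact hc)
  rw [← Fintype.sum_prod_type' (f := fun x i => h (x, i) ^ 2)] at hback
  -- Duality: h is the kernel applied to f, minus a constant orthogonal to h, so the transposed
  -- kernel can be moved onto h.
  have hexp : ∑ p, h p ^ 2 = ∑ q, f q * ∑ p, M.ordKernel l p q * h p := by
    have e1 : ∑ p, h p ^ 2 = ∑ p, h p * ∑ q, M.ordKernel l p q * f q := by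
      have e0 : ∀ p, h p ^ 2 = h p * ∑ q, M.ordKernel l p q * f q - c * h p := fun p => by
        simp only [hh]; ring
      simp only [e0, Finset.sum_sub_distrib, ← Finset.mul_sum]
      rw [show ∑ p, h p = 0 from hc, mul_zero, sub_zero]
    rw [e1]
    simp only [Finset.mul_sum]
    rw [Finset.sum_comm]
    exact Finset.sum_congr rfl fun q _ => Finset.sum_congr rfl fun p _ => by ring
  let C : M.OrdQuestion l → ℝ := fun q => 1 / d * (l / Fintype.card (M.nbr q.1 ↪ Fin l))
  have hC : ∀ q, 0 ≤ C q := fun q => by positivity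
  have hk : ∀ q (F : X × Fin l → ℝ), ∑ p, M.ordKernel l p q * F p = C q * ∑ x : M.nbr q.1, F (x, q.2 x) := by
    intro q F
    rw [sum_ordKernel_mul hl0, Finset.mul_sum]
    exact Finset.sum_congr rfl fun x _ => by rw [hM.1]
  -- AM-GM with weight s |N(x')|, s = 16 η². By `hback` the terms in h sum to at most half of ∑ h²,
  -- which is absorbed on the left.
  have hpt : ∀ q, f q * ∑ p, M.ordKernel l p q * h p ≤
      2⁻¹ * (s * ∑ p, M.ordKernel l p q * f q ^ 2
        + s⁻¹ * (C q * (1 / (M.nbr q.1).card) * (∑ x : M.nbr q.1, h (x, q.2 x)) ^ 2)) := by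
    intro q
    rw [hk q h, hk q (fun _ => f q ^ 2)]
    simp only [Finset.sum_const, Finset.card_univ, Fintype.card_coe, nsmul_eq_mul]
    set N : ℝ := ((M.nbr q.1).card : ℝ) with hN
    set S := ∑ x : M.nbr q.1, h (x, q.2 x) with hS
    rcases eq_or_ne N 0 with h0 | h0
    · have hemp : M.nbr q.1 = ∅ := by
        rw [hN] at h0
        exact Finset.card_eq_zero.1 (by exact_mod_cast h0)
      have hS0 : S = 0 := by
        rw [hS]
        have : IsEmpty (M.nbr q.1) := by rw [hemp]; infer_instance
        exact Fintype.sum_empty _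
      rw [hS0, h0]
      simp
    · have hN0 : 0 < N := lt_of_le_of_ne (by positivity) (Ne.symm h0)
      have key : 2 * (f q * S) ≤ s * N * f q ^ 2 + s⁻¹ * (1 / N) * S ^ 2 := by
        have hsN : 0 < s * N := by positivity
        have e : s * N * f q ^ 2 + s⁻¹ * (1 / N) * S ^ 2 - 2 * (f q * S)
            = (s * N * f q - S) ^ 2 / (s * N) := by
          field_simp
          ring
        have := div_nonneg (sq_nonneg (s * N * f q - S)) hsN.le
        linarith
      nlinarith [mul_le_mul_of_nonneg_left key (hC q)]
  have hsum := Finset.sum_le_sum fun q (_ : q ∈ Finset.univ) => hpt q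
  rw [← hexp, ← Finset.mul_sum, Finset.sum_add_distrib, ← Finset.mul_sum, ← Finset.mul_sum] at hsum
  have e2 : ∑ q : M.OrdQuestion l,
        C q * (1 / (M.nbr q.1).card) * (∑ x : M.nbr q.1, h (x, q.2 x)) ^ 2
      = ∑ x', 1 / (d * (M.nbr x').card) * (l / Fintype.card (M.nbr x' ↪ Fin l) *
        ∑ r : M.nbr x' ↪ Fin l, (∑ x : M.nbr x', h (x, r x)) ^ 2) := by
    rw [Fintype.sum_sigma]
    refine Finset.sum_congr rfl fun x' _ => ?_
    simp only [Finset.mul_sum, C]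
    refine Finset.sum_congr rfl fun r _ => ?_
    ring
  rw [e2, Finset.sum_comm] at hsum
  have h5 : s⁻¹ * (∑ x', 1 / (d * (M.nbr x').card) * (l / Fintype.card (M.nbr x' ↪ Fin l) *
        ∑ r : M.nbr x' ↪ Fin l, (∑ x : M.nbr x', h (x, r x)) ^ 2)) ≤ ∑ p, h p ^ 2 := by
    rw [inv_mul_le_iff₀ hs0]
    exact hback
  linarith

end BipGraph

/-! ### Coarse-graining and averaging of measurements -/

section Marginals

open scoped MatrixOrder

variable {n m A B A' B' : Type*} [Fintype A] [Fintype B] [Fintype A'] [Fintype B']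

open Classical in
/-- The measurement obtained by applying `φ` to the outcome of `E`. -/
noncomputable def margOp (φ : A' → A) (E : A' → Matrix n n ℂ) (a : A) : Matrix n n ℂ :=
  ∑ a', if φ a' = a then E a' else 0

lemma margOp_nonneg [Fintype n] (φ : A' → A) {E : A' → Matrix n n ℂ} (hE : ∀ a', 0 ≤ E a')
    (a : A) : 0 ≤ margOp φ E a := by
  refine Finset.sum_nonneg fun a' _ => ?_
  split_ifs
  · exact hE a'
  · exact le_rfl

lemma sum_margOp (φ : A' → A) (E : A' → Matrix n n ℂ) : ∑ a, margOp φ E a = ∑ a', E a' := by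
  classical
  unfold margOp
  rw [Finset.sum_comm]
  simp

lemma winOp_margOp [Fintype n] [Fintype m] [DecidableEq n] [DecidableEq m] (V : A → B → Prop)
    (φ : A' → A) (χ : B' → B) (E : A' → Matrix n n ℂ) (F : B' → Matrix m m ℂ) :
    winOp V (margOp φ E) (margOp χ F) = winOp (fun a b => V (φ a) (χ b)) E F := by
  classical
  have h1 : ∀ a b, (if V a b then margOp φ E a ⊗ₖ margOp χ F b else 0)
      = ∑ a', ∑ b', if φ a' = a then if χ b' = b then if V a b then E a' ⊗ₖ F b' else 0 else 0
        else 0 := by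
    intro a b
    unfold margOp
    rw [sum_kronecker]
    simp only [kronecker_sum]
    split_ifs with hV
    · refine Finset.sum_congr rfl fun a' _ => Finset.sum_congr rfl fun b' _ => ?_
      split_ifs <;> simp
    · simp
  unfold winOp
  simp only [h1]
  rw [Finset.sum_congr rfl fun a _ => Finset.sum_comm, Finset.sum_comm]
  refine Finset.sum_congr rfl fun a' _ => ?_
  rw [Finset.sum_congr rfl fun a _ => Finset.sum_comm]
  rw [Finset.sum_congr rfl fun a _ => Finset.sum_comm]
  rw [Finset.sum_congr rfl fun a _ => Finset.sum_comm, Finset.sum_comm]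
  simp

lemma winOp_sum_smul [Fintype n] [Fintype m] [DecidableEq n] [DecidableEq m] {Q W : Type*}
    [Fintype Q] [Fintype W] (V : A → B → Prop) (c : Q → ℝ) (c' : W → ℝ)
    (E : Q → A → Matrix n n ℂ) (F : W → B → Matrix m m ℂ) :
    winOp V (fun a => ∑ q, c q • E q a) (fun b => ∑ w, c' w • F w b)
      = ∑ q, ∑ w, (c q * c' w) • winOp V (E q) (F w) := by
  classical
  have h1 : ∀ a b, (if V a b then (∑ q, c q • E q a) ⊗ₖ (∑ w, c' w • F w b) else 0)
      = ∑ q, ∑ w, (c q * c' w) • if V a b then E q a ⊗ₖ F w b else 0 := by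
    intro a b
    rw [sum_kronecker]
    simp only [kronecker_sum, Matrix.smul_kronecker, Matrix.kronecker_smul, Finset.smul_sum,
      smul_smul]
    split_ifs
    · rfl
    · simp
  unfold winOp
  simp only [h1, Finset.smul_sum]
  rw [Finset.sum_congr rfl fun a _ => Finset.sum_comm, Finset.sum_comm]
  refine Finset.sum_congr rfl fun q _ => ?_
  rw [Finset.sum_congr rfl fun a _ => Finset.sum_comm, Finset.sum_comm]

end Marginals

/-! ### Induced strategies and the upper bound on the value -/

section InducedStrategies

open scoped MatrixOrder

variable {X' X : Type*} [Fintype X'] [Fintype X] [DecidableEq X'] [DecidableEq X]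
  {A : Type*} [Fintype A] {n : Type*}

/-- The operators on the labeled true questions induced by operators of the ordered
concatenation. -/
noncomputable def BipGraph.inducedOp (M : BipGraph X' X) (l : ℕ)
    (E : (q : M.OrdQuestion l) → M.OrdAnswer l A q → Matrix n n ℂ) (p : X × Fin l) (a : A) :
    Matrix n n ℂ :=
  ∑ q, M.ordKernel l p q • if h : p.1 ∈ M.nbr q.1 then
    margOp (fun a' : M.OrdAnswer l A q => a' ⟨p.1, h⟩) (E q) a else 0

lemma BipGraph.inducedOp_nonneg [Fintype n] (M : BipGraph X' X) (l : ℕ)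
    {E : (q : M.OrdQuestion l) → M.OrdAnswer l A q → Matrix n n ℂ} (hE : ∀ q a, 0 ≤ E q a)
    (p : X × Fin l) (a : A) : 0 ≤ M.inducedOp l E p a := by
  refine Finset.sum_nonneg fun q _ => smul_nonneg (M.ordKernel_nonneg l p q) ?_
  split_ifs
  · exact margOp_nonneg _ (hE q) a
  · exact le_rfl

lemma BipGraph.ordKernel_eq_zero {M : BipGraph X' X} {l : ℕ} {p : X × Fin l}
    {q : M.OrdQuestion l} (h : p.1 ∉ M.nbr q.1) : M.ordKernel l p q = 0 := by
  unfold BipGraph.ordKernel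
  rw [dif_neg fun h' => h (BipGraph.mem_nbr h')]

lemma BipGraph.sum_inducedOp (M : BipGraph X' X) (l : ℕ)
    (E : (q : M.OrdQuestion l) → M.OrdAnswer l A q → Matrix n n ℂ) (p : X × Fin l) :
    ∑ a, M.inducedOp l E p a = ∑ q, M.ordKernel l p q • ∑ a', E q a' := by
  unfold BipGraph.inducedOp
  rw [Finset.sum_comm]
  refine Finset.sum_congr rfl fun q _ => ?_
  rw [← Finset.smul_sum]
  by_cases h : p.1 ∈ M.nbr q.1
  · simp only [dif_pos h, sum_margOp]
  · rw [BipGraph.ordKernel_eq_zero h, zero_smul, zero_smul]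

lemma BipGraph.sum_ordKernel_smul_le_one [Fintype n] [DecidableEq n] {M : BipGraph X' X} {l : ℕ}
    (hl : M.maxDeg ≤ l) (hM : ∀ x, (M.conbr x).Nonempty) {E : M.OrdQuestion l → Matrix n n ℂ}
    (hE : ∀ q, E q ≤ 1) (p : X × Fin l) : ∑ q, M.ordKernel l p q • E q ≤ 1 := by
  have h1 : ∑ q, M.ordKernel l p q • (1 : Matrix n n ℂ) = 1 := by
    rw [← Finset.sum_smul, BipGraph.sum_ordKernel hl p (hM p.1), one_smul]
  rw [← h1]
  exact Finset.sum_le_sum fun q _ =>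
    smul_le_smul_of_nonneg_left (hE q) (M.ordKernel_nonneg l p q)

variable {Y' Y B : Type*} [Fintype Y'] [Fintype Y] [DecidableEq Y'] [DecidableEq Y] [Fintype B]

/-- The substrategy on labeled true questions induced by a substrategy for the ordered
concatenation. -/
noncomputable def QuantumSubstrategy.induced {M : BipGraph X' X} {P : BipGraph Y' Y} {l : ℕ}
    (S : QuantumSubstrategy (M.OrdQuestion l) (P.OrdQuestion l) (M.OrdAnswer l A)
      (P.OrdAnswer l B))
    (hM : ∀ x, (M.conbr x).Nonempty) (hP : ∀ y, (P.conbr y).Nonempty)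
    (hlM : M.maxDeg ≤ l) (hlP : P.maxDeg ≤ l) :
    QuantumSubstrategy (X × Fin l) (Y × Fin l) (fun _ => A) (fun _ => B) where
  dim := S.dim
  ψ := S.ψ
  ψ_unit := S.ψ_unit
  PA := M.inducedOp l S.PA
  PB := P.inducedOp l S.PB
  PA_psd p a := Matrix.nonneg_iff_posSemidef.1
    (M.inducedOp_nonneg l (fun q a => (S.PA_psd q a).nonneg) p a)
  PB_psd p a := Matrix.nonneg_iff_posSemidef.1
    (P.inducedOp_nonneg l (fun q a => (S.PB_psd q a).nonneg) p a)
  PA_le p := by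
    rw [M.sum_inducedOp]
    exact Matrix.le_iff.1 (BipGraph.sum_ordKernel_smul_le_one hlM hM
      (fun q => Matrix.le_iff.2 (S.PA_le q)) p)
  PB_le p := by
    rw [P.sum_inducedOp]
    exact Matrix.le_iff.1 (BipGraph.sum_ordKernel_smul_le_one hlP hP
      (fun q => Matrix.le_iff.2 (S.PB_le q)) p)

lemma QuantumSubstrategy.induced_isComplete {M : BipGraph X' X} {P : BipGraph Y' Y} {l : ℕ}
    {S : QuantumSubstrategy (M.OrdQuestion l) (P.OrdQuestion l) (M.OrdAnswer l A)
      (P.OrdAnswer l B)}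
    (hM : ∀ x, (M.conbr x).Nonempty) (hP : ∀ y, (P.conbr y).Nonempty)
    (hlM : M.maxDeg ≤ l) (hlP : P.maxDeg ≤ l) (hS : S.IsComplete) :
    (S.induced hM hP hlM hlP).IsComplete := by
  constructor
  · intro p
    change ∑ a, M.inducedOp l S.PA p a = 1
    rw [M.sum_inducedOp]
    simp only [hS.1]
    rw [← Finset.sum_smul, BipGraph.sum_ordKernel hlM p (hM p.1), one_smul]
  · intro p
    change ∑ a, P.inducedOp l S.PB p a = 1
    rw [P.sum_inducedOp]
    simp only [hS.2]
    rw [← Finset.sum_smul, BipGraph.sum_ordKernel hlP p (hP p.1), one_smul]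

/-- For each r, exactly a fraction 1 / l of the injections s takes the prescribed value r(a) at b.
-/
lemma card_matching_labelings {α β : Type*} [Fintype α] [Fintype β] [DecidableEq α]
    [DecidableEq β] {l : ℕ} (a : α) (b : β) :
    l * Fintype.card {rs : (α ↪ Fin l) × (β ↪ Fin l) // rs.1 a = rs.2 b}
      = Fintype.card (α ↪ Fin l) * Fintype.card (β ↪ Fin l) := by
  have h1 : Fintype.card {rs : (α ↪ Fin l) × (β ↪ Fin l) // rs.1 a = rs.2 b}
      = ∑ r : α ↪ Fin l, Fintype.card {s : β ↪ Fin l // s b = r a} := by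
    rw [Fintype.card_subtype, Finset.card_filter, Fintype.sum_prod_type]
    refine Finset.sum_congr rfl fun r _ => ?_
    rw [Fintype.card_subtype, Finset.card_filter]
    exact Finset.sum_congr rfl fun s _ => by simp only [eq_comm]
  rw [h1, Finset.mul_sum]
  simp only [mul_card_embedding_eq_apply, Finset.sum_const, Finset.card_univ, smul_eq_mul]

/-- The common label of a uniform matching pair (r, s) is itself uniform, and given this label r and
s are independent and uniform. This is what makes the disjoint union of l copies the right inner
game. -/
lemma ordProb_eq_sum (G : Game X Y A B) (M : BipGraph X' X) (P : BipGraph Y' Y) {l : ℕ}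
    (hl : 0 < l) (t : X × Y) (q : M.OrdQuestion l) (w : P.OrdQuestion l) :
    ordProb G M P l t q w = ∑ i, G.μ t.1 t.2 / l *
      (M.ordKernel l (t.1, i) q * P.ordKernel l (t.2, i) w) := by
  by_cases h : t.1 ∈ M.nbr q.1 ∧ t.2 ∈ P.nbr w.1
  · have h' : (q.1, t.1) ∈ M ∧ (w.1, t.2) ∈ P :=
      ⟨BipGraph.mem_nbr_iff.1 h.1, BipGraph.mem_nbr_iff.1 h.2⟩
    rw [ordProb, dif_pos h']
    have hk : ∀ i, M.ordKernel l (t.1, i) q = if q.2 ⟨t.1, h.1⟩ = i then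
        (1 : ℝ) / (M.conbr t.1).card * (l / Fintype.card (M.nbr q.1 ↪ Fin l)) else 0 := fun i => by
      rw [BipGraph.ordKernel_apply hl, dif_pos h.1]
    have hk' : ∀ i, P.ordKernel l (t.2, i) w = if w.2 ⟨t.2, h.2⟩ = i then
        (1 : ℝ) / (P.conbr t.2).card * (l / Fintype.card (P.nbr w.1 ↪ Fin l)) else 0 := fun i => by
      rw [BipGraph.ordKernel_apply hl, dif_pos h.2]
    rw [Finset.sum_eq_single (q.2 ⟨t.1, h.1⟩) (fun i _ hi => by rw [hk, if_neg hi.symm]; ring)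
      (fun hi => (hi (Finset.mem_univ _)).elim), hk, hk', if_pos rfl]
    by_cases hrs : q.2 ⟨t.1, h.1⟩ = w.2 ⟨t.2, h.2⟩
    · rw [if_pos hrs, if_pos hrs.symm]
      have hc := card_matching_labelings (l := l) (⟨t.1, h.1⟩ : M.nbr q.1) (⟨t.2, h.2⟩ : P.nbr w.1)
      have hE : (Fintype.card (M.nbr q.1 ↪ Fin l) : ℝ) ≠ 0 := by
        exact_mod_cast (Fintype.card_pos_iff.2 ⟨q.2⟩).ne'
      have hF : (Fintype.card (P.nbr w.1 ↪ Fin l) : ℝ) ≠ 0 := by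
        exact_mod_cast (Fintype.card_pos_iff.2 ⟨w.2⟩).ne'
      have hl' : (l : ℝ) ≠ 0 := by positivity
      have hc' : (Fintype.card {rs : (M.nbr q.1 ↪ Fin l) × (P.nbr w.1 ↪ Fin l) //
          rs.1 ⟨t.1, h.1⟩ = rs.2 ⟨t.2, h.2⟩} : ℝ) = Fintype.card (M.nbr q.1 ↪ Fin l)
            * Fintype.card (P.nbr w.1 ↪ Fin l) / l := by
        rw [eq_div_iff hl', mul_comm]
        exact_mod_cast hc
      rw [hc']
      generalize (Fintype.card (M.nbr q.1 ↪ Fin l) : ℝ) = E at hE ⊢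
      generalize (Fintype.card (P.nbr w.1 ↪ Fin l) : ℝ) = F at hF ⊢
      field_simp
    · rw [if_neg hrs, if_neg fun h2 => hrs h2.symm]
      ring
  · have h' : ¬((q.1, t.1) ∈ M ∧ (w.1, t.2) ∈ P) := fun h' =>
      h ⟨BipGraph.mem_nbr h'.1, BipGraph.mem_nbr h'.2⟩
    rw [ordProb, dif_neg h', Finset.sum_eq_zero]
    intro i _
    rcases not_and_or.1 h with h1 | h1
    · rw [BipGraph.ordKernel_eq_zero h1]; ring
    · rw [BipGraph.ordKernel_eq_zero (p := (t.2, i)) h1]; ring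

lemma winOp_orderedConcat [Fintype n] [DecidableEq n] (G : Game X Y A B) (M : BipGraph X' X)
    (P : BipGraph Y' Y) (hM : ∀ x, (M.conbr x).Nonempty) (hP : ∀ y, (P.conbr y).Nonempty)
    (t : X × Y) (q : M.OrdQuestion (labelCount M P)) (w : P.OrdQuestion (labelCount M P))
    (hx : t.1 ∈ M.nbr q.1) (hy : t.2 ∈ P.nbr w.1)
    (E : M.OrdAnswer (labelCount M P) A q → Matrix n n ℂ)
    (F : P.OrdAnswer (labelCount M P) B w → Matrix n n ℂ) :
    winOp ((orderedConcat G M P hM hP).V t q w) E F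
      = winOp (fun a b => G.V a b t.1 t.2)
        (margOp (fun a' : M.OrdAnswer (labelCount M P) A q => a' ⟨t.1, hx⟩) E)
        (margOp (fun b' : P.OrdAnswer (labelCount M P) B w => b' ⟨t.2, hy⟩) F) := by
  rw [winOp_margOp]
  congr 1
  funext a b
  exact propext ⟨fun ⟨_, _, h⟩ => h, fun h => ⟨hx, hy, h⟩⟩

lemma Game.value_eq_winOp {Q W : Type*} [Fintype Q] [Fintype W] (Γ : Game Q W A B)
    (S : QuantumSubstrategy Q W (fun _ => A) (fun _ => B)) :
    Γ.toRefereed.value S = ∑ q, ∑ w, Γ.μ q w *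
      quadForm S.ψ (winOp (fun a b => Γ.V a b q w) (S.PA q) (S.PB w)) := by
  rw [Γ.toRefereed.value_eq_winOp, Fintype.sum_unique]
  rfl

/-- The value of a substrategy for the ordered concatenation is that of the induced substrategy for
the disjoint union of copies of the inner game. -/
lemma value_orderedConcat (G : Game X Y A B) (M : BipGraph X' X) (P : BipGraph Y' Y)
    (hM : ∀ x, (M.conbr x).Nonempty) (hP : ∀ y, (P.conbr y).Nonempty)
    (S : QuantumSubstrategy (M.OrdQuestion (labelCount M P)) (P.OrdQuestion (labelCount M P))
      (M.OrdAnswer (labelCount M P) A) (P.OrdAnswer (labelCount M P) B)) :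
    (orderedConcat G M P hM hP).value S
      = (G.disjointCopies (labelCount M P) (labelCount_pos G M P hM)).toRefereed.value
          (S.induced hM hP (le_max_left _ _) (le_max_right _ _)) := by
  have hl := labelCount_pos G M P hM
  rw [RefereedGame.value_eq_winOp, Game.value_eq_winOp]
  -- Bilinearity of the winning operator expands the two averages. Terms with x or y outside the
  -- relevant neighbourhood, where the verdict is undefined, have kernel weight 0.
  have hR : ∀ (x : X) (i : Fin (labelCount M P)) (y : Y) (j : Fin (labelCount M P)),
      (G.disjointCopies (labelCount M P) hl).μ (x, i) (y, j) * quadForm S.ψ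
        (winOp (fun a b => (G.disjointCopies (labelCount M P) hl).V a b (x, i) (y, j))
          (M.inducedOp (labelCount M P) S.PA (x, i)) (P.inducedOp (labelCount M P) S.PB (y, j)))
      = if i = j then ∑ q, ∑ w, G.μ x y / (labelCount M P) * (M.ordKernel (labelCount M P) (x, i) q * P.ordKernel (labelCount M P) (y, i) w) *
          quadForm S.ψ (winOp ((orderedConcat G M P hM hP).V (x, y) q w) (S.PA q) (S.PB w))
        else 0 := by
    intro x i y j
    change (if i = j then G.μ x y / (labelCount M P) else 0) * _ = _
    split_ifs with hij
    · subst hij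
      unfold BipGraph.inducedOp
      rw [winOp_sum_smul]
      simp only [map_sum, map_smul, Finset.mul_sum, smul_eq_mul]
      refine Finset.sum_congr rfl fun q _ => Finset.sum_congr rfl fun w _ => ?_
      by_cases hx : x ∈ M.nbr q.1
      · by_cases hy : y ∈ P.nbr w.1
        · rw [winOp_orderedConcat G M P hM hP (x, y) q w hx hy]
          simp only [dif_pos hx, dif_pos hy]
          rw [← mul_assoc]
          rfl
        · rw [BipGraph.ordKernel_eq_zero (p := (y, i)) hy]; ring
      · rw [BipGraph.ordKernel_eq_zero (p := (x, i)) hx]; ring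
    · rw [zero_mul]
  have hRHS : ∑ p, ∑ p', (G.disjointCopies (labelCount M P) hl).μ p p' * quadForm S.ψ
        (winOp (fun a b => (G.disjointCopies (labelCount M P) hl).V a b p p')
          (M.inducedOp (labelCount M P) S.PA p) (P.inducedOp (labelCount M P) S.PB p'))
      = ∑ x, ∑ y, ∑ i, ∑ q, ∑ w,
          G.μ x y / (labelCount M P) * (M.ordKernel (labelCount M P) (x, i) q * P.ordKernel (labelCount M P) (y, i) w) *
          quadForm S.ψ (winOp ((orderedConcat G M P hM hP).V (x, y) q w) (S.PA q) (S.PB w)) := by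
    simp only [Fintype.sum_prod_type, hR, Finset.sum_ite_eq, Finset.mem_univ, if_true]
    exact Finset.sum_congr rfl fun x _ => Finset.sum_comm
  refine Eq.trans ?_ hRHS.symm
  rw [Fintype.sum_prod_type]
  refine Finset.sum_congr rfl fun x _ => Finset.sum_congr rfl fun y _ => ?_
  have hprob : ∀ q w, (orderedConcat G M P hM hP).prob (x, y) q w
      = ∑ i, G.μ x y / (labelCount M P) * (M.ordKernel (labelCount M P) (x, i) q * P.ordKernel (labelCount M P) (y, i) w) := fun q w =>
    ordProb_eq_sum G M P hl (x, y) q w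
  simp only [hprob, Finset.sum_mul]
  rw [Finset.sum_congr rfl fun q _ => Finset.sum_comm]
  exact Finset.sum_comm

/-- The value of a complete strategy for a disjoint union of copies is an average of values of
strategies for the single game. -/
lemma Game.value_disjointCopies_le (G : Game X Y A B) (l : ℕ) (hl : 0 < l)
    (S : QuantumSubstrategy (X × Fin l) (Y × Fin l) (fun _ => A) (fun _ => B))
    (hS : S.IsComplete) : (G.disjointCopies l hl).toRefereed.value S ≤ G.entangledValue := by
  rw [Game.value_eq_winOp]
  -- Both players know i, so fixing it gives a complete strategy for one copy of G on the same
  -- state.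
  have hi : ∀ i : Fin l, ∑ x, ∑ y, G.μ x y *
      quadForm S.ψ (winOp (fun a b => G.V a b x y) (S.PA (x, i)) (S.PB (y, i)))
        ≤ G.entangledValue := by
    intro i
    have h := G.toRefereed.sum_winOp_le S.ψ (fun x => S.PA (x, i)) (fun y => S.PB (y, i))
      (fun x a => (S.PA_psd _ a).nonneg) (fun x a => (S.PB_psd _ a).nonneg)
      (fun x => hS.1 _) (fun x => hS.2 _)
    rw [Fintype.sum_unique, S.quadForm_one, mul_one] at h
    exact h
  have hR : ∀ (x : X) (i : Fin l) (y : Y) (j : Fin l),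
      (G.disjointCopies l hl).μ (x, i) (y, j) * quadForm S.ψ
        (winOp (fun a b => (G.disjointCopies l hl).V a b (x, i) (y, j))
          (S.PA (x, i)) (S.PB (y, j)))
      = if i = j then (l : ℝ)⁻¹ * (G.μ x y *
          quadForm S.ψ (winOp (fun a b => G.V a b x y) (S.PA (x, i)) (S.PB (y, i)))) else 0 := by
    intro x i y j
    change (if i = j then G.μ x y / l else 0) * _ = _
    split_ifs with hij
    · subst hij
      rw [div_eq_inv_mul, mul_assoc]
      rfl
    · rw [zero_mul]
  have hsum : ∑ p, ∑ p', (G.disjointCopies l hl).μ p p' * quadForm S.ψ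
        (winOp (fun a b => (G.disjointCopies l hl).V a b p p') (S.PA p) (S.PB p'))
      = ∑ i : Fin l, (l : ℝ)⁻¹ * ∑ x, ∑ y, G.μ x y *
          quadForm S.ψ (winOp (fun a b => G.V a b x y) (S.PA (x, i)) (S.PB (y, i))) := by
    simp only [Fintype.sum_prod_type, hR, Finset.sum_ite_eq, Finset.mem_univ, if_true]
    rw [Finset.sum_congr rfl fun x _ => Finset.sum_comm]
    rw [Finset.sum_congr rfl fun x _ => Finset.sum_comm, Finset.sum_comm]
    simp only [Finset.mul_sum]
  rw [hsum]
  refine (Finset.sum_le_sum fun i _ => mul_le_mul_of_nonneg_left (hi i) (by positivity)).trans ?_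
  rw [Finset.sum_const, Finset.card_univ, Fintype.card_fin, nsmul_eq_mul]
  have : (l : ℝ) ≠ 0 := by positivity
  rw [← mul_assoc, mul_inv_cancel₀ this, one_mul]

lemma entangledValue_orderedConcat_le (G : Game X Y A B) (M : BipGraph X' X) (P : BipGraph Y' Y)
    (hM : ∀ x, (M.conbr x).Nonempty) (hP : ∀ y, (P.conbr y).Nonempty) :
    (orderedConcat G M P hM hP).entangledValue ≤ G.entangledValue := by
  refine Real.sSup_le ?_ G.toRefereed.entangledValue_nonneg
  rintro v ⟨S, hS, rfl⟩
  rw [value_orderedConcat]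
  exact G.value_disjointCopies_le _ _ _ (QuantumSubstrategy.induced_isComplete hM hP _ _ hS)

end InducedStrategies

/-! ### Tensor powers of strategies -/

section TensorPowers

open scoped MatrixOrder

variable {ι d : Type*} [Fintype ι] [DecidableEq ι] [Fintype d] [DecidableEq d]

/-- The tensor product of a family of square matrices of the same size. -/
def tensorOp (F : ι → Matrix d d ℂ) : Matrix (ι → d) (ι → d) ℂ :=
  Matrix.of fun f g => ∏ i, F i (f i) (g i)

/-- The tensor power of a bipartite vector. -/
def tensorState (ι : Type*) [Fintype ι] (ψ : d × d → ℂ) : (ι → d) × (ι → d) → ℂ :=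
  fun u => ∏ i, ψ (u.1 i, u.2 i)

lemma tensorOp_apply (F : ι → Matrix d d ℂ) (f g : ι → d) :
    tensorOp F f g = ∏ i, F i (f i) (g i) := rfl

lemma tensorOp_mul (F F' : ι → Matrix d d ℂ) :
    tensorOp F * tensorOp F' = tensorOp fun i => F i * F' i := by
  ext f g
  simp only [Matrix.mul_apply, tensorOp_apply, ← Finset.prod_mul_distrib]
  rw [Finset.prod_univ_sum, Fintype.piFinset_univ]

lemma tensorOp_conjTranspose (F : ι → Matrix d d ℂ) :
    (tensorOp F)ᴴ = tensorOp fun i => (F i)ᴴ := by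
  ext f g
  simp only [Matrix.conjTranspose_apply, tensorOp_apply, star_prod]

lemma tensorOp_one : tensorOp (fun _ : ι => (1 : Matrix d d ℂ)) = 1 := by
  ext f g
  simp only [tensorOp_apply, Matrix.one_apply, funext_iff]
  by_cases h : ∀ i, f i = g i
  · simp [h]
  · rw [if_neg h]
    push Not at h
    obtain ⟨i, hi⟩ := h
    exact Finset.prod_eq_zero (Finset.mem_univ i) (if_neg hi)

lemma tensorOp_nonneg {F : ι → Matrix d d ℂ} (hF : ∀ i, 0 ≤ F i) : 0 ≤ tensorOp F := by
  have h : ∀ i, ∃ C : Matrix d d ℂ, F i = Cᴴ * C := fun i => by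
    refine ⟨CFC.sqrt (F i), ?_⟩
    rw [(Matrix.nonneg_iff_posSemidef.1 (CFC.sqrt_nonneg (F i))).isHermitian.eq,
      CFC.sqrt_mul_sqrt_self _ (hF i)]
  choose C hC using h
  have e : tensorOp F = (tensorOp C)ᴴ * tensorOp C := by
    rw [tensorOp_conjTranspose, tensorOp_mul]
    exact congrArg tensorOp (funext hC)
  rw [e]
  exact (Matrix.posSemidef_conjTranspose_mul_self _).nonneg

/-- Expanding the product of sums gives sums over functions ι → d × d, which are pairs of functions
ι → d, the indices of the tensor power. -/
lemma tensorState_expectation (ψ : d × d → ℂ) (F F' : ι → Matrix d d ℂ) :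
    star (tensorState ι ψ) ⬝ᵥ ((tensorOp F ⊗ₖ tensorOp F') *ᵥ tensorState ι ψ)
      = ∏ i, star ψ ⬝ᵥ ((F i ⊗ₖ F' i) *ᵥ ψ) := by
  have hR : ∀ i, star ψ ⬝ᵥ ((F i ⊗ₖ F' i) *ᵥ ψ)
      = ∑ u : d × d, ∑ v : d × d, star (ψ u) * (F i u.1 v.1 * F' i u.2 v.2 * ψ v) := by
    intro i
    simp only [dotProduct, Matrix.mulVec, Pi.star_apply, Finset.mul_sum,
      Matrix.kroneckerMap_apply]
  simp only [hR]
  rw [Finset.prod_univ_sum, Fintype.piFinset_univ]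
  simp only [Finset.prod_univ_sum, Fintype.piFinset_univ]
  simp only [dotProduct, Matrix.mulVec, Pi.star_apply, Finset.mul_sum, Matrix.kroneckerMap_apply]
  rw [← (Equiv.arrowProdEquivProdArrow ι (fun _ => d) (fun _ => d)).sum_comp]
  refine Finset.sum_congr rfl fun U _ => ?_
  rw [← (Equiv.arrowProdEquivProdArrow ι (fun _ => d) (fun _ => d)).sum_comp]
  refine Finset.sum_congr rfl fun V _ => ?_
  simp only [tensorState, tensorOp_apply, star_prod, ← Finset.prod_mul_distrib]
  rfl

lemma tensorState_unit {ψ : d × d → ℂ} (hψ : star ψ ⬝ᵥ ψ = 1) :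
    star (tensorState ι ψ) ⬝ᵥ tensorState ι ψ = 1 := by
  have h := tensorState_expectation (ι := ι) ψ (fun _ => 1) (fun _ => 1)
  simpa [tensorOp_one, hψ] using h

lemma quadForm_tensorState_update {ψ : d × d → ℂ} (hψ : star ψ ⬝ᵥ ψ = 1) (i : ι)
    (P Q : Matrix d d ℂ) :
    quadForm (tensorState ι ψ) (tensorOp (Function.update (fun _ => 1) i P) ⊗ₖ
      tensorOp (Function.update (fun _ => 1) i Q)) = quadForm ψ (P ⊗ₖ Q) := by
  rw [quadForm_apply, tensorState_expectation, Finset.prod_eq_single i]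
  · simp [quadForm_apply]
  · intro j _ hj
    simp [Function.update_of_ne hj, hψ]
  · simp

variable {α : Type*} [Fintype α] [DecidableEq α]

open Classical in
/-- The family of operators that has `E z` in position `r z`, and the identity elsewhere. -/
noncomputable def slotOp (r : α ↪ ι) (E : α → Matrix d d ℂ) (i : ι) : Matrix d d ℂ :=
  if h : ∃ z, r z = i then E h.choose else 1

lemma slotOp_apply (r : α ↪ ι) (E : α → Matrix d d ℂ) (z : α) : slotOp r E (r z) = E z := by
  have h : ∃ z', r z' = r z := ⟨z, rfl⟩
  rw [slotOp, dif_pos h, r.injective h.choose_spec]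

lemma slotOp_of_forall_ne (r : α ↪ ι) (E : α → Matrix d d ℂ) {i : ι} (h : ∀ z, r z ≠ i) :
    slotOp r E i = 1 := by
  rw [slotOp, dif_neg (by push Not; exact h)]

lemma slotOp_nonneg (r : α ↪ ι) {E : α → Matrix d d ℂ} (hE : ∀ z, 0 ≤ E z) (i : ι) :
    0 ≤ slotOp r E i := by
  unfold slotOp
  split_ifs
  · exact hE _
  · exact Matrix.PosSemidef.one.nonneg

lemma slotOp_one (r : α ↪ ι) : slotOp r (fun _ => (1 : Matrix d d ℂ)) = fun _ => 1 := by
  funext i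
  unfold slotOp
  split_ifs <;> rfl

lemma slotOp_ite (r : α ↪ ι) (x : α) (Q : Matrix d d ℂ) :
    slotOp r (fun z => if z = x then Q else 1) = Function.update (fun _ => 1) (r x) Q := by
  funext i
  by_cases h : ∃ z, r z = i
  · obtain ⟨z, rfl⟩ := h
    rw [slotOp_apply]
    by_cases hz : z = x
    · rw [if_pos hz, hz, Function.update_self]
    · rw [if_neg hz, Function.update_of_ne fun h => hz (r.injective h)]
  · push Not at h
    rw [slotOp_of_forall_ne r _ h, Function.update_of_ne (h x).symm]

lemma tensorOp_slotOp_apply (r : α ↪ ι) (E : α → Matrix d d ℂ) (f g : ι → d) :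
    tensorOp (slotOp r E) f g = (∏ z, E z (f (r z)) (g (r z))) *
      ∏ i ∈ Finset.univ \ Finset.univ.map r, (1 : Matrix d d ℂ) (f i) (g i) := by
  rw [tensorOp_apply, ← Finset.prod_sdiff (Finset.subset_univ (Finset.univ.map r)), mul_comm,
    Finset.prod_map]
  congr 1
  · exact Finset.prod_congr rfl fun z _ => by rw [slotOp_apply]
  · refine Finset.prod_congr rfl fun i hi => ?_
    rw [slotOp_of_forall_ne]
    intro z hz
    exact (Finset.mem_sdiff.1 hi).2 (Finset.mem_map.2 ⟨z, Finset.mem_univ z, hz⟩)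

/-- Injectivity of r puts the factors in distinct slots, so the sum over answer functions factors as
a product of sums. -/
lemma sum_tensorOp_slotOp {β : Type*} (r : α ↪ ι) (K : α → β → Matrix d d ℂ)
    (s : α → Finset β) :
    ∑ a ∈ Fintype.piFinset s, tensorOp (slotOp r fun z => K z (a z))
      = tensorOp (slotOp r fun z => ∑ b ∈ s z, K z b) := by
  ext f g
  rw [Matrix.sum_apply]
  simp only [tensorOp_slotOp_apply, Matrix.sum_apply]
  rw [← Finset.sum_mul, Finset.prod_univ_sum]

/-- Fixing the answer at x and summing freely over the others completes every other measurement to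
the identity, leaving only slot r(x). -/
lemma margOp_tensorOp_slotOp {β : Type*} [Fintype β] (r : α ↪ ι) {K : α → β → Matrix d d ℂ}
    (hK : ∀ z, ∑ b, K z b = 1) (x : α) (b : β) :
    margOp (fun a : α → β => a x) (fun a => tensorOp (slotOp r fun z => K z (a z))) b
      = tensorOp (Function.update (fun _ => 1) (r x) (K x b)) := by
  classical
  have h := sum_tensorOp_slotOp r K fun z => if z = x then {b} else Finset.univ
  have e : (fun z => ∑ b' ∈ (if z = x then {b} else Finset.univ), K z b')
      = fun z => if z = x then K x b else 1 := by
    funext z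
    split_ifs with hz
    · rw [Finset.sum_singleton, hz]
    · exact hK z
  rw [e, slotOp_ite] at h
  rw [← h, margOp, ← Finset.sum_filter]
  refine Finset.sum_congr ?_ fun _ _ => rfl
  ext a
  simp only [Finset.mem_filter, Finset.mem_univ, true_and, Fintype.mem_piFinset]
  constructor
  · intro ha z
    split_ifs with hz
    · rw [hz, ha]; exact Finset.mem_singleton_self b
    · exact Finset.mem_univ _
  · intro ha
    simpa using ha x

lemma sum_tensorOp_slotOp_eq_one {β : Type*} [Fintype β] (r : α ↪ ι) {K : α → β → Matrix d d ℂ}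
    (hK : ∀ z, ∑ b, K z b = 1) :
    ∑ a : α → β, tensorOp (slotOp r fun z => K z (a z)) = 1 := by
  have h := sum_tensorOp_slotOp r K fun _ => Finset.univ
  rw [Fintype.piFinset_univ] at h
  rw [h]
  simp only [hK]
  rw [slotOp_one, tensorOp_one]

end TensorPowers

/-! ### Strategies on arbitrary finite index types -/

section FiniteDimensionalModels

open scoped MatrixOrder

variable {T X Y : Type*} {A : X → Type*} {B : Y → Type*}
  [Fintype T] [Fintype X] [Fintype Y] [∀ x, Fintype (A x)] [∀ y, Fintype (B y)]

lemma quadForm_submatrix_equiv {n m : Type*} [Fintype n] [Fintype m] [DecidableEq n]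
    [DecidableEq m] (e : m ≃ n) (φ : n → ℂ)
    (W : Matrix n n ℂ) : quadForm (φ ∘ e) (W.submatrix e e) = quadForm φ W := by
  rw [quadForm_apply, Matrix.submatrix_mulVec_equiv, quadForm_apply]
  congr 1
  have h1 : (φ ∘ e) ∘ e.symm = φ := by funext i; simp
  rw [h1]
  exact e.sum_comp fun i => star φ i * (W *ᵥ φ) i

/-- Complete measurements on a pair of finite-dimensional spaces of the same dimension do not beat
the entangled value. -/
lemma RefereedGame.sum_winOp_le_of_fintype (H : RefereedGame T X Y A B) {n : Type*} [Fintype n]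
    [DecidableEq n] (φ : n × n → ℂ) (M : (x : X) → A x → Matrix n n ℂ)
    (N : (y : Y) → B y → Matrix n n ℂ) (hM : ∀ x a, 0 ≤ M x a) (hN : ∀ y b, 0 ≤ N y b)
    (hM1 : ∀ x, ∑ a, M x a = 1) (hN1 : ∀ y, ∑ b, N y b = 1) :
    ∑ t, ∑ x, ∑ y, H.prob t x y * quadForm φ (winOp (H.V t x y) (M x) (N y))
      ≤ H.entangledValue * quadForm φ 1 := by
  let e : Fin (Fintype.card n) ≃ n := (Fintype.equivFin n).symm
  let e2 : Fin (Fintype.card n) × Fin (Fintype.card n) ≃ n × n := e.prodCongr e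
  have h := H.sum_winOp_le (φ ∘ e2) (fun x a => (M x a).submatrix e e)
    (fun y b => (N y b).submatrix e e)
    (fun x a => ((Matrix.nonneg_iff_posSemidef.1 (hM x a)).submatrix e).nonneg)
    (fun x a => ((Matrix.nonneg_iff_posSemidef.1 (hN x a)).submatrix e).nonneg)
    (fun x => by
      rw [← Matrix.submatrix_one_equiv e, ← hM1 x]
      ext i j
      simp [Matrix.sum_apply])
    (fun y => by
      rw [← Matrix.submatrix_one_equiv e, ← hN1 y]
      ext i j
      simp [Matrix.sum_apply])
  have hw : ∀ t x y, winOp (H.V t x y) (fun a => (M x a).submatrix e e)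
      (fun b => (N y b).submatrix e e) = (winOp (H.V t x y) (M x) (N y)).submatrix e2 e2 := by
    intro t x y
    ext i j
    simp only [winOp, Matrix.sum_apply, Matrix.submatrix_apply]
    refine Finset.sum_congr rfl fun a _ => Finset.sum_congr rfl fun b _ => ?_
    split_ifs <;> rfl
  simp only [hw, quadForm_submatrix_equiv] at h
  rwa [← Matrix.submatrix_one_equiv e2, quadForm_submatrix_equiv] at h

end FiniteDimensionalModels

/-! ### The lower bound on the value of the ordered concatenation -/

section OrderedConcatenationValue

open scoped MatrixOrder

variable {X' X : Type*} [Fintype X'] [Fintype X] [DecidableEq X'] [DecidableEq X]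
  {A : Type*} [Fintype A]
  {Y' Y B : Type*} [Fintype Y'] [Fintype Y] [DecidableEq Y'] [DecidableEq Y] [Fintype B]

/-- The operators of a player who uses a separate copy of the system for each label. -/
noncomputable def BipGraph.powerOp {d : Type*} [Fintype d] [DecidableEq d] (M : BipGraph X' X)
    (l : ℕ) (E : X → A → Matrix d d ℂ) (q : M.OrdQuestion l) (a : M.OrdAnswer l A q) :
    Matrix (Fin l → d) (Fin l → d) ℂ :=
  tensorOp (slotOp q.2 fun z => E z.1 (a z))

lemma BipGraph.powerOp_nonneg {d : Type*} [Fintype d] [DecidableEq d] (M : BipGraph X' X)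
    (l : ℕ) {E : X → A → Matrix d d ℂ} (hE : ∀ x a, 0 ≤ E x a) (q : M.OrdQuestion l)
    (a : M.OrdAnswer l A q) : 0 ≤ M.powerOp l E q a :=
  tensorOp_nonneg (slotOp_nonneg _ fun _ => hE _ _)

lemma BipGraph.sum_powerOp {d : Type*} [Fintype d] [DecidableEq d] (M : BipGraph X' X)
    (l : ℕ) {E : X → A → Matrix d d ℂ} (hE : ∀ x, ∑ a, E x a = 1) (q : M.OrdQuestion l) :
    ∑ a, M.powerOp l E q a = 1 :=
  sum_tensorOp_slotOp_eq_one q.2 (K := fun z a => E z.1 a) fun z => hE z.1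

lemma BipGraph.margOp_powerOp {d : Type*} [Fintype d] [DecidableEq d] (M : BipGraph X' X)
    (l : ℕ) {E : X → A → Matrix d d ℂ} (hE : ∀ x, ∑ a, E x a = 1) (q : M.OrdQuestion l) {x : X}
    (hx : x ∈ M.nbr q.1) :
    margOp (fun a' : M.OrdAnswer l A q => a' ⟨x, hx⟩) (M.powerOp l E q)
      = fun a => tensorOp (Function.update (fun _ => 1) (q.2 ⟨x, hx⟩) (E x a)) := by
  funext a
  exact margOp_tensorOp_slotOp q.2 (K := fun z a => E z.1 a) (fun z => hE z.1) ⟨x, hx⟩ a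

lemma sum_orderedConcat_prob (G : Game X Y A B) (M : BipGraph X' X) (P : BipGraph Y' Y)
    (hM : ∀ x, (M.conbr x).Nonempty) (hP : ∀ y, (P.conbr y).Nonempty) (t : X × Y) :
    ∑ q, ∑ w, (orderedConcat G M P hM hP).prob t q w = G.μ t.1 t.2 :=
  sum_ordProb G M P _ le_rfl hM hP t

/-- Using `l` copies of an entangled state, the players can answer all the questions in a
neighbourhood. -/
lemma value_le_entangledValue_orderedConcat (G : Game X Y A B) (M : BipGraph X' X)
    (P : BipGraph Y' Y) (hM : ∀ x, (M.conbr x).Nonempty) (hP : ∀ y, (P.conbr y).Nonempty)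
    (S : QuantumSubstrategy X Y (fun _ => A) (fun _ => B)) (hS : S.IsComplete) :
    G.toRefereed.value S ≤ (orderedConcat G M P hM hP).entangledValue := by
  let Ψ := tensorState (Fin (labelCount M P)) S.ψ
  have hΨ : quadForm Ψ 1 = 1 := by
    rw [quadForm_apply, Matrix.one_mulVec, tensorState_unit S.ψ_unit, Complex.one_re]
  have h := (orderedConcat G M P hM hP).sum_winOp_le_of_fintype Ψ
    (M.powerOp (labelCount M P) S.PA) (P.powerOp (labelCount M P) S.PB)
    (M.powerOp_nonneg _ fun x a => (S.PA_psd x a).nonneg)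
    (P.powerOp_nonneg _ fun y b => (S.PB_psd y b).nonneg)
    (M.sum_powerOp _ hS.1) (P.sum_powerOp _ hS.2)
  rw [hΨ, mul_one] at h
  refine le_trans (le_of_eq ?_) h
  have hpt : ∀ t q w, (orderedConcat G M P hM hP).prob t q w *
        quadForm Ψ (winOp ((orderedConcat G M P hM hP).V t q w)
          (M.powerOp (labelCount M P) S.PA q) (P.powerOp (labelCount M P) S.PB w))
      = (orderedConcat G M P hM hP).prob t q w *
        quadForm S.ψ (winOp (fun a b => G.V a b t.1 t.2) (S.PA t.1) (S.PB t.2)) := by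
    intro t q w
    by_cases hmem : (q.1, t.1) ∈ M ∧ (w.1, t.2) ∈ P
    -- When the labels match, both marginals act on the same copy and the other copies contribute
    -- ⟨ψ, ψ⟩ = 1; otherwise the probability is 0.
    · by_cases hrs : q.2 ⟨t.1, BipGraph.mem_nbr hmem.1⟩ = w.2 ⟨t.2, BipGraph.mem_nbr hmem.2⟩
      · refine congrArg (HMul.hMul ((orderedConcat G M P hM hP).prob t q w)) ?_
        rw [winOp_orderedConcat G M P hM hP t q w (BipGraph.mem_nbr hmem.1)
          (BipGraph.mem_nbr hmem.2)]
        rw [M.margOp_powerOp _ hS.1, P.margOp_powerOp _ hS.2, hrs]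
        simp only [winOp, map_sum]
        refine Finset.sum_congr rfl fun a _ => Finset.sum_congr rfl fun b _ => ?_
        split_ifs
        · exact quadForm_tensorState_update S.ψ_unit _ _ _
        · rw [map_zero, map_zero]
      · have h0 : (orderedConcat G M P hM hP).prob t q w = 0 := by
          change ordProb G M P _ t q w = 0
          rw [ordProb, dif_pos hmem, if_neg hrs]
        rw [h0, zero_mul, zero_mul]
    · have h0 : (orderedConcat G M P hM hP).prob t q w = 0 := by
        change ordProb G M P _ t q w = 0
        rw [ordProb, dif_neg hmem]
      rw [h0, zero_mul, zero_mul]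
  simp only [hpt, ← Finset.sum_mul, sum_orderedConcat_prob]
  rw [Game.value_eq_winOp, Fintype.sum_prod_type]

lemma entangledValue_le_orderedConcat (G : Game X Y A B) (M : BipGraph X' X) (P : BipGraph Y' Y)
    (hM : ∀ x, (M.conbr x).Nonempty) (hP : ∀ y, (P.conbr y).Nonempty) :
    G.entangledValue ≤ (orderedConcat G M P hM hP).entangledValue := by
  refine Real.sSup_le ?_ (RefereedGame.entangledValue_nonneg _)
  rintro v ⟨S, hS, rfl⟩
  exact value_le_entangledValue_orderedConcat G M P hM hP S hS

end OrderedConcatenationValue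

/-! ### Concentration for operators and fortification -/

section Fortification

open scoped MatrixOrder

lemma quadForm_conjTranspose_mul_self {n : Type*} [Fintype n] [DecidableEq n] (ψ : n → ℂ)
    (N : Matrix n n ℂ) :
    quadForm ψ (Nᴴ * N) = ∑ i, (((N *ᵥ ψ) i).re ^ 2 + ((N *ᵥ ψ) i).im ^ 2) := by
  have h := quadForm_mulVec ψ N 1
  rw [Matrix.mul_one] at h
  rw [← h, quadForm_one]
  refine Finset.sum_congr rfl fun i _ => ?_
  rw [← Complex.normSq_eq_norm_sq, Complex.normSq_apply]
  ring

/-- E² ≤ E ≤ 1, where E - E² = E(1 - E)E + (1 - E)E(1 - E) is a sum of positive terms. -/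
lemma conjTranspose_mul_self_le_one {n : Type*} [Fintype n] [DecidableEq n] {E : Matrix n n ℂ}
    (h0 : 0 ≤ E) (h1 : E ≤ 1) : Eᴴ * E ≤ 1 := by
  have hE : Eᴴ = E := (Matrix.nonneg_iff_posSemidef.1 h0).isHermitian
  have hF : (1 - E)ᴴ = 1 - E := by rw [Matrix.conjTranspose_sub, hE, Matrix.conjTranspose_one]
  refine le_trans ?_ h1
  rw [← sub_nonneg]
  have e : E - Eᴴ * E = Eᴴ * (1 - E) * E + (1 - E)ᴴ * E * (1 - E) := by
    rw [hF, hE]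
    noncomm_ring
  rw [e]
  exact add_nonneg ((Matrix.le_iff.1 h1).conjTranspose_mul_mul_same _).nonneg
    ((Matrix.nonneg_iff_posSemidef.1 h0).conjTranspose_mul_mul_same _).nonneg

variable {X' X : Type*} [Fintype X'] [Fintype X] [DecidableEq X'] [DecidableEq X]

/-- Operator-valued averages over the neighbours of labeled questions are concentrated. -/
lemma BipGraph.IsSpectralExpander.sum_quadForm_sub_mean_le {M : BipGraph X' X} {d l : ℕ}
    {lam η : ℝ} (hM : M.IsSpectralExpander d lam) (hd : 0 < d) (hlam : lam < 1)
    (hη : lam ^ 2 ≤ η ^ 2) (hη0 : 0 < η) (hX : 1 ≤ η ^ 2 * Fintype.card X) (hl : M.maxDeg ≤ l)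
    {n : Type*} [Fintype n] [DecidableEq n] (ψ : n → ℂ) (N : M.OrdQuestion l → Matrix n n ℂ)
    (N₀ : Matrix n n ℂ) (hN₀ : ∑ p, (∑ q, M.ordKernel l p q • N q - N₀) = 0) :
    ∑ p, quadForm ψ
        ((∑ q, M.ordKernel l p q • N q - N₀)ᴴ * (∑ q, M.ordKernel l p q • N q - N₀))
      ≤ 16 * η ^ 2 * ∑ p, ∑ q, M.ordKernel l p q * quadForm ψ ((N q)ᴴ * N q) := by
  have hv : ∀ p i, ((∑ q, M.ordKernel l p q • N q - N₀) *ᵥ ψ) i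
      = ∑ q, (M.ordKernel l p q : ℂ) * (N q *ᵥ ψ) i - (N₀ *ᵥ ψ) i := by
    intro p i
    rw [Matrix.sub_mulVec, Matrix.sum_mulVec, Pi.sub_apply, Finset.sum_apply]
    simp only [Matrix.smul_mulVec, Pi.smul_apply, Complex.real_smul]
  have hre : ∀ p i, (((∑ q, M.ordKernel l p q • N q - N₀) *ᵥ ψ) i).re
      = ∑ q, M.ordKernel l p q * ((N q *ᵥ ψ) i).re - ((N₀ *ᵥ ψ) i).re := by
    intro p i
    rw [hv, Complex.sub_re, Complex.re_sum]
    simp only [Complex.re_ofReal_mul]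
  have him : ∀ p i, (((∑ q, M.ordKernel l p q • N q - N₀) *ᵥ ψ) i).im
      = ∑ q, M.ordKernel l p q * ((N q *ᵥ ψ) i).im - ((N₀ *ᵥ ψ) i).im := by
    intro p i
    rw [hv, Complex.sub_im, Complex.im_sum]
    simp only [Complex.im_ofReal_mul]
  have hsum0 : ∀ i, ∑ p, ((∑ q, M.ordKernel l p q • N q - N₀) *ᵥ ψ) i = 0 := by
    intro i
    rw [← Finset.sum_apply, ← Matrix.sum_mulVec, hN₀, Matrix.zero_mulVec, Pi.zero_apply]
  -- The form is the squared norm of a vector, so the scalar inequality is applied to the real and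
  -- imaginary part of each coordinate and summed; the dimension does not enter.
  have hR : ∀ i, _ := fun i => hM.sum_sq_sub_mean_le hd hlam hη hη0 hX hl
    (fun q => ((N q *ᵥ ψ) i).re) ((N₀ *ᵥ ψ) i).re (by
      simp only [← hre, ← Complex.re_sum, hsum0, Complex.zero_re])
  have hI : ∀ i, _ := fun i => hM.sum_sq_sub_mean_le hd hlam hη hη0 hX hl
    (fun q => ((N q *ᵥ ψ) i).im) ((N₀ *ᵥ ψ) i).im (by
      simp only [← him, ← Complex.im_sum, hsum0, Complex.zero_im])
  have hs := Finset.sum_le_sum fun i (_ : i ∈ Finset.univ) => add_le_add (hR i) (hI i)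
  simp only [quadForm_conjTranspose_mul_self, hre, him]
  rw [Finset.sum_comm]
  simp only [Finset.sum_add_distrib] at hs ⊢
  refine hs.trans (le_of_eq ?_)
  simp only [mul_add, Finset.sum_add_distrib, Finset.mul_sum]
  congr 1
  · rw [Finset.sum_comm]
    exact Finset.sum_congr rfl fun p _ => Finset.sum_comm
  · rw [Finset.sum_comm]
    exact Finset.sum_congr rfl fun p _ => Finset.sum_comm

variable {Y' Y A B : Type*} [Fintype Y'] [Fintype Y] [DecidableEq Y'] [DecidableEq Y]
  [Fintype A] [Fintype B]

/-- Averages of operators bounded by one over the neighbours of uniformly random labeled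
questions. -/
lemma BipGraph.IsSpectralExpander.average_quadForm_sub_mean_le {M : BipGraph X' X} {d l : ℕ}
    {lam η : ℝ} (hM : M.IsSpectralExpander d lam) (hMne : ∀ x, (M.conbr x).Nonempty)
    (hlam : lam < 1) (hη : lam ^ 2 ≤ η ^ 2) (hη0 : 0 < η) (hX : 1 ≤ η ^ 2 * Fintype.card X)
    (hl : M.maxDeg ≤ l) {n : Type*} [Fintype n] [DecidableEq n] {ψ : n → ℂ}
    (hψ : quadForm ψ 1 = 1) {N : M.OrdQuestion l → Matrix n n ℂ} (hN0 : ∀ q, 0 ≤ N q)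
    (hN1 : ∀ q, N q ≤ 1) {u : ℝ} (hu : u * (Fintype.card X * l) = 1) {N₀ : Matrix n n ℂ}
    (hN₀ : ∑ p, u • ∑ q, M.ordKernel l p q • N q = N₀) :
    ∑ p, u * quadForm ψ
        ((∑ q, M.ordKernel l p q • N q - N₀)ᴴ * (∑ q, M.ordKernel l p q • N q - N₀))
      ≤ 16 * η ^ 2 := by
  have hu0 : 0 < u := by
    by_contra hneg
    have : u * (Fintype.card X * l) ≤ 0 :=
      mul_nonpos_of_nonpos_of_nonneg (not_lt.1 hneg) (by positivity)
    linarith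
  have hd : 0 < d := by
    have hX0 : (Fintype.card X : ℝ) ≠ 0 := by
      intro h0
      rw [h0, mul_zero] at hX
      linarith
    obtain ⟨x⟩ : Nonempty X := Fintype.card_pos_iff.1 (Nat.pos_of_ne_zero (by exact_mod_cast hX0))
    rw [← hM.1 x]
    exact Finset.card_pos.2 (hMne x)
  have hcard : u * Fintype.card (X × Fin l) = 1 := by
    rw [Fintype.card_prod, Fintype.card_fin]
    push_cast
    exact hu
  have hmean : ∑ p, (∑ q, M.ordKernel l p q • N q - N₀) = 0 := by
    have h1 : ∑ p : X × Fin l, u • N₀ = N₀ := by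
      rw [Finset.sum_const, Finset.card_univ, ← Nat.cast_smul_eq_nsmul ℝ, smul_smul, mul_comm,
        hcard, one_smul]
    have h2 : u • ∑ p, (∑ q, M.ordKernel l p q • N q - N₀) = 0 := by
      rw [Finset.smul_sum]
      simp only [smul_sub, Finset.sum_sub_distrib]
      rw [hN₀, h1, sub_self]
    exact (smul_eq_zero.1 h2).resolve_left hu0.ne'
  have h := hM.sum_quadForm_sub_mean_le hd hlam hη hη0 hX hl ψ N N₀ hmean
  have hone : ∀ q, quadForm ψ ((N q)ᴴ * N q) ≤ 1 := fun q => by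
    rw [← hψ]
    exact quadForm_mono ψ (conjTranspose_mul_self_le_one (hN0 q) (hN1 q))
  have h2 : ∑ p, ∑ q, M.ordKernel l p q * quadForm ψ ((N q)ᴴ * N q)
      ≤ Fintype.card (X × Fin l) := by
    have : ∀ p ∈ Finset.univ, ∑ q, M.ordKernel l p q * quadForm ψ ((N q)ᴴ * N q) ≤ 1 := by
      intro p _
      rw [← BipGraph.sum_ordKernel hl p (hMne p.1)]
      exact Finset.sum_le_sum fun q _ =>
        mul_le_of_le_one_right (M.ordKernel_nonneg l p q) (hone q)
    refine (Finset.sum_le_sum this).trans ?_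
    simp
  rw [← Finset.mul_sum]
  calc _ ≤ u * (16 * η ^ 2 * Fintype.card (X × Fin l)) :=
        mul_le_mul_of_nonneg_left (h.trans (mul_le_mul_of_nonneg_left h2 (by positivity))) hu0.le
    _ = 16 * η ^ 2 * (u * Fintype.card (X × Fin l)) := by ring
    _ = 16 * η ^ 2 := by rw [hcard, mul_one]

lemma BipGraph.IsSpectralExpander.average_kronecker_left_sub_mean_le {M : BipGraph X' X}
    {d l : ℕ} {lam η : ℝ} (hM : M.IsSpectralExpander d lam) (hMne : ∀ x, (M.conbr x).Nonempty)
    (hlam : lam < 1) (hη : lam ^ 2 ≤ η ^ 2) (hη0 : 0 < η) (hX : 1 ≤ η ^ 2 * Fintype.card X)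
    (hl : M.maxDeg ≤ l) {n m : Type*} [Fintype n] [DecidableEq n] [Fintype m] [DecidableEq m]
    {ψ : n × m → ℂ} (hψ : quadForm ψ 1 = 1) {E : M.OrdQuestion l → Matrix n n ℂ}
    (hE0 : ∀ q, 0 ≤ E q) (hE1 : ∀ q, E q ≤ 1) {E' : X × Fin l → Matrix n n ℂ}
    (hE' : ∀ p, E' p = ∑ q, M.ordKernel l p q • E q) {u : ℝ}
    (hu : u * (Fintype.card X * l) = 1) {E₀ : Matrix n n ℂ} (hE₀ : ∑ p, u • E' p = E₀) :
    ∑ p, u * quadForm ψ (((E' p - E₀)ᴴ * (E' p - E₀)) ⊗ₖ 1) ≤ 16 * η ^ 2 := by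
  have hk : ∀ p, ∑ q, M.ordKernel l p q • (E q ⊗ₖ (1 : Matrix m m ℂ)) = E' p ⊗ₖ (1 : Matrix m m ℂ) := by
    intro p
    simp only [hE', sum_kronecker, Matrix.smul_kronecker]
  have h := hM.average_quadForm_sub_mean_le hMne hlam hη hη0 hX hl hψ
    (N := fun q => E q ⊗ₖ (1 : Matrix m m ℂ)) (N₀ := E₀ ⊗ₖ (1 : Matrix m m ℂ))
    (fun q => kronecker_nonneg (hE0 q) Matrix.PosSemidef.one.nonneg)
    (fun q => by
      rw [← Matrix.one_kronecker_one]
      exact kronecker_mono_left (hE1 q) Matrix.PosSemidef.one.nonneg)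
    hu (by simp only [hk, ← hE₀, sum_kronecker, Matrix.smul_kronecker])
  refine le_trans (le_of_eq ?_) h
  refine Finset.sum_congr rfl fun p _ => ?_
  rw [hk, ← sub_kronecker, Matrix.conjTranspose_kronecker, ← Matrix.mul_kronecker_mul,
    Matrix.conjTranspose_one, Matrix.one_mul]

lemma BipGraph.IsSpectralExpander.average_kronecker_right_sub_mean_le {M : BipGraph X' X}
    {d l : ℕ} {lam η : ℝ} (hM : M.IsSpectralExpander d lam) (hMne : ∀ x, (M.conbr x).Nonempty)
    (hlam : lam < 1) (hη : lam ^ 2 ≤ η ^ 2) (hη0 : 0 < η) (hX : 1 ≤ η ^ 2 * Fintype.card X)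
    (hl : M.maxDeg ≤ l) {n m : Type*} [Fintype n] [DecidableEq n] [Fintype m] [DecidableEq m]
    {ψ : m × n → ℂ} (hψ : quadForm ψ 1 = 1) {E : M.OrdQuestion l → Matrix n n ℂ}
    (hE0 : ∀ q, 0 ≤ E q) (hE1 : ∀ q, E q ≤ 1) {E' : X × Fin l → Matrix n n ℂ}
    (hE' : ∀ p, E' p = ∑ q, M.ordKernel l p q • E q) {u : ℝ}
    (hu : u * (Fintype.card X * l) = 1) {E₀ : Matrix n n ℂ} (hE₀ : ∑ p, u • E' p = E₀) :
    ∑ p, u * quadForm ψ (1 ⊗ₖ ((E' p - E₀)ᴴ * (E' p - E₀))) ≤ 16 * η ^ 2 := by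
  have hk : ∀ p, ∑ q, M.ordKernel l p q • ((1 : Matrix m m ℂ) ⊗ₖ E q) = (1 : Matrix m m ℂ) ⊗ₖ E' p := by
    intro p
    simp only [hE', kronecker_sum, Matrix.kronecker_smul]
  have h := hM.average_quadForm_sub_mean_le hMne hlam hη hη0 hX hl hψ
    (N := fun q => (1 : Matrix m m ℂ) ⊗ₖ E q) (N₀ := (1 : Matrix m m ℂ) ⊗ₖ E₀)
    (fun q => kronecker_nonneg Matrix.PosSemidef.one.nonneg (hE0 q))
    (fun q => by
      rw [← Matrix.one_kronecker_one]
      exact kronecker_mono_right Matrix.PosSemidef.one.nonneg (hE1 q))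
    hu (by simp only [hk, ← hE₀, kronecker_sum, Matrix.kronecker_smul])
  refine le_trans (le_of_eq ?_) h
  refine Finset.sum_congr rfl fun p _ => ?_
  rw [hk, ← kronecker_sub, Matrix.conjTranspose_kronecker, ← Matrix.mul_kronecker_mul,
    Matrix.conjTranspose_one, Matrix.one_mul]

lemma Game.sum_disjointCopies_right {G : Game X Y A B} (hG : G.IsBiregular) (l : ℕ) (hl : 0 < l)
    (p : X × Fin l) : ∑ p', (G.disjointCopies l hl).μ p p' = 1 / (Fintype.card X * l) := by
  rw [Fintype.sum_prod_type]
  change ∑ y, ∑ j, (if p.2 = j then G.μ p.1 y / l else 0) = _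
  simp only [Finset.sum_ite_eq, Finset.mem_univ, if_true, ← Finset.sum_div, hG.1]
  rw [div_div]

lemma Game.sum_disjointCopies_left {G : Game X Y A B} (hG : G.IsBiregular) (l : ℕ) (hl : 0 < l)
    (p' : Y × Fin l) : ∑ p, (G.disjointCopies l hl).μ p p' = 1 / (Fintype.card Y * l) := by
  rw [Fintype.sum_prod_type]
  change ∑ x, ∑ i, (if i = p'.2 then G.μ x p'.1 / l else 0) = _
  simp only [Finset.sum_ite_eq', Finset.mem_univ, if_true, ← Finset.sum_div, hG.2]
  rw [div_div]

lemma QuantumSubstrategy.induced_totalA {M : BipGraph X' X} {P : BipGraph Y' Y} {l : ℕ}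
    (S : QuantumSubstrategy (M.OrdQuestion l) (P.OrdQuestion l) (M.OrdAnswer l A)
      (P.OrdAnswer l B))
    (hM : ∀ x, (M.conbr x).Nonempty) (hP : ∀ y, (P.conbr y).Nonempty)
    (hlM : M.maxDeg ≤ l) (hlP : P.maxDeg ≤ l) (p : X × Fin l) :
    (S.induced hM hP hlM hlP).totalA p = ∑ q, M.ordKernel l p q • S.totalA q :=
  M.sum_inducedOp l S.PA p

lemma QuantumSubstrategy.induced_totalB {M : BipGraph X' X} {P : BipGraph Y' Y} {l : ℕ}
    (S : QuantumSubstrategy (M.OrdQuestion l) (P.OrdQuestion l) (M.OrdAnswer l A)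
      (P.OrdAnswer l B))
    (hM : ∀ x, (M.conbr x).Nonempty) (hP : ∀ y, (P.conbr y).Nonempty)
    (hlM : M.maxDeg ≤ l) (hlP : P.maxDeg ≤ l) (p : Y × Fin l) :
    (S.induced hM hP hlM hlP).totalB p = ∑ w, P.ordKernel l p w • S.totalB w :=
  P.sum_inducedOp l S.PB p

lemma Game.value_eq_zero_of_isEmpty {Q W : Type*} [Fintype Q] [Fintype W] (Γ : Game Q W A B)
    (S : QuantumSubstrategy Q W (fun _ => A) (fun _ => B)) (h : IsEmpty A ∨ IsEmpty B) :
    Γ.toRefereed.value S = 0 := by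
  rw [Game.value_eq_winOp]
  refine Finset.sum_eq_zero fun q _ => Finset.sum_eq_zero fun w _ => ?_
  have : winOp (fun a b => Γ.V a b q w) (S.PA q) (S.PB w) = 0 := by
    unfold winOp
    rcases h with h | h
    · exact Fintype.sum_empty _
    · exact Finset.sum_eq_zero fun a _ => Fintype.sum_empty _
  rw [this, map_zero, mul_zero]

/-- As 56² = 16 · 196, each concentration error is 16 η² = ε⁴ δ² / 196. With τ = δ/8 the
regularization costs about δ/2, and the rounding error, with its factors 1/ε and 1/τ, stays below 72
δ / 196; all terms together are below δ. -/
lemma fortification_error_le {v T ε δ η : ℝ} (hv : v ≤ 1) (hε : 0 < ε) (hε1 : ε ≤ 1)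
    (hδ : 0 < δ) (hδ1 : δ ≤ 1) (hη : η = ε ^ 2 * δ / 56) :
    (v + ε) * (T + 2⁻¹ * (16 * η ^ 2 + 16 * η ^ 2) + (2 * (δ / 8) + (δ / 8) ^ 2))
      + (1 + 1 / ε) * (2 * ((δ / 8)⁻¹ * (1 + δ / 8)) * (16 * η ^ 2 + 16 * η ^ 2))
      ≤ (v + ε) * T + δ := by
  have hε4 : ε ^ 4 ≤ 1 := pow_le_one₀ hε.le hε1
  have hε3 : ε ^ 3 ≤ 1 := pow_le_one₀ hε.le hε1
  have hδ2 : δ ^ 2 ≤ δ := by nlinarith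
  have hk : 16 * η ^ 2 = ε ^ 4 * δ ^ 2 / 196 := by rw [hη]; ring
  have hk1 : 16 * η ^ 2 ≤ δ / 196 := by
    rw [hk]
    have : ε ^ 4 * δ ^ 2 ≤ 1 * δ := mul_le_mul hε4 hδ2 (by positivity) zero_le_one
    linarith
  have h1 : (v + ε) * (16 * η ^ 2 + (2 * (δ / 8) + (δ / 8) ^ 2))
      ≤ 2 * (δ / 196 + (δ / 4 + δ / 64)) := by
    have hb : 0 ≤ 16 * η ^ 2 + (2 * (δ / 8) + (δ / 8) ^ 2) := by positivity
    have hb2 : 16 * η ^ 2 + (2 * (δ / 8) + (δ / 8) ^ 2) ≤ δ / 196 + (δ / 4 + δ / 64) := by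
      nlinarith
    calc _ ≤ 2 * (16 * η ^ 2 + (2 * (δ / 8) + (δ / 8) ^ 2)) :=
          mul_le_mul_of_nonneg_right (by linarith) hb
      _ ≤ _ := by linarith
  have h2 : (1 + 1 / ε) * (2 * ((δ / 8)⁻¹ * (1 + δ / 8)) * (16 * η ^ 2 + 16 * η ^ 2))
      = (ε ^ 4 + ε ^ 3) * ((1 + δ / 8) * δ) * (32 / 196) := by
    rw [hk]
    field_simp
    ring
  have h3 : (ε ^ 4 + ε ^ 3) * ((1 + δ / 8) * δ) ≤ 2 * ((1 + 1 / 8) * δ) := by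
    refine mul_le_mul (by linarith) ?_ (by positivity) (by norm_num)
    exact mul_le_mul_of_nonneg_right (by linarith) hδ.le
  rw [h2]
  have e : (v + ε) * (T + 2⁻¹ * (16 * η ^ 2 + 16 * η ^ 2) + (2 * (δ / 8) + (δ / 8) ^ 2))
      = (v + ε) * T + (v + ε) * (16 * η ^ 2 + (2 * (δ / 8) + (δ / 8) ^ 2)) := by ring
  rw [e]
  nlinarith

/-- Ordered concatenation with spectral expanders fortifies against entangled substrategies. -/
theorem orderedConcatWeaklyFortified_of_isSpectralExpander (G : Game X Y A B)
    (M : BipGraph X' X) (P : BipGraph Y' Y) (hM : ∀ x, (M.conbr x).Nonempty)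
    (hP : ∀ y, (P.conbr y).Nonempty) {dM dP : ℕ} {lam ε δ : ℝ} (hε0 : 0 ≤ ε) (hε1 : ε ≤ 1)
    (hδ0 : 0 ≤ δ) (hδ1 : δ ≤ 1) (hG : G.IsBiregular) (hMexp : M.IsSpectralExpander dM lam)
    (hPexp : P.IsSpectralExpander dP lam) (hlam : lam ≤ ε ^ 2 * δ / 56)
    (hX : 1 ≤ (ε ^ 2 * δ / 56) ^ 2 * (Fintype.card X : ℝ))
    (hY : 1 ≤ (ε ^ 2 * δ / 56) ^ 2 * (Fintype.card Y : ℝ)) :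
    OrderedConcatWeaklyFortified G M P hM hP ε δ := by
  intro S
  obtain ⟨η, hη⟩ : ∃ η : ℝ, η = ε ^ 2 * δ / 56 := ⟨_, rfl⟩
  rw [← hη] at hlam hX hY
  -- The size condition on X excludes η = 0, and thereby ε = 0 and δ = 0.
  have hη0 : 0 < η := by
    refine lt_of_le_of_ne (by rw [hη]; positivity) fun h => ?_
    rw [← h] at hX
    norm_num at hX
  have hε : 0 < ε := lt_of_le_of_ne hε0 fun h => by
    rw [hη, ← h] at hη0; norm_num at hη0
  have hδ : 0 < δ := lt_of_le_of_ne hδ0 fun h => by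
    rw [hη, ← h] at hη0; norm_num at hη0
  have hη1 : η < 1 := by
    have : ε ^ 2 * δ ≤ 1 := mul_le_one₀ (pow_le_one₀ hε0 hε1) hδ0 hδ1
    rw [hη]; linarith
  have hlam0 : 0 ≤ lam := (LinearMap.singularValues_nonneg _ 1).trans hMexp.2
  have hlam2 : lam ^ 2 ≤ η ^ 2 := pow_le_pow_left₀ hlam0 hlam 2
  have hlam1 : lam < 1 := hlam.trans_lt hη1
  have hl := labelCount_pos G M P hM
  have hlM : M.maxDeg ≤ labelCount M P := le_max_left _ _
  have hlP : P.maxDeg ≤ labelCount M P := le_max_right _ _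
  have hl' : (labelCount M P : ℝ) ≠ 0 := by positivity
  have hX' : (Fintype.card X : ℝ) ≠ 0 := fun h0 => by
    rw [h0, mul_zero] at hX; linarith
  have hY' : (Fintype.card Y : ℝ) ≠ 0 := fun h0 => by
    rw [h0, mul_zero] at hY; linarith
  have hA0 : ∀ q, 0 ≤ S.totalA q := fun q =>
    Finset.sum_nonneg fun a _ => (S.PA_psd q a).nonneg
  have hB0 : ∀ w, 0 ≤ S.totalB w := fun w =>
    Finset.sum_nonneg fun b _ => (S.PB_psd w b).nonneg
  have hA1 : ∀ q, S.totalA q ≤ 1 := fun q => Matrix.le_iff.2 (S.PA_le q)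
  have hB1 : ∀ w, S.totalB w ≤ 1 := fun w => Matrix.le_iff.2 (S.PB_le w)
  let S' := S.induced hM hP hlM hlP
  let Γ := G.disjointCopies (labelCount M P) hl
  have hT : ∑ p, ∑ p', Γ.μ p p' * S.expect
        (∑ q, (M.ordKernel (labelCount M P) p q : ℂ) • S.totalA q)
        (∑ w, (P.ordKernel (labelCount M P) p' w : ℂ) • S.totalB w)
      = ∑ p, ∑ p', Γ.μ p p' * S'.expect (S'.totalA p) (S'.totalB p') := by
    refine Finset.sum_congr rfl fun p _ => Finset.sum_congr rfl fun p' _ => ?_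
    rw [S.induced_totalA, S.induced_totalB]
    simp only [Complex.coe_smul]
    rfl
  rw [value_orderedConcat]
  refine le_trans ?_ (add_le_add_left (mul_le_mul_of_nonneg_left hT.ge ?_) δ)
  -- Rounding needs some answer to absorb τ; if a player has none, the value is 0 and the bound is
  -- trivial.
  · by_cases hAB : Nonempty A ∧ Nonempty B
    · obtain ⟨hAne, hBne⟩ := hAB
      have hψ : quadForm S'.ψ 1 = 1 := S'.quadForm_one
      have hkA := hMexp.average_kronecker_left_sub_mean_le hM hlam1 hlam2 hη0 hX hlM hψ hA0 hA1
        (E' := S'.totalA) (S.induced_totalA hM hP hlM hlP)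
        (u := 1 / (Fintype.card X * labelCount M P)) (by field_simp) rfl
      have hkB := hPexp.average_kronecker_right_sub_mean_le hP hlam1 hlam2 hη0 hY hlP hψ hB0 hB1
        (E' := S'.totalB) (S.induced_totalB hM hP hlM hlP)
        (u := 1 / (Fintype.card Y * labelCount M P)) (by field_simp) rfl
      have h := Γ.value_le_of_concentration S' (τ := δ / 8) (kA := 16 * η ^ 2)
        (kB := 16 * η ^ 2) rfl rfl hε (by positivity) ?_ ?_
      · exact h.trans (fortification_error_le (RefereedGame.entangledValue_le_one _) hε hε1 hδ hδ1
          hη)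
      -- Biregularity makes the marginals of the inner game uniform over labeled questions, the law
      -- under which concentration was proved.
      · refine le_trans (le_of_eq ?_) hkA
        have e0 : ∑ p, ∑ p', Γ.μ p p' • S'.totalA p
            = ∑ p, (1 / (Fintype.card X * labelCount M P : ℝ)) • S'.totalA p :=
          Finset.sum_congr rfl fun p _ => by
            rw [← Finset.sum_smul, Game.sum_disjointCopies_right hG]
        rw [e0]
        refine Finset.sum_congr rfl fun p _ => ?_
        rw [← Finset.sum_mul, Game.sum_disjointCopies_right hG]
      · refine le_trans (le_of_eq ?_) hkB
        have e0 : ∑ p, ∑ p', Γ.μ p p' • S'.totalB p'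
            = ∑ p', (1 / (Fintype.card Y * labelCount M P : ℝ)) • S'.totalB p' := by
          rw [Finset.sum_comm]
          exact Finset.sum_congr rfl fun p _ => by
            rw [← Finset.sum_smul, Game.sum_disjointCopies_left hG]
        rw [e0, Finset.sum_comm]
        refine Finset.sum_congr rfl fun p _ => ?_
        rw [← Finset.sum_mul, Game.sum_disjointCopies_left hG]
    · rw [Game.value_eq_zero_of_isEmpty]
      · refine add_nonneg (mul_nonneg (add_nonneg (RefereedGame.entangledValue_nonneg _) hε0) ?_)
          hδ0
        refine Finset.sum_nonneg fun p _ => Finset.sum_nonneg fun p' _ =>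
          mul_nonneg (Γ.μ_nonneg p p') (quadForm_nonneg _ (kronecker_nonneg ?_ ?_))
        · exact Finset.sum_nonneg fun a _ => (S'.PA_psd p a).nonneg
        · exact Finset.sum_nonneg fun b _ => (S'.PB_psd p' b).nonneg
      · rwa [not_and_or, not_nonempty_iff, not_nonempty_iff] at hAB
  · exact add_nonneg (RefereedGame.entangledValue_nonneg _) hε0

end Fortification

theorem theorem3 {X Y X' Y' A B : Type*}
    [Fintype X] [Fintype Y] [Fintype X'] [Fintype Y'] [Fintype A] [Fintype B]
    [DecidableEq X] [DecidableEq Y] [DecidableEq X'] [DecidableEq Y']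
    (G : Game X Y A B) (M : BipGraph X' X) (P : BipGraph Y' Y)
    (hM : ∀ x, (M.conbr x).Nonempty) (hP : ∀ y, (P.conbr y).Nonempty) :
    (orderedConcat G M P hM hP).entangledValue = G.entangledValue ∧
    ∀ (dM dP : ℕ) (lam ε δ : ℝ), 0 ≤ ε → ε ≤ 1 → 0 ≤ δ → δ ≤ 1 →
      G.IsBiregular →
      M.IsSpectralExpander dM lam → P.IsSpectralExpander dP lam →
      lam ≤ ε ^ 2 * δ / 56 →
      1 ≤ (ε ^ 2 * δ / 56) ^ 2 * (Fintype.card X : ℝ) →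
      1 ≤ (ε ^ 2 * δ / 56) ^ 2 * (Fintype.card Y : ℝ) →
      OrderedConcatWeaklyFortified G M P hM hP ε δ := by
  refine ⟨le_antisymm (entangledValue_orderedConcat_le G M P hM hP)
    (entangledValue_le_orderedConcat G M P hM hP), ?_⟩
  intro dM dP lam ε δ hε0 hε1 hδ0 hδ1 hG hMexp hPexp hlam hX hY
  exact orderedConcatWeaklyFortified_of_isSpectralExpander G M P hM hP hε0 hε1 hδ0 hδ1 hG hMexp
    hPexp hlam hX hY
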